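/- **Theorem 2 (asymptotic large sieve).** Let $W:\mathbb{R}\to\mathbb{C}$ be a $C^\infty$ function supported in $[1,2]$, with Mellin transform $\hat W(s)=\int_0^\infty W(x)x^{s-1}\,dx$. Let $\eta>0$ and put $X=Q^{2-\eta}$, $Q\ge 1$. Let $(a_n)$, $(b_n)$ be sequences of complex numbers (which may depend on $Q$) such that for every $\varepsilon'>0$ $$\sum_{m\le u,\ (m,c)=1}a_{m\ell}\,\psi(m)\ll_{\varepsilon'}\ell^{-1/2}Q^{\varepsilon'},\qquad \sum_{m\le u,\ (m,c)=1}b_{m\ell}\,\psi(m)\ll_{\varepsilon'}\ell^{-1/2}Q^{\varepsilon'},$$ uniformly for all positive integers $c,\ell\le X$, all real $u\le X$ and all Dirichlet characters $\psi$ (primitive or not) to moduli at most $2Q$. Let $\varphi^*(q)$ be the number of primitive Dirichlet characters modulo $q$, let $\sum^{*}$ denote summation over primitive characters, and put $$S=\sum_{q}\frac{W(q/Q)}{\varphi(q)}\ {\sum_{\chi \bmod q}}^{*}\ \sum_{m,n\le X}a_mb_n\chi(m)\overline{\chi(n)}.$$ Then for every $0<\varepsilon<\eta/2$ $$S=\sum_{q}\frac{W(q/Q)\varphi^*(q)}{\varphi(q)}\sum_{\substack{n\le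 X\\(n,q)=1}}a_nb_n+O(Q^{1-\varepsilon}),$$ and also $$S=\hat W(1)\prod_p\Big(1-\frac1{p^2}-\frac1{p^3}\Big)\,Q\sum_{n\le X}a_nb_n\frac{\varphi(n)}{n}\prod_{p\mid n}\Big(1-\frac1{p^2}-\frac1{p^3}\Big)^{-1}+O(Q^{1-\varepsilon}).$$ Moreover, for every fixed positive integer $N$, the sum $S_N$ obtained from $S$ by restricting $q$ to $(q,N)=1$ satisfies $$S_N=\sum_{(q,N)=1}\frac{W(q/Q)\varphi^*(q)}{\varphi(q)}\sum_{\substack{n\le X\\(n,q)=1}}a_nb_n+O(Q^{1-\varepsilon})$$ and $$S_N=\hat W(1)\prod_p\Big(1-\frac1{p^2}-\frac1{p^3}\Big)\,Q\sum_{n\le X}a_nb_n\frac{\varphi(nN)}{nN}\prod_{p\mid nN}\Big(1-\frac1{p^2}-\frac1{p^3}\Big)^{-1}+O(Q^{1-\varepsilon}).$$ The implied constants depend only on $W$, $\eta$, $\varepsilon$, the implied constants in the hypotheses and, for $S_N$, on $N$. -/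

import Mathlib

open scoped ContDiff ComplexConjugate

noncomputable section

namespace AsymptoticLargeSieve

/-- The number `φ*(q)` of primitive Dirichlet characters modulo `q`. -/
def primitiveTotient (q : ℕ) : ℕ :=
  Nat.card {χ : DirichletCharacter ℂ q // χ.IsPrimitive}

open Classical in
/-- The sum over the primitive characters `χ` modulo `q` of
`∑_{m, n ≤ X} a_m b_n χ(m) conj (χ(n))`. -/
def primitiveSum (X : ℝ) (a b : ℕ → ℂ) (q : ℕ) : ℂ :=
  ∑ χ : DirichletCharacter ℂ q with χ.IsPrimitive,
    ∑ m ∈ Finset.Icc 1 ⌊X⌋₊, ∑ n ∈ Finset.Icc 1 ⌊X⌋₊,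
      a m * b n * χ (m : ZMod q) * conj (χ (n : ZMod q))

/-- The full smoothed sum `S` over all moduli `q`. -/
def S (W : ℝ → ℂ) (Q X : ℝ) (a b : ℕ → ℂ) : ℂ :=
  ∑' q : ℕ, W (q / Q) / (Nat.totient q : ℂ) * primitiveSum X a b q

/-- The smoothed sum `S_N`, over the moduli `q` coprime to `N`. -/
def SCoprime (N : ℕ) (W : ℝ → ℂ) (Q X : ℝ) (a b : ℕ → ℂ) : ℂ :=
  ∑' q : ℕ, if q.Coprime N then
    W (q / Q) / (Nat.totient q : ℂ) * primitiveSum X a b q else 0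

/-- `∑_{n ≤ X, (n, q) = 1} a_n b_n`. -/
def diagonalSum (X : ℝ) (a b : ℕ → ℂ) (q : ℕ) : ℂ :=
  ∑ n ∈ Finset.Icc 1 ⌊X⌋₊ with n.Coprime q, a n * b n

/-- The diagonal contribution to `S`. -/
def diagonal (W : ℝ → ℂ) (Q X : ℝ) (a b : ℕ → ℂ) : ℂ :=
  ∑' q : ℕ, W (q / Q) * (primitiveTotient q : ℂ) / (Nat.totient q : ℂ) * diagonalSum X a b q

/-- The diagonal contribution to `S_N`. -/
def diagonalCoprime (N : ℕ) (W : ℝ → ℂ) (Q X : ℝ) (a b : ℕ → ℂ) : ℂ :=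
  ∑' q : ℕ, if q.Coprime N then
    W (q / Q) * (primitiveTotient q : ℂ) / (Nat.totient q : ℂ) * diagonalSum X a b q else 0

/-- The Euler factor `1 - 1/p² - 1/p³`. -/
def eulerFactor (p : ℕ) : ℝ := 1 - 1 / (p : ℝ) ^ 2 - 1 / (p : ℝ) ^ 3

/-- The infinite product over all primes of `eulerFactor p` converges (absolutely), so that the
`∏'` below is the genuine product. -/
theorem multipliable_eulerFactor : Multipliable fun p : Nat.Primes => eulerFactor p := by
  have h2 : Summable fun n : ℕ => 1 / (n : ℝ) ^ 2 :=
    Real.summable_one_div_nat_pow.2 (by norm_num)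
  have h3 : Summable fun n : ℕ => 1 / (n : ℝ) ^ 3 :=
    Real.summable_one_div_nat_pow.2 (by norm_num)
  have h : Summable fun p : Nat.Primes => -(1 / ((p : ℕ) : ℝ) ^ 2) - 1 / ((p : ℕ) : ℝ) ^ 3 :=
    (h2.comp_injective Nat.Primes.coe_nat_injective).neg.sub
      (h3.comp_injective Nat.Primes.coe_nat_injective)
  have := Real.multipliable_one_add_of_summable h
  refine this.congr fun p => ?_
  simp only [eulerFactor]
  ring

/-- `r(n) = φ(n)/n · ∏_{p ∣ n} (1 - 1/p² - 1/p³)⁻¹`. -/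
def r (n : ℕ) : ℝ :=
  (Nat.totient n : ℝ) / n * ∏ p ∈ n.primeFactors, (eulerFactor p)⁻¹

/-- The main term with the sum over `q` coprime to `N` executed:
`Ŵ(1) ∏_p (1 - 1/p² - 1/p³) Q ∑_{n ≤ X} a_n b_n r(nN)`, where `Ŵ` is the Mellin transform
(so that `Ŵ(1) = ∫_0^∞ W(x) dx`). The unrestricted sum corresponds to `N = 1`. -/
def eulerMainTerm (N : ℕ) (W : ℝ → ℂ) (Q X : ℝ) (a b : ℕ → ℂ) : ℂ :=
  mellin W 1 * ((∏' p : Nat.Primes, eulerFactor p : ℝ) : ℂ) * (Q : ℂ) *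
    ∑ n ∈ Finset.Icc 1 ⌊X⌋₊, a n * b n * (r (n * N) : ℂ)

/-- The character sum bounds for the coefficients at the level `Q, X`, with the constants `K ε`:
for every `ε > 0`,
`|∑_{m ≤ u, (m, c) = 1} a_{mℓ} ψ(m)| ≤ K(ε) ℓ^{-1/2} Q^ε`
for all `c, ℓ, u ≤ X` and all Dirichlet characters `ψ`, primitive or not, to moduli `k ≤ 2Q`. -/
def CharSumBound (K : ℝ → ℝ) (Q X : ℝ) (a : ℕ → ℂ) : Prop :=
  ∀ ε : ℝ, 0 < ε → ∀ (c l k : ℕ) (u : ℝ), 1 ≤ c → 1 ≤ l → 1 ≤ k →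
    (c : ℝ) ≤ X → (l : ℝ) ≤ X → u ≤ X → (k : ℝ) ≤ 2 * Q →
    ∀ ψ : DirichletCharacter ℂ k,
      ‖∑ m ∈ Finset.Icc 1 ⌊u⌋₊ with m.Coprime c, a (m * l) * ψ (m : ZMod k)‖
        ≤ K ε * (l : ℝ) ^ (-(1 / 2) : ℝ) * Q ^ ε

end AsymptoticLargeSieve

end

noncomputable section

namespace AsymptoticLargeSieve

open Finset
open scoped ArithmeticFunction.Moebius

/-! ### Sums over Dirichlet characters -/

/-! For `m`, `n` coprime to `q`, Möbius inversion over conductors writes the correlation of the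
primitive characters modulo `q` as the sum over `q = c d` of `μ(c) φ(d)` times the indicator of `m ≡
n (mod d)` (`primitiveCorr_eq`). The pairs `m = n` give exactly the diagonal term. In the remaining
pairs `φ(d) / φ(c d) = rho c d / φ(c)`, and `∑ 1 / φ(c)` costs only a small power of `Q`, so it
suffices to bound the sum over `d` for each fixed `c` by `Q^(1 - η/2)` up to small powers. The
ranges of `c` are separated at `c0 = Q^(η/2) / √N`.

For `c > c0` there are at most `2 Q / c` relevant `d`. The congruence modulo `d` is detected by all
characters modulo `d`; the hypothesis makes each pair of character sums small, and averaging over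
the characters loses nothing (`norm_offDiagonal_le`).

For `c ≤ c0` the modulus is switched: `d` divides `m - n`, and after the coprimality conditions are
opened by Möbius sums, `d` is replaced by its complementary divisor `e`, which is at most `c X / Q`.
The new moduli divide `k l e` with `k ∣ c` and `l ∣ N`, so they stay admissible. The weight becomes
the smooth kernel `W(c (m - n) / (e Q))`; double summation by parts removes it at the cost of a
factor `1 + c M / (e Q)`, where `M = ⌊X⌋` (`exists_bilinear_bound`). The total is about `c X / Q`
(`norm_sum_upperOffDiagonal_le`). Since `X = Q^(2 - η)`, the choice of `c0` balances `Q / c0` with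
`c0 X / Q`.

For the Euler product form, the weight of `a_n b_n` in the diagonal is a sum over `q` coprime to `n
N`. The same factorization `q = c d` reduces it to Riemann sums of `W`, whose main terms form an
absolutely convergent Dirichlet series with an Euler product (`exists_diagonalWeight_bound`,
`tsum_eulerSummand`). -/

theorem conj_dirichletCharacter {d : ℕ} [NeZero d] (χ : DirichletCharacter ℂ d) (x : ZMod d) :
    conj (χ x) = χ⁻¹ x := by
  rw [← MulChar.star_eq_inv]
  rfl

theorem sum_dirichletCharacter_mul_conj {d : ℕ} [NeZero d] (m : ℕ) {n : ℕ} (hn : n.Coprime d) :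
    ∑ χ : DirichletCharacter ℂ d, χ (m : ZMod d) * conj (χ (n : ZMod d)) =
      if m ≡ n [MOD d] then (d.totient : ℂ) else 0 := by
  have hu : IsUnit (n : ZMod d) := (ZMod.isUnit_iff_coprime n d).2 hn
  have := DirichletCharacter.sum_char_inv_mul_char_eq ℂ hu (m : ZMod d)
  simp only [eq_comm (a := (n : ZMod d)), ZMod.natCast_eq_natCast_iff] at this
  rw [← this]
  refine Finset.sum_congr rfl fun χ _ => ?_
  rw [conj_dirichletCharacter, mul_comm, MulChar.inv_apply]
  obtain ⟨u, hu'⟩ := hu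
  rw [← hu', Ring.inverse_unit, ZMod.inv_coe_unit]

theorem changeLevel_natCast {d q : ℕ} (hd : d ∣ q) (χ : DirichletCharacter ℂ d) {m : ℕ}
    (hm : m.Coprime q) :
    DirichletCharacter.changeLevel hd χ (m : ZMod q) = χ (m : ZMod d) := by
  have h := DirichletCharacter.changeLevel_eq_cast_of_dvd' χ hd (a := (m : ℤ))
    (Nat.isCoprime_iff_coprime.2 hm)
  simpa using h

open Classical in
/-- The correlation `∑* χ(m) conj χ(n)` of the primitive characters modulo `q`. -/
def primitiveCorr (m n q : ℕ) : ℂ :=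
  ∑ χ : DirichletCharacter ℂ q with χ.IsPrimitive, χ (m : ZMod q) * conj (χ (n : ZMod q))

/-- Every character modulo `q` is induced by exactly one primitive character, modulo its conductor
`d ∣ q`, and the two agree at arguments coprime to `q`. Grouping by conductor reduces the claim to
orthogonality. -/
theorem sum_divisors_primitiveCorr {q m n : ℕ} (hq : q ≠ 0) (hm : m.Coprime q)
    (hn : n.Coprime q) :
    ∑ d ∈ q.divisors, primitiveCorr m n d =
      if m ≡ n [MOD q] then (q.totient : ℂ) else 0 := by
  classical
  have : NeZero q := ⟨hq⟩
  rw [← sum_dirichletCharacter_mul_conj m hn]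
  rw [← Finset.sum_fiberwise_of_maps_to (s := Finset.univ) (t := q.divisors)
    (g := fun χ : DirichletCharacter ℂ q => χ.conductor)
    (fun χ _ => Nat.mem_divisors.2 ⟨χ.conductor_dvd_level, hq⟩)]
  refine Finset.sum_congr rfl fun d hd => ?_
  have hdq := Nat.dvd_of_mem_divisors hd
  refine Finset.sum_bij (fun χ _ => DirichletCharacter.changeLevel hdq χ) ?_ ?_ ?_ ?_
  · intro χ hχ
    simp only [Finset.mem_filter, Finset.mem_univ, true_and] at hχ ⊢
    rw [DirichletCharacter.conductor_changeLevel]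
    exact hχ
  · intro χ _ χ' _ h
    exact DirichletCharacter.changeLevel_injective hdq h
  · intro ψ hψ
    simp only [Finset.mem_filter, Finset.mem_univ, true_and] at hψ
    subst hψ
    exact ⟨ψ.primitiveCharacter, by simpa using ψ.primitiveCharacter_isPrimitive,
      ψ.changeLevel_primitiveCharacter⟩
  · intro χ _
    rw [changeLevel_natCast hdq χ hm, changeLevel_natCast hdq χ hn]

/-- Möbius inversion of the preceding identity. It holds only for moduli coprime to `m` and `n`, a
set closed under divisors, which is all that the inversion needs. -/
theorem primitiveCorr_eq {q m n : ℕ} (hq : q ≠ 0) (hm : m.Coprime q) (hn : n.Coprime q) :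
    primitiveCorr m n q = ∑ x ∈ q.divisorsAntidiagonal,
      (μ x.1 : ℂ) * (if m ≡ n [MOD x.2] then (x.2.totient : ℂ) else 0) := by
  have key := (ArithmeticFunction.sum_eq_iff_sum_smul_moebius_eq_on
    (f := fun d => primitiveCorr m n d)
    (g := fun d => if m ≡ n [MOD d] then (d.totient : ℂ) else 0)
    {d | m.Coprime d ∧ n.Coprime d} (fun a b hab hb => ⟨hb.1.coprime_dvd_right hab,
      hb.2.coprime_dvd_right hab⟩)).1
    (fun d hd hd' => sum_divisors_primitiveCorr hd.ne' hd'.1 hd'.2) q (Nat.pos_of_ne_zero hq)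
    ⟨hm, hn⟩
  rw [← key]
  refine Finset.sum_congr rfl fun x _ => ?_
  rw [zsmul_eq_mul]

theorem primitiveCorr_eq_zero {q m n : ℕ} (h : ¬ (m.Coprime q ∧ n.Coprime q)) :
    primitiveCorr m n q = 0 := by
  refine Finset.sum_eq_zero fun χ _ => ?_
  rw [← ZMod.isUnit_iff_coprime, ← ZMod.isUnit_iff_coprime, not_and_or] at h
  rcases h with h | h
  · rw [χ.map_nonunit h, zero_mul]
  · rw [χ.map_nonunit h, map_zero, mul_zero]

theorem primitiveCorr_self {q n : ℕ} (hn : n.Coprime q) :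
    primitiveCorr n n q = primitiveTotient q := by
  classical
  have h : ∀ χ : DirichletCharacter ℂ q, χ (n : ZMod q) * conj (χ (n : ZMod q)) = 1 := by
    intro χ
    -- For `q = 0` coprimality forces `n = 1`.
    rcases eq_or_ne q 0 with rfl | hq
    · obtain rfl : n = 1 := by simpa using hn
      simp
    · have : NeZero q := ⟨hq⟩
      rw [conj_dirichletCharacter, ← MulChar.mul_apply, mul_inv_cancel,
        MulChar.one_apply ((ZMod.isUnit_iff_coprime n q).2 hn)]
  rw [primitiveCorr, Finset.sum_congr rfl fun χ _ => h χ, Finset.sum_const, nsmul_eq_mul, mul_one,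
    primitiveTotient, Nat.card_eq_fintype_card, Fintype.card_subtype]

theorem primitiveTotient_eq {q : ℕ} (hq : q ≠ 0) :
    (primitiveTotient q : ℂ) = ∑ x ∈ q.divisorsAntidiagonal, (μ x.1 : ℂ) * (x.2.totient : ℂ) := by
  rw [← primitiveCorr_self (Nat.coprime_one_left q),
    primitiveCorr_eq hq (Nat.coprime_one_left q) (Nat.coprime_one_left q)]
  simp [Nat.ModEq.refl]

theorem primitiveSum_eq (X : ℝ) (a b : ℕ → ℂ) (q : ℕ) :
    primitiveSum X a b q = ∑ m ∈ Finset.Icc 1 ⌊X⌋₊, ∑ n ∈ Finset.Icc 1 ⌊X⌋₊,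
      a m * b n * primitiveCorr m n q := by
  rw [primitiveSum, Finset.sum_comm]
  refine Finset.sum_congr rfl fun m _ => ?_
  rw [Finset.sum_comm]
  refine Finset.sum_congr rfl fun n _ => ?_
  rw [primitiveCorr, Finset.mul_sum]
  exact Finset.sum_congr rfl fun χ _ => by ring

/-- The primitive sum minus its diagonal part. -/
theorem primitiveSum_sub_diagonalSum (X : ℝ) (a b : ℕ → ℂ) (q : ℕ) :
    primitiveSum X a b q - primitiveTotient q * diagonalSum X a b q =
      ∑ m ∈ Finset.Icc 1 ⌊X⌋₊, ∑ n ∈ Finset.Icc 1 ⌊X⌋₊,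
        if m ≠ n then a m * b n * primitiveCorr m n q else 0 := by
  have h : (primitiveTotient q : ℂ) * diagonalSum X a b q =
      ∑ m ∈ Finset.Icc 1 ⌊X⌋₊, ∑ n ∈ Finset.Icc 1 ⌊X⌋₊,
        if m = n then a m * b n * primitiveCorr m n q else 0 := by
    rw [diagonalSum, Finset.sum_filter, Finset.mul_sum]
    refine Finset.sum_congr rfl fun m hm => ?_
    rw [Finset.sum_ite_eq, if_pos hm]
    split_ifs with hc
    · rw [primitiveCorr_self hc]; ring
    · rw [primitiveCorr_eq_zero (fun h => hc h.1)]; ring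
  rw [primitiveSum_eq, h, ← Finset.sum_sub_distrib]
  refine Finset.sum_congr rfl fun m _ => ?_
  rw [← Finset.sum_sub_distrib]
  refine Finset.sum_congr rfl fun n _ => ?_
  by_cases hmn : m = n <;> simp [hmn]

/-- Detecting a congruence modulo `E` with the Dirichlet characters to the moduli `E / g`. -/
theorem ite_modEq_eq_sum {E m n : ℕ} (hE : E ≠ 0) :
    (if m ≡ n [MOD E] then (1 : ℂ) else 0) =
      ∑ g ∈ E.divisors, if g ∣ m ∧ g ∣ n then
        ((E / g).totient : ℂ)⁻¹ * ∑ ψ : DirichletCharacter ℂ (E / g),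
          ψ ((m / g : ℕ) : ZMod (E / g)) * conj (ψ ((n / g : ℕ) : ZMod (E / g))) else 0 := by
  -- Only `g = gcd(E, n)` contributes: for any other common divisor `g`, the number `n / g` is not
  -- coprime to `E / g` and every character modulo `E / g` kills it.
  have hterm : ∀ g ∈ E.divisors, (if g ∣ m ∧ g ∣ n then
        ((E / g).totient : ℂ)⁻¹ * ∑ ψ : DirichletCharacter ℂ (E / g),
          ψ ((m / g : ℕ) : ZMod (E / g)) * conj (ψ ((n / g : ℕ) : ZMod (E / g))) else 0) =
      if g = E.gcd n then (if m ≡ n [MOD E] then (1 : ℂ) else 0) else 0 := by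
    intro g hg
    have hgE := Nat.dvd_of_mem_divisors hg
    have hg0 : 0 < g := Nat.pos_of_mem_divisors hg
    have hEg : 0 < E / g := Nat.div_pos (Nat.le_of_dvd (Nat.pos_of_ne_zero hE) hgE) hg0
    by_cases hmn : g ∣ m ∧ g ∣ n
    · rw [if_pos hmn]
      obtain ⟨⟨m', rfl⟩, ⟨n', rfl⟩⟩ := hmn
      obtain ⟨E', rfl⟩ := hgE
      simp only [Nat.mul_div_cancel_left m' hg0, Nat.mul_div_cancel_left n' hg0, Nat.gcd_mul_left]
      have e := Nat.mul_div_cancel_left E' hg0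
      -- The modulus occurs in types, so the quotient is made a variable before it is identified
      -- with `E'`.
      generalize g * E' / g = F at e hEg ⊢
      subst e
      have : NeZero F := ⟨hEg.ne'⟩
      have hgcd : g = g * F.gcd n' ↔ n'.Coprime F := by
        rw [eq_comm, Nat.mul_eq_left hg0.ne', Nat.gcd_comm, Nat.coprime_iff_gcd_eq_one]
      simp only [hgcd]
      by_cases hc : n'.Coprime F
      · rw [sum_dirichletCharacter_mul_conj m' hc, if_pos hc]
        have : g * m' ≡ g * n' [MOD g * F] ↔ m' ≡ n' [MOD F] :=
          ⟨fun h => Nat.ModEq.mul_left_cancel' hg0.ne' h, fun h => Nat.ModEq.mul_left' g h⟩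
        simp only [this]
        split_ifs
        · exact inv_mul_cancel₀ (by exact_mod_cast (Nat.totient_pos.2 hEg).ne')
        · simp
      · rw [if_neg hc, Finset.sum_eq_zero, mul_zero]
        intro χ _
        rw [χ.map_nonunit (a := (n' : ZMod F)) (by rwa [ZMod.isUnit_iff_coprime]),
          map_zero, mul_zero]
    · rw [if_neg hmn]
      by_cases h : g = E.gcd n
      · rw [if_pos h, if_neg]
        intro hm
        refine hmn ⟨?_, h ▸ Nat.gcd_dvd_right E n⟩
        exact (Nat.ModEq.dvd_iff hm hgE).2 (h ▸ Nat.gcd_dvd_right E n)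
      · rw [if_neg h]
  rw [Finset.sum_congr rfl hterm, Finset.sum_ite_eq', if_pos (show E.gcd n ∈ E.divisors from ?_)]
  exact Nat.mem_divisors.2 ⟨Nat.gcd_dvd_left E n, hE⟩

/-! ### Möbius sums -/

theorem sum_divisors_moebius_dvd (L : ℕ) {d : ℕ} (hL : L ≠ 0) :
    ∑ l ∈ L.divisors, (if l ∣ d then (μ l : ℂ) else 0) = if d.Coprime L then 1 else 0 := by
  have h1 : ∑ l ∈ (d.gcd L).divisors, μ l = if d.gcd L = 1 then 1 else 0 := by
    rw [← ArithmeticFunction.coe_mul_zeta_apply, ArithmeticFunction.moebius_mul_coe_zeta,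
      ArithmeticFunction.one_apply]
  have h2 : L.divisors.filter (· ∣ d) = (d.gcd L).divisors := by
    ext l
    simp only [mem_filter, Nat.mem_divisors, Nat.dvd_gcd_iff]
    have : d.gcd L ≠ 0 := fun h => hL (Nat.eq_zero_of_gcd_eq_zero_right h)
    tauto
  rw [← Finset.sum_filter, h2, ← Int.cast_sum, h1]
  simp [Nat.Coprime]

theorem sum_divisors_moebius_div (n : ℕ) (hn : n ≠ 0) :
    ∑ k ∈ n.divisors, (μ k : ℂ) / k = (n.totient : ℂ) / n := by
  have h := (ArithmeticFunction.sum_eq_iff_sum_mul_moebius_eq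
    (f := fun n => (n.totient : ℂ)) (g := fun n => (n : ℂ))).1
    (fun n _ => by exact_mod_cast Nat.sum_totient n) n (Nat.pos_of_ne_zero hn)
  rw [← h, Nat.sum_divisorsAntidiagonal (f := fun i j => (μ i : ℂ) * (j : ℂ)), Finset.sum_div]
  refine Finset.sum_congr rfl fun k hk => ?_
  have hk0 : (k : ℂ) ≠ 0 := by exact_mod_cast (Nat.pos_of_mem_divisors hk).ne'
  have hn0 : (n : ℂ) ≠ 0 := by exact_mod_cast hn
  rw [Nat.cast_div (Nat.dvd_of_mem_divisors hk) hk0]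
  field_simp

/-- `rho c d = φ(c) φ(d) / φ(c d)`, written as a sum over the common divisors of `c` and `d`. -/
def rho (c d : ℕ) : ℂ := ∑ k ∈ c.divisors, if k ∣ d then (μ k : ℂ) / k else 0

/-- Rests on `φ(gcd) φ(c d) = φ(c) φ(d) gcd` and on `φ(g) / g = ∑ μ(k) / k` over `k ∣ g`. The gain
is that `d` enters only through the conditions `k ∣ d` with `k ∣ c`. -/
theorem rho_eq {c d : ℕ} (hc : c ≠ 0) (hd : d ≠ 0) :
    (d.totient : ℂ) / ((c * d).totient : ℂ) = rho c d / c.totient := by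
  have h2 : c.divisors.filter (· ∣ d) = (c.gcd d).divisors := by
    ext l
    simp only [mem_filter, Nat.mem_divisors, Nat.dvd_gcd_iff]
    have : c.gcd d ≠ 0 := fun h => hc (Nat.eq_zero_of_gcd_eq_zero_left h)
    tauto
  have hg : c.gcd d ≠ 0 := fun h => hc (Nat.eq_zero_of_gcd_eq_zero_left h)
  rw [rho, ← Finset.sum_filter, h2, sum_divisors_moebius_div _ hg]
  have h := congrArg (Nat.cast : ℕ → ℂ) (Nat.totient_gcd_mul_totient_mul c d)
  push_cast at h
  have e1 : (c.totient : ℂ) ≠ 0 := by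
    exact_mod_cast (Nat.totient_pos.2 (Nat.pos_of_ne_zero hc)).ne'
  have e2 : ((c * d).totient : ℂ) ≠ 0 := by
    exact_mod_cast (Nat.totient_pos.2 (Nat.pos_of_ne_zero (mul_ne_zero hc hd))).ne'
  have e3 : ((c.gcd d : ℕ) : ℂ) ≠ 0 := by exact_mod_cast hg
  rw [div_eq_div_iff e2 e1, div_mul_eq_mul_div, eq_div_iff e3]
  linear_combination -h

theorem rho_mul_of_coprime {c j : ℕ} (d : ℕ) (h : j.Coprime c) : rho c (j * d) = rho c d := by
  refine Finset.sum_congr rfl fun k hk => ?_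
  have : k.Coprime j := (h.coprime_dvd_right (Nat.dvd_of_mem_divisors hk)).symm
  simp only [this.dvd_mul_left]

/-- Since `c` is coprime to `N`, so are `k` and `l`, and the conditions `k ∣ d` and `l ∣ d` merge
into one divisibility by `k * l`. -/
theorem ite_coprime_mul_rho {c N : ℕ} (hN : N ≠ 0) (h : c.Coprime N) (d : ℕ) :
    (if d.Coprime N then rho c d else 0) =
      ∑ k ∈ c.divisors, ∑ l ∈ N.divisors,
        (μ k : ℂ) / k * μ l * (if k * l ∣ d then 1 else 0) := by
  have : (if d.Coprime N then rho c d else 0) = rho c d * (if d.Coprime N then 1 else 0) := by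
    simp
  rw [this, ← sum_divisors_moebius_dvd N hN, rho, Finset.sum_mul_sum]
  refine Finset.sum_congr rfl fun k hk => Finset.sum_congr rfl fun l hl => ?_
  have hkl : k.Coprime l := Nat.Coprime.of_dvd (Nat.dvd_of_mem_divisors hk)
    (Nat.dvd_of_mem_divisors hl) h
  have hiff : k * l ∣ d ↔ k ∣ d ∧ l ∣ d :=
    ⟨fun h => ⟨(dvd_mul_right k l).trans h, (dvd_mul_left l k).trans h⟩,
      fun h => hkl.mul_dvd_of_dvd_of_dvd h.1 h.2⟩
  by_cases h1 : k ∣ d <;> by_cases h2 : l ∣ d <;> simp [h1, h2, hiff]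

theorem norm_moebius_le_one (k : ℕ) : ‖(μ k : ℂ)‖ ≤ 1 := by
  rw [Complex.norm_intCast]
  exact_mod_cast ArithmeticFunction.abs_moebius_le_one (n := k)

/-! ### Reindexing -/

theorem sum_Icc_dvd (f : ℕ → ℂ) (M : ℕ) {t : ℕ} (ht : 0 < t) :
    ∑ m ∈ Icc 1 M, (if t ∣ m then f m else 0) = ∑ m ∈ Icc 1 (M / t), f (t * m) := by
  rw [← Finset.sum_filter]
  symm
  refine Finset.sum_bij (fun m _ => t * m) ?_ ?_ ?_ ?_
  · intro m hm
    rw [mem_Icc] at hm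
    rw [mem_filter, mem_Icc]
    refine ⟨⟨Nat.mul_pos ht hm.1, ?_⟩, dvd_mul_right _ _⟩
    rw [mul_comm]
    exact (Nat.le_div_iff_mul_le ht).1 hm.2
  · intro m _ n _ h
    exact Nat.eq_of_mul_eq_mul_left ht h
  · intro m hm
    rw [mem_filter, mem_Icc] at hm
    obtain ⟨⟨h1, h2⟩, n, rfl⟩ := hm
    refine ⟨n, mem_Icc.2 ⟨Nat.pos_of_mul_pos_left h1, ?_⟩, rfl⟩
    rw [Nat.le_div_iff_mul_le ht, mul_comm]
    exact h2
  · intro _ _; rfl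

/-- A sum over `q` of sums over the factorizations of `q`, in a range that contains the support. -/
theorem sum_Icc_divisorsAntidiagonal (f : ℕ → ℕ → ℂ) (R : ℕ)
    (hf : ∀ c d, R < c * d → f c d = 0) :
    ∑ q ∈ Icc 1 R, ∑ x ∈ q.divisorsAntidiagonal, f x.1 x.2 =
      ∑ c ∈ Icc 1 R, ∑ d ∈ Icc 1 R, f c d := by
  rw [Finset.sum_sigma', ← Finset.sum_product',
    ← Finset.sum_filter_of_ne (s := Icc 1 R ×ˢ Icc 1 R) (p := fun x => x.1 * x.2 ≤ R)]
  · refine Finset.sum_bij (fun x _ => x.2) ?_ ?_ ?_ ?_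
    · rintro ⟨q, c, d⟩ h
      simp only [mem_sigma, mem_Icc, Nat.mem_divisorsAntidiagonal, mem_filter, mem_product] at h ⊢
      obtain ⟨⟨h1, h2⟩, rfl, h3⟩ := h
      have hc : 0 < c := Nat.pos_of_ne_zero fun h => h3 (by simp [h])
      have hd : 0 < d := Nat.pos_of_ne_zero fun h => h3 (by simp [h])
      exact ⟨⟨⟨hc, (Nat.le_mul_of_pos_right c hd).trans h2⟩,
        ⟨hd, (Nat.le_mul_of_pos_left d hc).trans h2⟩⟩, h2⟩
    · rintro ⟨q, c, d⟩ h ⟨q', c', d'⟩ h' e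
      simp only [mem_sigma, mem_Icc, Nat.mem_divisorsAntidiagonal] at h h'
      simp only [Prod.mk.injEq] at e
      obtain ⟨rfl, rfl⟩ := e
      obtain rfl : q = q' := h.2.1.symm.trans h'.2.1
      rfl
    · rintro ⟨c, d⟩ h
      simp only [mem_Icc, mem_filter, mem_product] at h
      refine ⟨⟨c * d, c, d⟩, ?_, rfl⟩
      simp only [mem_sigma, mem_Icc, Nat.mem_divisorsAntidiagonal]
      have : 0 < c * d := Nat.mul_pos h.1.1.1 h.1.2.1
      exact ⟨⟨this, h.2⟩, trivial, this.ne'⟩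
    · intro _ _; rfl
  · intro x _ hx
    by_contra h
    exact hx (hf _ _ (not_le.1 h))

/-! ### Switching to the complementary divisor -/

/-- For `h ≥ 1`, the divisors of `h` that are multiples of `v` are the `h / e` with `v e ∣ h`. -/
theorem sum_divisors_switch {h v Z : ℕ} (hh : h ≠ 0) (V : ℝ → ℂ)
    (hZ : ∀ e : ℕ, Z < e → V ((h : ℝ) / e) = 0) :
    ∑ d ∈ h.divisors, (if v ∣ d then V d else 0) =
      ∑ e ∈ Icc 1 Z, (if v * e ∣ h then V ((h : ℝ) / e) else 0) := by
  rw [← Nat.sum_div_divisors h fun d => if v ∣ d then V d else 0]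
  have h1 : ∀ e ∈ h.divisors, (if v ∣ h / e then V ((h / e : ℕ) : ℝ) else 0) =
      if v * e ∣ h then V ((h : ℝ) / e) else 0 := by
    intro e he
    have he0 : e ≠ 0 := (Nat.pos_of_mem_divisors he).ne'
    have hdvd := Nat.dvd_of_mem_divisors he
    rw [Nat.cast_div hdvd (by exact_mod_cast he0)]
    have : v ∣ h / e ↔ v * e ∣ h := by
      rw [Nat.dvd_div_iff_mul_dvd hdvd, mul_comm]
    simp only [this]
  rw [Finset.sum_congr rfl h1, ← Finset.sum_filter, ← Finset.sum_filter]
  refine (Finset.sum_subset_zero_on_sdiff (s₁ := (Icc 1 Z).filter (fun e => v * e ∣ h))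
    ?_ ?_ fun _ _ => rfl).symm
  · intro e he
    rw [mem_filter, mem_Icc] at he
    rw [mem_filter, Nat.mem_divisors]
    exact ⟨⟨(dvd_mul_left e v).trans he.2, hh⟩, he.2⟩
  · intro e he
    rw [mem_sdiff, mem_filter, mem_filter, mem_Icc, Nat.mem_divisors] at he
    refine hZ e ?_
    by_contra hlt
    refine he.2 ⟨⟨Nat.pos_of_dvd_of_pos he.1.1.1 (Nat.pos_of_ne_zero hh), not_lt.1 hlt⟩, he.1.2⟩

theorem sum_divisors_rho_switch {h c N Z : ℕ} (hh : h ≠ 0) (hN : N ≠ 0)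
    (hcN : c.Coprime N) (V : ℝ → ℂ) (hZ : ∀ e : ℕ, Z < e → V ((h : ℝ) / e) = 0) :
    ∑ d ∈ h.divisors, (if d.Coprime N then rho c d else 0) * V d =
      ∑ k ∈ c.divisors, ∑ l ∈ N.divisors, (μ k : ℂ) / k * μ l *
        ∑ e ∈ Icc 1 Z, (if k * l * e ∣ h then V ((h : ℝ) / e) else 0) := by
  have h1 : ∀ k ∈ c.divisors, ∀ l ∈ N.divisors, (μ k : ℂ) / k * μ l *
        ∑ e ∈ Icc 1 Z, (if k * l * e ∣ h then V ((h : ℝ) / e) else 0) =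
      ∑ d ∈ h.divisors, (μ k : ℂ) / k * μ l * (if k * l ∣ d then 1 else 0) * V d := by
    intro k _ l _
    rw [← sum_divisors_switch hh V hZ, Finset.mul_sum]
    refine Finset.sum_congr rfl fun d _ => ?_
    by_cases hd : k * l ∣ d <;> simp [hd]
  rw [Finset.sum_congr rfl fun k hk => Finset.sum_congr rfl fun l hl => h1 k hk l hl]
  simp_rw [ite_coprime_mul_rho hN hcN, Finset.sum_mul]
  rw [Finset.sum_comm]
  exact Finset.sum_congr rfl fun k _ => Finset.sum_comm

/-- Coprimality of `d` and `m` is opened by a Möbius sum over `j ∣ m`, `j ∣ d`. As `d ∣ m - n`, also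
`j ∣ n`, and everything can be divided by `j` before switching divisors. Since `m` is coprime to
`c`, so is `j`, which leaves `rho c` unchanged. The range of `j` on the right does not depend on `m`
and `n`, so that this sum can later be taken outside. -/
theorem sum_divisors_coprime_switch {m n c N Z M : ℕ} (hmn : n < m) (hn : 0 < n) (hmM : m ≤ M)
    (hN : N ≠ 0) (hcN : c.Coprime N) (hmc : m.Coprime c) (V : ℝ → ℂ)
    (hZ : ∀ e : ℕ, Z < e → V (((m : ℝ) - n) / e) = 0) :
    ∑ d ∈ (m - n).divisors,
        (if d.Coprime N ∧ d.Coprime m then rho c d * V d else 0) =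
      ∑ j ∈ Icc 1 M, if j.Coprime N ∧ j ∣ m ∧ j ∣ n then (μ j : ℂ) *
        ∑ k ∈ c.divisors, ∑ l ∈ N.divisors, (μ k : ℂ) / k * μ l *
          ∑ e ∈ Icc 1 Z,
            (if m / j ≡ n / j [MOD k * l * e] then V (((m : ℝ) - n) / e) else 0) else 0 := by
  have hm0 : m ≠ 0 := by omega
  have hh : m - n ≠ 0 := by omega
  have hcast : ((m - n : ℕ) : ℝ) = (m : ℝ) - n := by rw [Nat.cast_sub hmn.le]
  have h1 : ∀ d ∈ (m - n).divisors,
      (if d.Coprime N ∧ d.Coprime m then rho c d * V d else 0) =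
      ∑ j ∈ m.divisors, (μ j : ℂ) * (if j ∣ d then
        (if d.Coprime N then rho c d else 0) * V d else 0) := by
    intro d _
    have : ∑ j ∈ m.divisors, (μ j : ℂ) * (if j ∣ d then
        (if d.Coprime N then rho c d else 0) * V d else 0) =
        (∑ j ∈ m.divisors, (if j ∣ d then (μ j : ℂ) else 0)) *
          ((if d.Coprime N then rho c d else 0) * V d) := by
      rw [Finset.sum_mul]
      refine Finset.sum_congr rfl fun j _ => ?_
      split_ifs <;> ring
    rw [this, sum_divisors_moebius_dvd m hm0]
    rw [ite_and]
    split_ifs <;> simp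
  rw [Finset.sum_congr rfl h1, Finset.sum_comm]
  refine Finset.sum_subset_zero_on_sdiff ?_ ?_ ?_
  · intro j hj
    rw [mem_Icc]
    exact ⟨Nat.pos_of_mem_divisors hj, (Nat.divisor_le hj).trans hmM⟩
  · intro j hj
    rw [mem_sdiff, Nat.mem_divisors] at hj
    rw [if_neg]
    exact fun h => hj.2 ⟨h.2.1, hm0⟩
  · intro j hj
    have hjm := Nat.dvd_of_mem_divisors hj
    have hj0 : 0 < j := Nat.pos_of_mem_divisors hj
    -- If `j ∤ n`, no divisor of `m - n` is a multiple of `j`, and both sides vanish.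
    by_cases hjn : j ∣ n
    swap
    · rw [if_neg (fun h => hjn h.2.2)]
      refine Finset.sum_eq_zero fun d hd => ?_
      rw [if_neg, mul_zero]
      intro hjd
      exact hjn ((Nat.dvd_sub_iff_right hmn.le hjm).1
        (hjd.trans (Nat.dvd_of_mem_divisors hd)))
    obtain ⟨m', rfl⟩ := hjm
    obtain ⟨n', rfl⟩ := hjn
    have hmn' : n' < m' := Nat.lt_of_mul_lt_mul_left hmn
    have hsub : j * m' - j * n' = j * (m' - n') := (Nat.mul_sub j m' n').symm
    have hh' : m' - n' ≠ 0 := by omega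
    have hjc : j.Coprime c := Nat.Coprime.coprime_dvd_left (dvd_mul_right j m') hmc
    rw [← Finset.mul_sum]
    have h2 : ∑ d ∈ (j * m' - j * n').divisors, (if j ∣ d then
          (if d.Coprime N then rho c d else 0) * V d else 0) =
        if j.Coprime N then ∑ d ∈ (m' - n').divisors,
          (if d.Coprime N then rho c d else 0) * V (j * d) else 0 := by
      rw [← Finset.sum_filter, hsub]
      have h3 : ∑ d ∈ (j * (m' - n')).divisors.filter (j ∣ ·),
          (if d.Coprime N then rho c d else 0) * V d =
          ∑ d ∈ (m' - n').divisors,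
          (if (j * d).Coprime N then rho c (j * d) else 0) * V ((j * d : ℕ) : ℝ) := by
        symm
        refine Finset.sum_bij (fun d _ => j * d) ?_ ?_ ?_ ?_
        · intro d hd
          rw [mem_filter, Nat.mem_divisors]
          exact ⟨⟨Nat.mul_dvd_mul_left j (Nat.dvd_of_mem_divisors hd), mul_ne_zero hj0.ne' hh'⟩,
            dvd_mul_right _ _⟩
        · intro d _ d' _ h
          exact Nat.eq_of_mul_eq_mul_left hj0 h
        · intro d hd
          rw [mem_filter, Nat.mem_divisors] at hd
          obtain ⟨⟨h4, h5⟩, d', rfl⟩ := hd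
          exact ⟨d', Nat.mem_divisors.2 ⟨Nat.dvd_of_mul_dvd_mul_left hj0 h4, hh'⟩, rfl⟩
        · intro _ _; rfl
      rw [h3]
      by_cases hjN : j.Coprime N
      · rw [if_pos hjN]
        refine Finset.sum_congr rfl fun d _ => ?_
        rw [rho_mul_of_coprime d hjc, Nat.cast_mul]
        have : (j * d).Coprime N ↔ d.Coprime N := by
          rw [Nat.coprime_mul_iff_left]
          exact and_iff_right hjN
        simp only [this]
      · rw [if_neg hjN]
        refine Finset.sum_eq_zero fun d _ => ?_
        rw [if_neg, zero_mul]
        exact fun h => hjN (Nat.Coprime.coprime_dvd_left (dvd_mul_right j d) h)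
    rw [h2]
    by_cases hjN : j.Coprime N
    swap
    · rw [if_neg hjN, if_neg (fun h => hjN h.1), mul_zero]
    rw [if_pos hjN, if_pos ⟨hjN, dvd_mul_right _ _, dvd_mul_right _ _⟩]
    -- The weight does not see `j`: its argument `j * d'` with `d' = (m' - n') / e` is again `(m -
    -- n) / e`.
    have hcast' : ∀ e : ℕ, (j : ℝ) * (((m' - n' : ℕ) : ℝ) / e) =
        (((j * m' : ℕ) : ℝ) - ((j * n' : ℕ) : ℝ)) / e := by
      intro e
      rw [Nat.cast_sub hmn'.le]
      push_cast
      ring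
    rw [sum_divisors_rho_switch hh' hN hcN (fun x => V (j * x)) (Z := Z)]
    · rw [Nat.mul_div_cancel_left _ hj0, Nat.mul_div_cancel_left _ hj0]
      refine congrArg _ (Finset.sum_congr rfl fun k _ => Finset.sum_congr rfl fun l _ =>
        congrArg _ (Finset.sum_congr rfl fun e _ => ?_))
      rw [hcast']
      have : k * l * e ∣ m' - n' ↔ m' ≡ n' [MOD k * l * e] :=
        ((Nat.modEq_iff_dvd' hmn'.le).symm).trans ⟨Nat.ModEq.symm, Nat.ModEq.symm⟩
      simp only [this]
    · intro e he
      rw [hcast']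
      exact hZ e he

/-! ### Summation by parts -/

theorem sum_mul_eq_sum_partial (α f : ℕ → ℂ) (M : ℕ) :
    ∑ m ∈ Icc 1 M, α m * f m =
      ∑ m ∈ Icc 1 M, (∑ i ∈ Icc 1 m, α i) * (f m - f (m + 1)) +
        (∑ i ∈ Icc 1 M, α i) * f (M + 1) := by
  induction M with
  | zero => simp
  | succ M ih =>
    rw [Finset.sum_Icc_succ_top (by omega), ih, Finset.sum_Icc_succ_top (by omega)]
    rw [Finset.sum_Icc_succ_top (b := M) (by omega) α]
    ring

theorem norm_sum_mul_le_of_partial {α f : ℕ → ℂ} {M : ℕ} {A : ℝ}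
    (hα : ∀ u ≤ M, ‖∑ m ∈ Icc 1 u, α m‖ ≤ A) :
    ‖∑ m ∈ Icc 1 M, α m * f m‖ ≤ A * (∑ m ∈ Icc 1 M, ‖f m - f (m + 1)‖ + ‖f (M + 1)‖) := by
  rw [sum_mul_eq_sum_partial, mul_add, Finset.mul_sum]
  refine (norm_add_le _ _).trans (add_le_add ((norm_sum_le _ _).trans ?_) ?_)
  · refine Finset.sum_le_sum fun m hm => ?_
    rw [norm_mul]
    exact mul_le_mul_of_nonneg_right (hα m (mem_Icc.1 hm).2) (norm_nonneg _)
  · rw [norm_mul]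
    exact mul_le_mul_of_nonneg_right (hα M le_rfl) (norm_nonneg _)

/-- One-variable partial summation in `n`, with the inner sum over `m` as the weight, followed by
partial summation in `m` for its differences. What remains is the total mixed variation of `F` and
its boundary terms. -/
theorem norm_sum_sum_mul_le_of_partial {α β : ℕ → ℂ} {F : ℕ → ℕ → ℂ} {M : ℕ} {A B : ℝ}
    (hα : ∀ u ≤ M, ‖∑ m ∈ Icc 1 u, α m‖ ≤ A) (hβ : ∀ u ≤ M, ‖∑ m ∈ Icc 1 u, β m‖ ≤ B) :
    ‖∑ m ∈ Icc 1 M, ∑ n ∈ Icc 1 M, α m * β n * F m n‖ ≤ A * B *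
      (∑ n ∈ Icc 1 M, (∑ m ∈ Icc 1 M,
          ‖F m n - F m (n + 1) - (F (m + 1) n - F (m + 1) (n + 1))‖ +
          ‖F (M + 1) n - F (M + 1) (n + 1)‖) +
        (∑ m ∈ Icc 1 M, ‖F m (M + 1) - F (m + 1) (M + 1)‖ + ‖F (M + 1) (M + 1)‖)) := by
  have hB : 0 ≤ B := (norm_nonneg _).trans (hβ 0 (Nat.zero_le M))
  have hA : 0 ≤ A := (norm_nonneg _).trans (hα 0 (Nat.zero_le M))
  have h1 : ∑ m ∈ Icc 1 M, ∑ n ∈ Icc 1 M, α m * β n * F m n =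
      ∑ n ∈ Icc 1 M, β n * ∑ m ∈ Icc 1 M, α m * F m n := by
    rw [Finset.sum_comm]
    refine Finset.sum_congr rfl fun n _ => ?_
    rw [Finset.mul_sum]
    exact Finset.sum_congr rfl fun m _ => by ring
  rw [h1]
  refine (norm_sum_mul_le_of_partial hβ).trans ?_
  rw [mul_comm A B, mul_assoc B A]
  refine mul_le_mul_of_nonneg_left ?_ hB
  rw [mul_add, Finset.mul_sum]
  refine add_le_add (Finset.sum_le_sum fun n _ => ?_) (norm_sum_mul_le_of_partial hα)
  rw [← Finset.sum_sub_distrib]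
  simp_rw [← mul_sub]
  exact norm_sum_mul_le_of_partial hα

/-! ### Bounds for the test function -/

section TestFunction

variable {W : ℝ → ℂ}

theorem hasCompactSupport_of_support_subset (hWsupp : Function.support W ⊆ Set.Icc 1 2) :
    HasCompactSupport W :=
  HasCompactSupport.intro isCompact_Icc fun x hx => by
    by_contra h
    exact hx (hWsupp h)

theorem eq_zero_of_lt_one (hWsupp : Function.support W ⊆ Set.Icc 1 2) {x : ℝ} (hx : x < 1) :
    W x = 0 := by
  by_contra h
  exact absurd (hWsupp h).1 (not_le.2 hx)

theorem eq_zero_of_two_lt (hWsupp : Function.support W ⊆ Set.Icc 1 2) {x : ℝ} (hx : 2 < x) :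
    W x = 0 := by
  by_contra h
  exact absurd (hWsupp h).2 (not_le.2 hx)

/-- A common bound for `W`, its first and its second differences. -/
theorem exists_differences_bound (hW : ContDiff ℝ ∞ W)
    (hWsupp : Function.support W ⊆ Set.Icc 1 2) :
    ∃ B : ℝ, 0 ≤ B ∧ (∀ x, ‖W x‖ ≤ B) ∧ (∀ x y, ‖W y - W x‖ ≤ B * |y - x|) ∧
      ∀ x h, ‖W (x + h) - W x - (W x - W (x - h))‖ ≤ B * h ^ 2 := by
  have hc := hasCompactSupport_of_support_subset hWsupp
  have hW1 : ContDiff ℝ ∞ (deriv W) := (contDiff_infty_iff_deriv.1 hW).2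
  have hW2 : ContDiff ℝ ∞ (deriv (deriv W)) := (contDiff_infty_iff_deriv.1 hW1).2
  obtain ⟨B0, h0⟩ := hc.exists_bound_of_continuous hW.continuous
  obtain ⟨B1, h1⟩ := hc.deriv.exists_bound_of_continuous hW1.continuous
  obtain ⟨B2, h2⟩ := hc.deriv.deriv.exists_bound_of_continuous hW2.continuous
  have lip : ∀ (f : ℝ → ℂ) (B : ℝ), Differentiable ℝ f → (∀ x, ‖deriv f x‖ ≤ B) →
      ∀ x y, ‖f y - f x‖ ≤ B * |y - x| := by
    intro f B hf hB x y
    exact convex_univ.norm_image_sub_le_of_norm_deriv_le (fun x _ => hf x) (fun x _ => hB x)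
      (Set.mem_univ x) (Set.mem_univ y)
  have hd := hW.differentiable (by simp)
  have hd1 := hW1.differentiable (by simp)
  have l1 := lip W B1 hd h1
  have l2 := lip (deriv W) B2 hd1 h2
  have p0 : 0 ≤ B0 := (norm_nonneg _).trans (h0 0)
  have p1 : 0 ≤ B1 := (norm_nonneg _).trans (h1 0)
  have p2 : 0 ≤ B2 := (norm_nonneg _).trans (h2 0)
  refine ⟨B0 + B1 + B2, by positivity, fun x => (h0 x).trans (by linarith), fun x y =>
    (l1 x y).trans (mul_le_mul_of_nonneg_right (by linarith) (abs_nonneg _)), fun x h => ?_⟩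
  -- The second difference is a first difference of `W(t + h) - W(t)`, whose derivative is at most
  -- `B2 * |h|`.
  have hshift : Differentiable ℝ fun t => W (t + h) := hd.comp (differentiable_id.add_const h)
  have l3 := lip (fun t => W (t + h) - W t) (B2 * |h|) (hshift.sub hd) (fun t => by
    have e : deriv (fun t => W (t + h) - W t) t = deriv W (t + h) - deriv W t := by
      rw [deriv_fun_sub (hshift t) (hd t), deriv_comp_add_const]
    rw [e]
    simpa using l2 t (t + h)) (x - h) x
  simp only [sub_add_cancel, sub_sub_cancel] at l3
  refine l3.trans ?_
  rw [mul_assoc, ← sq, sq_abs]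
  exact mul_le_mul_of_nonneg_right (by linarith) (sq_nonneg h)

/-- A function on `ℤ` that vanishes outside of `[Y - 1, 2 Y + 1]`. -/
theorem sum_int_le_of_support {g : ℤ → ℝ} {Y D : ℝ} (hY : 0 < Y) (hD : 0 ≤ D)
    (hg : ∀ x, g x ≤ D) (h1 : ∀ x : ℤ, (x : ℝ) < Y - 1 → g x = 0)
    (h2 : ∀ x : ℤ, 2 * Y + 1 < (x : ℝ) → g x = 0) (s : Finset ℤ) :
    ∑ x ∈ s, g x ≤ (Y + 3) * D := by
  classical
  have hsub : ∑ x ∈ s, g x = ∑ x ∈ s ∩ Icc ⌈Y - 1⌉ ⌊2 * Y + 1⌋, g x := by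
    refine (Finset.sum_subset_zero_on_sdiff inter_subset_left (fun x hx => ?_)
      fun _ _ => rfl).symm
    rw [mem_sdiff, mem_inter, mem_Icc] at hx
    by_cases h : (x : ℝ) < Y - 1
    · exact h1 x h
    · refine h2 x ?_
      by_contra h'
      exact hx.2 ⟨hx.1, Int.ceil_le.2 (not_lt.1 h), Int.le_floor.2 (not_lt.1 h')⟩
  have hcard : (((s ∩ Icc ⌈Y - 1⌉ ⌊2 * Y + 1⌋).card : ℕ) : ℝ) ≤ Y + 3 := by
    have e1 : (((s ∩ Icc ⌈Y - 1⌉ ⌊2 * Y + 1⌋).card : ℕ) : ℝ) ≤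
        ((⌊2 * Y + 1⌋ + 1 - ⌈Y - 1⌉).toNat : ℝ) := by
      rw [← Int.card_Icc]
      exact_mod_cast Finset.card_le_card inter_subset_right
    refine e1.trans ?_
    have e2 : (((⌊2 * Y + 1⌋ + 1 - ⌈Y - 1⌉).toNat : ℤ) : ℝ) ≤ Y + 3 := by
      rcases le_total 0 (⌊2 * Y + 1⌋ + 1 - ⌈Y - 1⌉) with h | h
      · rw [Int.toNat_of_nonneg h]
        push_cast
        have := Int.floor_le (2 * Y + 1)
        have := Int.le_ceil (Y - 1)
        linarith
      · rw [Int.toNat_of_nonpos h]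
        push_cast
        linarith
    exact_mod_cast e2
  rw [hsub]
  refine (Finset.sum_le_card_nsmul _ _ D fun x _ => hg x).trans ?_
  rw [nsmul_eq_mul]
  exact mul_le_mul_of_nonneg_right hcard hD

/-- The differences of `x ↦ W(x / Y)` live on about `Y` integers; the first are `O(1 / Y)` and the
second `O(1 / Y²)`, whence totals `O(1)` and `O(1 / Y)`. For `Y ≤ 1` boundedly many points remain
and the trivial bound is enough. -/
theorem exists_sum_differences_bound (hW : ContDiff ℝ ∞ W)
    (hWsupp : Function.support W ⊆ Set.Icc 1 2) :
    ∃ B : ℝ, 0 ≤ B ∧ ∀ Y : ℝ, 0 < Y → ∀ s : Finset ℤ,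
      ∑ x ∈ s, ‖W ((x + 1) / Y) - W (x / Y)‖ ≤ B ∧
      ∑ x ∈ s, ‖W ((x + 1) / Y) - W (x / Y) - (W (x / Y) - W ((x - 1) / Y))‖ ≤ B / Y := by
  obtain ⟨B, hB, b0, b1, b2⟩ := exists_differences_bound hW hWsupp
  -- The worst case is `Y ≤ 1`: the counting factor `Y + 3 ≤ 4` times the trivial bound `4 * B` for
  -- a second difference.
  refine ⟨16 * B, by positivity, fun Y hY s => ?_⟩
  have z1 : ∀ y : ℝ, y < Y → W (y / Y) = 0 := fun y hy =>
    eq_zero_of_lt_one hWsupp ((div_lt_one hY).2 hy)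
  have z2 : ∀ y : ℝ, 2 * Y < y → W (y / Y) = 0 := fun y hy =>
    eq_zero_of_two_lt hWsupp ((lt_div_iff₀ hY).2 hy)
  rcases le_total Y 1 with hY1 | hY1
  · constructor
    · refine (sum_int_le_of_support (D := 2 * B) hY (by positivity) (fun x => ?_) (fun x hx => ?_)
        (fun x hx => ?_) s).trans (by nlinarith)
      · refine (norm_sub_le _ _).trans ?_
        linarith [b0 ((x + 1) / Y), b0 (x / Y)]
      · rw [z1 _ (by linarith), z1 _ (by linarith)]; simp
      · rw [z2 _ (by linarith), z2 _ (by linarith)]; simp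
    · refine (sum_int_le_of_support (D := 4 * B) hY (by positivity) (fun x => ?_) (fun x hx => ?_)
        (fun x hx => ?_) s).trans ?_
      · refine (norm_sub_le _ _).trans ?_
        have := norm_sub_le (W ((x + 1) / Y)) (W (x / Y))
        have := norm_sub_le (W (x / Y)) (W ((x - 1) / Y))
        linarith [b0 ((x + 1) / Y), b0 (x / Y), b0 ((x - 1) / Y)]
      · rw [z1 _ (by linarith), z1 _ (by linarith), z1 _ (by linarith)]; simp
      · rw [z2 _ (by linarith), z2 _ (by linarith), z2 _ (by linarith)]; simp
      · have : 16 * B ≤ 16 * B / Y := by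
          rw [le_div_iff₀ hY]
          nlinarith
        nlinarith
  · have hdiff : ∀ x : ℝ, (x + 1) / Y - x / Y = 1 / Y := fun x => by ring
    constructor
    · refine (sum_int_le_of_support (D := B / Y) hY (by positivity) (fun x => ?_) (fun x hx => ?_)
        (fun x hx => ?_) s).trans ?_
      · refine (b1 _ _).trans ?_
        rw [hdiff, abs_of_pos (by positivity), mul_one_div]
      · rw [z1 _ (by linarith), z1 _ (by linarith)]; simp
      · rw [z2 _ (by linarith), z2 _ (by linarith)]; simp
      · rw [mul_div_assoc', div_le_iff₀ hY]
        nlinarith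
    · refine (sum_int_le_of_support (D := B / Y ^ 2) hY (by positivity) (fun x => ?_)
        (fun x hx => ?_) (fun x hx => ?_) s).trans ?_
      · have := b2 (x / Y) (1 / Y)
        rw [← add_div, ← sub_div, div_pow, one_pow, mul_one_div] at this
        exact this
      · rw [z1 _ (by linarith), z1 _ (by linarith), z1 _ (by linarith)]; simp
      · rw [z2 _ (by linarith), z2 _ (by linarith), z2 _ (by linarith)]; simp
      · rw [mul_div_assoc', div_le_div_iff₀ (by positivity) hY]
        nlinarith [mul_nonneg hB hY.le, mul_nonneg (mul_nonneg hB hY.le) hY.le,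
          mul_nonneg (mul_nonneg hB hY.le) (sub_nonneg.2 hY1)]

/-- The bilinear form with the kernel `W((m - n) / Y)` is controlled by the partial sums. -/
theorem exists_bilinear_bound (hW : ContDiff ℝ ∞ W)
    (hWsupp : Function.support W ⊆ Set.Icc 1 2) :
    ∃ D : ℝ, 0 ≤ D ∧ ∀ (Y : ℝ) (_ : 0 < Y) (M : ℕ) (A B : ℝ) (α β : ℕ → ℂ),
      (∀ u ≤ M, ‖∑ m ∈ Icc 1 u, α m‖ ≤ A) → (∀ u ≤ M, ‖∑ m ∈ Icc 1 u, β m‖ ≤ B) →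
      ‖∑ m ∈ Icc 1 M, ∑ n ∈ Icc 1 M, α m * β n * W (((m : ℝ) - n) / Y)‖ ≤
        A * B * (D * (1 + M / Y)) := by
  obtain ⟨D, hD, hsum⟩ := exists_sum_differences_bound hW hWsupp
  refine ⟨D, hD, fun Y hY M A B α β hα hβ => ?_⟩
  have hB : 0 ≤ B := (norm_nonneg _).trans (hβ 0 (Nat.zero_le M))
  have hA : 0 ≤ A := (norm_nonneg _).trans (hα 0 (Nat.zero_le M))
  have z : ∀ y : ℝ, y ≤ 0 → W (y / Y) = 0 := fun y hy =>
    eq_zero_of_lt_one hWsupp ((div_lt_one hY).2 (by linarith))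
  refine (norm_sum_sum_mul_le_of_partial (F := fun m n => W (((m : ℝ) - n) / Y)) hα hβ).trans
    (mul_le_mul_of_nonneg_left ?_ (mul_nonneg hA hB))
  -- The boundary terms at `n = M + 1` vanish because `m - n ≤ 0` lies off the support of `W`.
  have e1 : ∑ m ∈ Icc 1 M, ‖W (((m : ℝ) - (M + 1 : ℕ)) / Y) -
      W ((((m + 1 : ℕ) : ℝ) - (M + 1 : ℕ)) / Y)‖ = 0 := by
    refine Finset.sum_eq_zero fun m hm => ?_
    have hm' : (m : ℝ) ≤ M := by exact_mod_cast (mem_Icc.1 hm).2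
    rw [z _ (by push_cast; linarith), z _ (by push_cast; linarith)]
    simp
  have e2 : ‖W ((((M + 1 : ℕ) : ℝ) - (M + 1 : ℕ)) / Y)‖ = 0 := by
    rw [z _ (by simp)]; simp
  simp only [e1, e2, add_zero]
  rw [Finset.sum_add_distrib, mul_add, mul_one, add_comm]
  have hinj1 : Set.InjOn (fun n : ℕ => (M : ℤ) - n) (Icc 1 M : Finset ℕ) := by
    intro a _ b _ h
    simp only at h
    omega
  refine add_le_add ?_ ?_
  · have h := (hsum Y hY ((Icc 1 M).image fun n : ℕ => (M : ℤ) - n)).1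
    rw [Finset.sum_image hinj1] at h
    refine le_trans (Finset.sum_le_sum fun n _ => le_of_eq ?_) h
    push_cast
    congr 3 <;> ring_nf
  -- The mixed difference of a function of `m - n` is minus its second difference, so each `n` costs
  -- `D / Y`.
  · have h2 : ∀ n ∈ Icc 1 M, ∑ m ∈ Icc 1 M, ‖W (((m : ℝ) - n) / Y) -
        W (((m : ℝ) - ((n + 1 : ℕ) : ℝ)) / Y) - (W ((((m + 1 : ℕ) : ℝ) - n) / Y) -
        W ((((m + 1 : ℕ) : ℝ) - ((n + 1 : ℕ) : ℝ)) / Y))‖ ≤ D / Y := by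
      intro n _
      have hinj2 : Set.InjOn (fun m : ℕ => (m : ℤ) - n) (Icc 1 M : Finset ℕ) := by
        intro a _ b _ h
        simp only at h
        omega
      have h := (hsum Y hY ((Icc 1 M).image fun m : ℕ => (m : ℤ) - n)).2
      rw [Finset.sum_image hinj2] at h
      refine le_trans (Finset.sum_le_sum fun m _ => le_of_eq ?_) h
      rw [← norm_neg]
      push_cast
      ring_nf
    refine (Finset.sum_le_card_nsmul _ _ _ h2).trans (le_of_eq ?_)
    rw [Nat.card_Icc, nsmul_eq_mul]
    simp only [Nat.add_sub_cancel]
    ring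

theorem mellin_one_eq (hWsupp : Function.support W ⊆ Set.Icc 1 2) {Y b : ℝ} (hY : 0 < Y)
    (hb : 2 * Y ≤ b) : Y * mellin W 1 = ∫ x in (0 : ℝ)..b, W (x / Y) := by
  have h2b : 2 ≤ b / Y := (le_div_iff₀ hY).2 hb
  have h1 : mellin W 1 = ∫ x in (0 : ℝ)..(b / Y), W x := by
    rw [mellin, intervalIntegral.integral_of_le (by linarith)]
    simp only [sub_self, Complex.cpow_zero, one_smul]
    refine MeasureTheory.setIntegral_eq_of_subset_of_forall_sdiff_eq_zero measurableSet_Ioi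
      (fun x hx => hx.1) fun x hx => ?_
    refine eq_zero_of_two_lt hWsupp (lt_of_le_of_lt h2b ?_)
    by_contra h
    exact hx.2 ⟨hx.1, not_lt.1 h⟩
  have h2 := intervalIntegral.integral_comp_div (a := 0) (b := b) W hY.ne'
  rw [h2, zero_div, h1, Complex.real_smul]

/-- The Riemann sums of `W` converge at the rate `O(min(1, Y))`. -/
theorem exists_riemann_sum_bound (hW : ContDiff ℝ ∞ W)
    (hWsupp : Function.support W ⊆ Set.Icc 1 2) :
    ∃ D : ℝ, 0 ≤ D ∧ ∀ (Y : ℝ) (_ : 0 < Y) (R : ℕ), 2 * Y ≤ R →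
      ‖∑ d ∈ Icc 1 R, W (d / Y) - Y * mellin W 1‖ ≤ D * min 1 Y := by
  obtain ⟨B, hB, b0, b1, -⟩ := exists_differences_bound hW hWsupp
  refine ⟨3 * B + ‖mellin W 1‖, by positivity, fun Y hY R hR => ?_⟩
  -- For `Y ≤ 1` the sum has at most `2 * Y` nonzero terms, so the sum and the integral are both
  -- `O(Y)`. For `Y ≥ 1` each term is compared with the integral over `[d - 1, d]`.
  rcases le_total Y 1 with hY1 | hY1
  · rw [min_eq_right hY1]
    refine (norm_sub_le _ _).trans ?_
    rw [norm_mul, Complex.norm_real, Real.norm_of_nonneg hY.le]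
    have h1 : ‖∑ d ∈ Icc 1 R, W (d / Y)‖ ≤ 2 * Y * B := by
      have : ∑ d ∈ Icc 1 R, W (d / Y) = ∑ d ∈ Icc 1 ⌊2 * Y⌋₊, W (d / Y) := by
        refine (Finset.sum_subset_zero_on_sdiff (fun d hd => ?_) (fun d hd => ?_)
          fun _ _ => rfl).symm
        · rw [mem_Icc] at hd ⊢
          refine ⟨hd.1, ?_⟩
          have := (Nat.floor_le (by positivity : (0 : ℝ) ≤ 2 * Y))
          have h3 : (d : ℝ) ≤ ⌊2 * Y⌋₊ := by exact_mod_cast hd.2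
          exact_mod_cast h3.trans (this.trans hR)
        · rw [mem_sdiff, mem_Icc, mem_Icc] at hd
          refine eq_zero_of_two_lt hWsupp ((lt_div_iff₀ hY).2 ?_)
          refine (Nat.floor_lt (by positivity)).1 ?_
          by_contra h
          exact hd.2 ⟨hd.1.1, not_lt.1 h⟩
      rw [this]
      refine (norm_sum_le _ _).trans ((Finset.sum_le_card_nsmul _ _ B fun d _ => b0 _).trans ?_)
      rw [nsmul_eq_mul, Nat.card_Icc, Nat.add_sub_cancel]
      exact mul_le_mul_of_nonneg_right (Nat.floor_le (by positivity)) hB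
    nlinarith [mul_nonneg hB hY.le]
  · rw [min_eq_left hY1, mul_one]
    have hcont : Continuous fun x : ℝ => W (x / Y) := hW.continuous.comp (by fun_prop)
    have hint : ∀ a b : ℝ, IntervalIntegrable (fun x : ℝ => W (x / Y)) MeasureTheory.volume a b :=
      fun a b => hcont.intervalIntegrable a b
    have h1 : ∫ x in (0 : ℝ)..R, W (x / Y) =
        ∑ d ∈ Icc 1 R, ∫ x in ((d - 1 : ℕ) : ℝ)..d, W (x / Y) := by
      have := intervalIntegral.sum_integral_adjacent_intervals (f := fun x : ℝ => W (x / Y))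
        (a := fun k : ℕ => (k : ℝ)) (n := R) (fun k _ => hint _ _)
      rw [Nat.cast_zero] at this
      rw [← this, Finset.range_eq_Ico]
      exact Finset.sum_Ico_add' (fun d : ℕ => ∫ x in ((d - 1 : ℕ) : ℝ)..d, W (x / Y)) 0 R 1
    rw [mellin_one_eq hWsupp hY hR, h1, ← Finset.sum_sub_distrib]
    have h2 : ∀ d ∈ Icc 1 R, ‖W (d / Y) - ∫ x in ((d - 1 : ℕ) : ℝ)..d, W (x / Y)‖ ≤ B / Y := by
      intro d hd
      have hcast : ((d - 1 : ℕ) : ℝ) = (d : ℝ) - 1 := by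
        rw [Nat.cast_sub (mem_Icc.1 hd).1, Nat.cast_one]
      have h3 : W (d / Y) = ∫ x in ((d - 1 : ℕ) : ℝ)..d, W (d / Y) := by
        rw [intervalIntegral.integral_const, hcast]
        simp
      rw [h3, ← intervalIntegral.integral_sub (by simp) (hint _ _)]
      refine (intervalIntegral.norm_integral_le_of_norm_le_const (C := B / Y)
        fun x hx => ?_).trans ?_
      · rw [Set.uIoc_of_le (by rw [hcast]; linarith), hcast] at hx
        refine (b1 _ _).trans ?_
        rw [← sub_div, abs_of_nonneg (div_nonneg (by linarith [hx.2]) hY.le), mul_div_assoc']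
        exact div_le_div_of_nonneg_right (mul_le_of_le_one_right hB (by linarith [hx.1])) hY.le
      · rw [hcast]
        simp
    -- Beyond `2 * Y + 1` both the value at `d` and the integral over `[d - 1, d]` vanish, so only
    -- `O(Y)` errors of size `B / Y` are counted.
    have h4 : ∑ d ∈ Icc 1 R, (W (d / Y) - ∫ x in ((d - 1 : ℕ) : ℝ)..d, W (x / Y)) =
        ∑ d ∈ (Icc 1 R).filter (fun d => d ≤ ⌊2 * Y + 1⌋₊),
          (W (d / Y) - ∫ x in ((d - 1 : ℕ) : ℝ)..d, W (x / Y)) := by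
      symm
      refine Finset.sum_filter_of_ne fun d hd hne => ?_
      by_contra hlt
      have hd' : 2 * Y + 1 < d := (Nat.floor_lt (by positivity)).1 (not_le.1 hlt)
      have hcast : ((d - 1 : ℕ) : ℝ) = (d : ℝ) - 1 := by
        rw [Nat.cast_sub (mem_Icc.1 hd).1, Nat.cast_one]
      refine hne ?_
      rw [eq_zero_of_two_lt hWsupp ((lt_div_iff₀ hY).2 (by linarith)),
        intervalIntegral.integral_congr_ae (g := fun _ => 0), intervalIntegral.integral_zero,
        sub_zero]
      refine Filter.Eventually.of_forall fun x hx => ?_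
      rw [Set.uIoc_of_le (by rw [hcast]; linarith), hcast] at hx
      exact eq_zero_of_two_lt hWsupp ((lt_div_iff₀ hY).2 (by linarith [hx.1]))
    rw [h4]
    have hcard : (((Icc 1 R).filter (fun d => d ≤ ⌊2 * Y + 1⌋₊)).card : ℝ) ≤ 2 * Y + 1 := by
      refine le_trans ?_ (Nat.floor_le (by positivity : (0 : ℝ) ≤ 2 * Y + 1))
      have : (Icc 1 R).filter (fun d => d ≤ ⌊2 * Y + 1⌋₊) ⊆ Icc 1 ⌊2 * Y + 1⌋₊ := by
        intro d hd
        rw [mem_filter, mem_Icc] at hd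
        exact mem_Icc.2 ⟨hd.1.1, hd.2⟩
      have := Finset.card_le_card this
      rw [Nat.card_Icc, Nat.add_sub_cancel] at this
      exact_mod_cast this
    refine (norm_sum_le _ _).trans ((Finset.sum_le_card_nsmul _ _ (B / Y) fun d hd =>
      h2 d (mem_filter.1 hd).1).trans ?_)
    rw [nsmul_eq_mul]
    refine (mul_le_mul_of_nonneg_right hcard (by positivity)).trans ?_
    have : (2 * Y + 1) * (B / Y) ≤ 3 * B := by
      rw [mul_div_assoc', div_le_iff₀ hY]
      nlinarith
    linarith [norm_nonneg (mellin W 1)]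

end TestFunction

/-! ### The level condition -/

/-- Square-root cancellation in the sums of `a` against characters, with the coprimality condition
absorbed into the level. -/
def LevelBound (A Q : ℝ) (M : ℕ) (a : ℕ → ℂ) : Prop :=
  ∀ t q c u : ℕ, 1 ≤ t → 1 ≤ q → 1 ≤ c → (q.lcm c : ℝ) ≤ 2 * Q → u * t ≤ M →
    ∀ ψ : DirichletCharacter ℂ q,
      ‖∑ m ∈ Icc 1 u with m.Coprime c, a (t * m) * ψ (m : ZMod q)‖ ≤ A / √t

theorem changeLevel_lcm_natCast {q c : ℕ} (ψ : DirichletCharacter ℂ q) (m : ℕ) :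
    DirichletCharacter.changeLevel (Nat.dvd_lcm_left q c) ψ (m : ZMod (q.lcm c)) =
      if m.Coprime c then ψ (m : ZMod q) else 0 := by
  have hiff : m.Coprime (q.lcm c) ↔ m.Coprime q ∧ m.Coprime c :=
    ⟨fun h => ⟨h.coprime_dvd_right (Nat.dvd_lcm_left q c),
      h.coprime_dvd_right (Nat.dvd_lcm_right q c)⟩,
      fun h => Nat.Coprime.coprime_dvd_right (Nat.lcm_dvd_mul q c)
        (Nat.coprime_mul_iff_right.2 h)⟩
  by_cases h : m.Coprime (q.lcm c)
  · rw [changeLevel_natCast _ ψ h, if_pos (hiff.1 h).2]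
  · rw [MulChar.map_nonunit _ (by rwa [ZMod.isUnit_iff_coprime])]
    split_ifs with hc
    · rw [MulChar.map_nonunit]
      rw [ZMod.isUnit_iff_coprime]
      exact fun hq => h (hiff.2 ⟨hq, hc⟩)
    · rfl

/-- Inducing `ψ` to the modulus `lcm(q, c)` imposes coprimality to `c`. This matters because the
hypothesis admits coprimality parameters only up to `X`, which can be smaller than `Q`, while here
`c` may be as large as `2 * Q`. -/
theorem CharSumBound.levelBound {K : ℝ → ℝ} {Q X δ : ℝ} {a : ℕ → ℂ} (hQ : 1 ≤ Q) (hX : 1 ≤ X)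
    (hδ : 0 < δ) (h : CharSumBound K Q X a) : LevelBound (|K δ| * Q ^ δ) Q ⌊X⌋₊ a := by
  intro t q c u ht hq hc hlcm hu ψ
  have hpos : (0 : ℝ) < t := by exact_mod_cast ht
  rcases Nat.eq_zero_or_pos u with rfl | hu0
  · simp only [Finset.Icc_eq_empty_of_lt Nat.zero_lt_one, Finset.filter_empty, Finset.sum_empty,
      norm_zero]
    positivity
  have hX0 : (⌊X⌋₊ : ℝ) ≤ X := Nat.floor_le (by linarith)
  have huM : (u : ℝ) ≤ X := by
    refine le_trans ?_ hX0
    exact_mod_cast (Nat.le_mul_of_pos_right u ht).trans hu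
  have htM : (t : ℝ) ≤ X := by
    refine le_trans ?_ hX0
    exact_mod_cast (Nat.le_mul_of_pos_left t hu0).trans hu
  -- The coprimality now sits in the character, so the parameter is `1`; the modulus is `lcm(q, c)`.
  have h1 := h δ hδ 1 t (q.lcm c) u le_rfl ht (Nat.lcm_pos hq hc) (by simpa using hX) htM huM hlcm
    (DirichletCharacter.changeLevel (Nat.dvd_lcm_left q c) ψ)
  have h2 : ∑ m ∈ Icc 1 ⌊(u : ℝ)⌋₊ with m.Coprime 1, a (m * t) *
      DirichletCharacter.changeLevel (Nat.dvd_lcm_left q c) ψ (m : ZMod (q.lcm c)) =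
      ∑ m ∈ Icc 1 u with m.Coprime c, a (t * m) * ψ (m : ZMod q) := by
    rw [Nat.floor_natCast, Finset.sum_filter, Finset.sum_filter]
    refine Finset.sum_congr rfl fun m _ => ?_
    rw [if_pos (Nat.coprime_one_right m), changeLevel_lcm_natCast, mul_comm m t]
    split_ifs <;> simp
  rw [h2] at h1
  refine h1.trans ?_
  have e1 : (t : ℝ) ^ (-(1 / 2) : ℝ) = 1 / √t := by
    rw [Real.rpow_neg hpos.le, ← Real.sqrt_eq_rpow, one_div]
  rw [e1]
  have : K δ * (1 / √t) * Q ^ δ ≤ |K δ| * (1 / √t) * Q ^ δ := by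
    have := le_abs_self (K δ)
    gcongr
  refine this.trans (le_of_eq (by ring))

theorem LevelBound.nonneg {A Q : ℝ} {M : ℕ} {a : ℕ → ℂ} (hQ : 1 ≤ Q) (h : LevelBound A Q M a) :
    0 ≤ A := by
  have := h 1 1 1 0 le_rfl le_rfl le_rfl (by simp; linarith) (by simp) 1
  simpa using this

/-- A sum of length one with `t = n` and the trivial character is the single coefficient `a n`. -/
theorem LevelBound.norm_le {A Q : ℝ} {M : ℕ} {a : ℕ → ℂ} (hQ : 1 ≤ Q) (h : LevelBound A Q M a)
    {n : ℕ} (hn : n ∈ Icc 1 M) : ‖a n‖ ≤ A / √n := by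
  have := h n 1 1 1 (mem_Icc.1 hn).1 le_rfl le_rfl (by simp; linarith)
    (by simpa using (mem_Icc.1 hn).2) 1
  have h1 : (1 : DirichletCharacter ℂ 1) ((1 : ℕ) : ZMod 1) = 1 := by rw [Nat.cast_one, map_one]
  rwa [Icc_self, filter_singleton, if_pos (Nat.coprime_one_right 1), sum_singleton, h1, mul_one,
    mul_one] at this

theorem LevelBound.norm_sum_conj_le {A Q : ℝ} {M : ℕ} {a : ℕ → ℂ} (h : LevelBound A Q M a)
    {t q c u : ℕ} (ht : 1 ≤ t) (hq : 1 ≤ q) (hc : 1 ≤ c) (hl : (q.lcm c : ℝ) ≤ 2 * Q)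
    (hu : u * t ≤ M) (ψ : DirichletCharacter ℂ q) :
    ‖∑ m ∈ Icc 1 u with m.Coprime c, a (t * m) * conj (ψ (m : ZMod q))‖ ≤ A / √t := by
  have : NeZero q := ⟨by omega⟩
  simp only [conj_dirichletCharacter]
  exact h t q c u ht hq hc hl hu ψ⁻¹

theorem sum_norm_mul_le {A Q : ℝ} {M : ℕ} {a b : ℕ → ℂ} (hQ : 1 ≤ Q) (ha : LevelBound A Q M a)
    (hb : LevelBound A Q M b) {g : ℕ → ℝ} (hg : ∀ n, 0 ≤ g n) :
    ∑ n ∈ Icc 1 M, ‖a n * b n‖ * g n ≤ A ^ 2 * ∑ n ∈ Icc 1 M, g n / n := by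
  rw [Finset.mul_sum]
  refine Finset.sum_le_sum fun n hn => ?_
  have hn0 : (0 : ℝ) < n := by exact_mod_cast (mem_Icc.1 hn).1
  have h : ‖a n * b n‖ ≤ A ^ 2 / n := by
    rw [norm_mul]
    refine (mul_le_mul (ha.norm_le hQ hn) (hb.norm_le hQ hn) (norm_nonneg _)
      (div_nonneg (ha.nonneg hQ) (Real.sqrt_nonneg _))).trans (le_of_eq ?_)
    rw [div_mul_div_comm, Real.mul_self_sqrt hn0.le, sq]
  refine (mul_le_mul_of_nonneg_right h (hg n)).trans (le_of_eq (by ring))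

/-! ### The off-diagonal terms -/

/-- The off-diagonal pairs that are congruent modulo `d` and coprime to `c d`. -/
def offDiagonal (M : ℕ) (a b : ℕ → ℂ) (c d : ℕ) : ℂ :=
  ∑ m ∈ Icc 1 M, ∑ n ∈ Icc 1 M,
    if m ≠ n ∧ (m.Coprime c ∧ n.Coprime c) ∧ (m.Coprime d ∧ n.Coprime d) ∧ m ≡ n [MOD d]
    then a m * b n else 0

theorem tsum_eq_sum_Icc_floor {W : ℝ → ℂ} (hWsupp : Function.support W ⊆ Set.Icc 1 2) {Q : ℝ}
    (hQ : 1 ≤ Q) (f : ℕ → ℂ) (hf : ∀ q : ℕ, W (q / Q) = 0 → f q = 0) :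
    ∑' q : ℕ, f q = ∑ q ∈ Icc 1 ⌊2 * Q⌋₊, f q := by
  refine tsum_eq_sum fun q hq => hf q ?_
  have hQ0 : 0 < Q := by linarith
  rcases Nat.eq_zero_or_pos q with rfl | hq0
  · exact eq_zero_of_lt_one hWsupp (by simp)
  · refine eq_zero_of_two_lt hWsupp ((lt_div_iff₀ hQ0).2 ?_)
    refine (Nat.floor_lt (by positivity)).1 ?_
    by_contra h
    exact hq (mem_Icc.2 ⟨hq0, not_lt.1 h⟩)

theorem eq_zero_of_floor_lt {W : ℝ → ℂ} (hWsupp : Function.support W ⊆ Set.Icc 1 2) {Q : ℝ}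
    (hQ : 1 ≤ Q) {c d : ℕ} (h : ⌊2 * Q⌋₊ < c * d) : W ((c : ℝ) * d / Q) = 0 := by
  refine eq_zero_of_two_lt hWsupp ((lt_div_iff₀ (by linarith)).2 ?_)
  exact_mod_cast (Nat.floor_lt (by positivity)).1 h

/-- The diagonal removes exactly the pairs `m = n`. On the others the primitive correlation is
opened over `q = c d`, and `rho_eq` separates the totients. -/
theorem SCoprime_sub_diagonalCoprime {W : ℝ → ℂ} (hWsupp : Function.support W ⊆ Set.Icc 1 2)
    {Q : ℝ} (hQ : 1 ≤ Q) (X : ℝ) (a b : ℕ → ℂ) (N : ℕ) :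
    SCoprime N W Q X a b - diagonalCoprime N W Q X a b =
      ∑ c ∈ Icc 1 ⌊2 * Q⌋₊, if c.Coprime N then (μ c : ℂ) / c.totient *
        ∑ d ∈ Icc 1 ⌊2 * Q⌋₊, (if d.Coprime N then rho c d else 0) * W ((c : ℝ) * d / Q) *
          offDiagonal ⌊X⌋₊ a b c d else 0 := by
  rw [SCoprime, diagonalCoprime,
    tsum_eq_sum_Icc_floor hWsupp hQ _ (fun q hq => by simp [hq]),
    tsum_eq_sum_Icc_floor hWsupp hQ _ (fun q hq => by simp [hq]), ← Finset.sum_sub_distrib]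
  let f : ℕ → ℕ → ℂ := fun c d => if (c * d).Coprime N then
    W ((c : ℝ) * d / Q) / ((c * d).totient : ℂ) * ((μ c : ℂ) * (d.totient : ℂ) *
      offDiagonal ⌊X⌋₊ a b c d) else 0
  have h1 : ∀ q ∈ Icc 1 ⌊2 * Q⌋₊, ((if q.Coprime N then
      W (q / Q) / (Nat.totient q : ℂ) * primitiveSum X a b q else 0) - if q.Coprime N then
      W (q / Q) * (primitiveTotient q : ℂ) / (Nat.totient q : ℂ) * diagonalSum X a b q else 0) =
      ∑ x ∈ q.divisorsAntidiagonal, f x.1 x.2 := by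
    intro q hq
    have hq0 : q ≠ 0 := by have := (mem_Icc.1 hq).1; omega
    have h2 : ∑ x ∈ q.divisorsAntidiagonal, f x.1 x.2 = if q.Coprime N then
        W (q / Q) / (Nat.totient q : ℂ) * ∑ x ∈ q.divisorsAntidiagonal,
          (μ x.1 : ℂ) * (x.2.totient : ℂ) * offDiagonal ⌊X⌋₊ a b x.1 x.2 else 0 := by
      split_ifs with hqN
      · rw [Finset.mul_sum]
        refine Finset.sum_congr rfl fun x hx => ?_
        obtain ⟨hx1, -⟩ := Nat.mem_divisorsAntidiagonal.1 hx
        simp only [f]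
        rw [hx1, if_pos hqN, ← Nat.cast_mul, hx1]
      · refine Finset.sum_eq_zero fun x hx => ?_
        obtain ⟨hx1, -⟩ := Nat.mem_divisorsAntidiagonal.1 hx
        simp only [f]
        rw [hx1, if_neg hqN]
    rw [h2]
    by_cases hqN : q.Coprime N
    swap
    · rw [if_neg hqN, if_neg hqN, if_neg hqN, sub_zero]
    rw [if_pos hqN, if_pos hqN, if_pos hqN]
    have h3 : ∑ x ∈ q.divisorsAntidiagonal,
        (μ x.1 : ℂ) * (x.2.totient : ℂ) * offDiagonal ⌊X⌋₊ a b x.1 x.2 =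
        primitiveSum X a b q - primitiveTotient q * diagonalSum X a b q := by
      rw [primitiveSum_sub_diagonalSum]
      simp only [offDiagonal, Finset.mul_sum]
      rw [Finset.sum_comm]
      refine Finset.sum_congr rfl fun m _ => ?_
      rw [Finset.sum_comm]
      refine Finset.sum_congr rfl fun n _ => ?_
      by_cases hmn : m = n
      · simp [hmn]
      rw [if_pos hmn]
      by_cases hc : m.Coprime q ∧ n.Coprime q
      · rw [primitiveCorr_eq hq0 hc.1 hc.2, Finset.mul_sum]
        refine Finset.sum_congr rfl fun x hx => ?_
        obtain ⟨hx1, -⟩ := Nat.mem_divisorsAntidiagonal.1 hx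
        rw [← hx1, Nat.coprime_mul_iff_right, Nat.coprime_mul_iff_right] at hc
        obtain ⟨⟨c1, c2⟩, c3, c4⟩ := hc
        by_cases hmod : m ≡ n [MOD x.2]
        · rw [if_pos ⟨hmn, ⟨c1, c3⟩, ⟨c2, c4⟩, hmod⟩, if_pos hmod]; ring
        · rw [if_neg (fun h => hmod h.2.2.2), if_neg hmod]; ring
      · rw [primitiveCorr_eq_zero hc, mul_zero]
        refine Finset.sum_eq_zero fun x hx => ?_
        obtain ⟨hx1, -⟩ := Nat.mem_divisorsAntidiagonal.1 hx
        rw [if_neg, mul_zero]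
        rintro ⟨-, ⟨c1, c3⟩, ⟨c2, c4⟩, -⟩
        refine hc ?_
        rw [← hx1, Nat.coprime_mul_iff_right, Nat.coprime_mul_iff_right]
        exact ⟨⟨c1, c2⟩, c3, c4⟩
    rw [h3]
    ring
  rw [Finset.sum_congr rfl h1, sum_Icc_divisorsAntidiagonal]
  · refine Finset.sum_congr rfl fun c hc => ?_
    have hc0 : c ≠ 0 := by have := (mem_Icc.1 hc).1; omega
    by_cases hcN : c.Coprime N
    · rw [if_pos hcN, Finset.mul_sum]
      refine Finset.sum_congr rfl fun d hd => ?_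
      have hd0 : d ≠ 0 := by have := (mem_Icc.1 hd).1; omega
      by_cases hdN : d.Coprime N
      · simp only [f]
        rw [if_pos hdN, if_pos (Nat.coprime_mul_iff_left.2 ⟨hcN, hdN⟩)]
        have := rho_eq hc0 hd0
        calc _ = W ((c : ℝ) * d / Q) * (μ c : ℂ) * offDiagonal ⌊X⌋₊ a b c d *
              ((d.totient : ℂ) / ((c * d).totient : ℂ)) := by ring
          _ = _ := by rw [this]; ring
      · simp only [f]
        rw [if_neg hdN, if_neg (fun h => hdN (Nat.coprime_mul_iff_left.1 h).2)]
        ring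
    · rw [if_neg hcN]
      refine Finset.sum_eq_zero fun d _ => ?_
      exact if_neg (fun h => hcN (Nat.coprime_mul_iff_left.1 h).1)
  · intro c d hcd
    simp only [f]
    rw [eq_zero_of_floor_lt hWsupp hQ hcd]
    simp

theorem norm_rho_le_one {c d : ℕ} (hc : c ≠ 0) (hd : d ≠ 0) : ‖rho c d‖ ≤ 1 := by
  have h := congrArg norm (rho_eq hc hd)
  have h1 : (0 : ℝ) < c.totient := by
    exact_mod_cast Nat.totient_pos.2 (Nat.pos_of_ne_zero hc)
  have h2 : (0 : ℝ) < (c * d).totient := by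
    exact_mod_cast Nat.totient_pos.2 (Nat.pos_of_ne_zero (mul_ne_zero hc hd))
  rw [norm_div, norm_div, Complex.norm_natCast, Complex.norm_natCast, Complex.norm_natCast] at h
  have h3 : ‖rho c d‖ = (d.totient : ℝ) / (c * d).totient * c.totient := by
    rw [h, div_mul_cancel₀ _ h1.ne']
  rw [h3, div_mul_eq_mul_div, div_le_one h2, mul_comm]
  exact_mod_cast Nat.totient_super_multiplicative c d

/-- With the pairs `m = n` restored, the sum is the average over the `φ(d)` characters modulo `d` of
products of two sums, each at most `A`. The restored pairs cost `∑ |a_n b_n| ≤ A² ∑ 1 / n`. -/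
theorem norm_offDiagonal_le {A Q : ℝ} {M : ℕ} {a b : ℕ → ℂ} (hQ : 1 ≤ Q)
    (ha : LevelBound A Q M a) (hb : LevelBound A Q M b) {c d : ℕ} (hc : 1 ≤ c) (hd : 1 ≤ d)
    (hcd : ((c * d : ℕ) : ℝ) ≤ 2 * Q) :
    ‖offDiagonal M a b c d‖ ≤ A ^ 2 * (1 + ∑ n ∈ Icc 1 M, 1 / (n : ℝ)) := by
  have : NeZero d := ⟨by omega⟩
  have hA := ha.nonneg hQ
  have hl : (d.lcm c : ℝ) ≤ 2 * Q := by
    refine le_trans ?_ hcd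
    rw [mul_comm]
    exact_mod_cast Nat.le_of_dvd (Nat.mul_pos hd hc) (Nat.lcm_dvd_mul d c)
  have hφ : (0 : ℝ) < d.totient := by exact_mod_cast Nat.totient_pos.2 hd
  have hφ' : (d.totient : ℂ) ≠ 0 := by exact_mod_cast hφ.ne'
  let u : DirichletCharacter ℂ d → ℂ := fun ψ =>
    ∑ m ∈ Icc 1 M with m.Coprime c, a m * ψ (m : ZMod d)
  let v : DirichletCharacter ℂ d → ℂ := fun ψ =>
    ∑ n ∈ Icc 1 M with n.Coprime c, b n * conj (ψ (n : ZMod d))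
  have hu : ∀ ψ, ‖u ψ‖ ≤ A := fun ψ => by
    have := ha 1 d c M le_rfl hd hc hl (by simp) ψ
    simpa using this
  have hv : ∀ ψ, ‖v ψ‖ ≤ A := fun ψ => by
    have := hb.norm_sum_conj_le (t := 1) (u := M) le_rfl hd hc hl (by simp) ψ
    simpa using this
  have h1 : offDiagonal M a b c d = (d.totient : ℂ)⁻¹ * ∑ ψ : DirichletCharacter ℂ d, u ψ * v ψ -
      ∑ n ∈ Icc 1 M, if n.Coprime c ∧ n.Coprime d then a n * b n else 0 := by
    have h2 : ∑ ψ : DirichletCharacter ℂ d, u ψ * v ψ = ∑ m ∈ Icc 1 M, ∑ n ∈ Icc 1 M,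
        if m.Coprime c ∧ n.Coprime c then a m * b n *
          ∑ ψ : DirichletCharacter ℂ d, ψ (m : ZMod d) * conj (ψ (n : ZMod d)) else 0 := by
      simp only [u, v, Finset.sum_filter, Finset.sum_mul_sum]
      rw [Finset.sum_comm]
      refine Finset.sum_congr rfl fun m _ => ?_
      rw [Finset.sum_comm]
      refine Finset.sum_congr rfl fun n _ => ?_
      rw [Finset.mul_sum]
      by_cases h3 : m.Coprime c
      · by_cases h4 : n.Coprime c
        · simp only [if_pos h3, if_pos h4, if_pos (And.intro h3 h4)]
          exact Finset.sum_congr rfl fun ψ _ => by ring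
        · simp only [h4, and_false, if_false, mul_zero, Finset.sum_const_zero]
      · simp only [h3, false_and, if_false, zero_mul, Finset.sum_const_zero]
    rw [h2, eq_sub_iff_add_eq, offDiagonal, ← Finset.sum_add_distrib, Finset.mul_sum]
    refine Finset.sum_congr rfl fun m hm => ?_
    have h3 : (if m.Coprime c ∧ m.Coprime d then a m * b m else 0) = ∑ n ∈ Icc 1 M,
        if m = n then (if m.Coprime c ∧ m.Coprime d then a m * b m else 0) else 0 := by
      rw [Finset.sum_ite_eq, if_pos hm]
    rw [h3, ← Finset.sum_add_distrib, Finset.mul_sum]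
    refine Finset.sum_congr rfl fun n _ => ?_
    by_cases hnd : n.Coprime d
    · rw [sum_dirichletCharacter_mul_conj m hnd]
      have h5 : m ≡ n [MOD d] → m.Coprime d := fun h => by
        rw [Nat.Coprime, h.gcd_eq]
        exact hnd
      by_cases hmn : m = n
      · subst hmn
        by_cases hmc : m.Coprime c
        · rw [if_neg (fun h => h.1 rfl), if_pos rfl, if_pos ⟨hmc, hnd⟩, if_pos ⟨hmc, hmc⟩,
            if_pos (Nat.ModEq.refl m)]
          field_simp
          ring
        · rw [if_neg (fun h => h.1 rfl), if_pos rfl, if_neg (fun h => hmc h.1),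
            if_neg (fun h => hmc h.1)]
          ring
      · rw [if_neg hmn, add_zero]
        by_cases hmod : m ≡ n [MOD d]
        · by_cases hcc : m.Coprime c ∧ n.Coprime c
          · rw [if_pos ⟨hmn, hcc, ⟨h5 hmod, hnd⟩, hmod⟩, if_pos hcc, if_pos hmod]
            field_simp
          · rw [if_neg (fun h => hcc h.2.1), if_neg hcc, mul_zero]
        · rw [if_neg (fun h => hmod h.2.2.2), if_neg hmod, mul_zero]
          simp
    · have h4 : ∑ ψ : DirichletCharacter ℂ d, ψ (m : ZMod d) * conj (ψ (n : ZMod d)) = 0 := by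
        refine Finset.sum_eq_zero fun ψ _ => ?_
        rw [ψ.map_nonunit (a := (n : ZMod d)) (by rwa [ZMod.isUnit_iff_coprime]), map_zero,
          mul_zero]
      rw [h4, if_neg (fun h => hnd h.2.2.1.2)]
      by_cases hmn : m = n
      · subst hmn
        rw [if_pos rfl, if_neg (fun h => hnd h.2)]
        simp
      · simp [hmn]
  rw [h1, mul_add, mul_one]
  refine (norm_sub_le _ _).trans (add_le_add ?_ ?_)
  · rw [norm_mul, norm_inv, Complex.norm_natCast, inv_mul_le_iff₀ hφ]
    refine (norm_sum_le _ _).trans ((Finset.sum_le_card_nsmul _ _ (A ^ 2) fun ψ _ => ?_).trans ?_)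
    · rw [norm_mul, sq]
      exact mul_le_mul (hu ψ) (hv ψ) (norm_nonneg _) hA
    · rw [nsmul_eq_mul, Finset.card_univ, ← Nat.card_eq_fintype_card,
        DirichletCharacter.card_eq_totient_of_hasEnoughRootsOfUnity]
  · refine le_trans ?_ (sum_norm_mul_le hQ ha hb (g := fun _ => 1) (fun _ => zero_le_one))
    refine (norm_sum_le _ _).trans (Finset.sum_le_sum fun n _ => ?_)
    split_ifs
    · simp
    · simp only [norm_zero, mul_one]; positivity

/-- The contribution of the large `c` (the moduli `d` are small). -/
theorem norm_sum_offDiagonal_le_of_large {W : ℝ → ℂ}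
    (hWsupp : Function.support W ⊆ Set.Icc 1 2) {B : ℝ} (hB : ∀ x, ‖W x‖ ≤ B) {A Q : ℝ} {M : ℕ}
    {a b : ℕ → ℂ} (hQ : 1 ≤ Q) (ha : LevelBound A Q M a) (hb : LevelBound A Q M b) {c : ℕ}
    (hc : 1 ≤ c) (N : ℕ) :
    ‖∑ d ∈ Icc 1 ⌊2 * Q⌋₊, (if d.Coprime N then rho c d else 0) * W ((c : ℝ) * d / Q) *
      offDiagonal M a b c d‖ ≤ 2 * Q / c * (B * (A ^ 2 * (1 + ∑ n ∈ Icc 1 M, 1 / (n : ℝ)))) := by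
  have hB0 : 0 ≤ B := (norm_nonneg _).trans (hB 0)
  have hc0 : (0 : ℝ) < c := by exact_mod_cast hc
  have hH : 0 ≤ ∑ n ∈ Icc 1 M, 1 / (n : ℝ) := Finset.sum_nonneg fun n _ => by positivity
  have h1 : ∑ d ∈ Icc 1 ⌊2 * Q⌋₊, (if d.Coprime N then rho c d else 0) * W ((c : ℝ) * d / Q) *
      offDiagonal M a b c d = ∑ d ∈ (Icc 1 ⌊2 * Q⌋₊).filter (fun d => c * d ≤ ⌊2 * Q⌋₊),
      (if d.Coprime N then rho c d else 0) * W ((c : ℝ) * d / Q) * offDiagonal M a b c d := by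
    symm
    refine Finset.sum_filter_of_ne fun d _ hne => ?_
    by_contra h
    refine hne ?_
    rw [eq_zero_of_floor_lt hWsupp hQ (not_le.1 h)]
    ring
  have hcard : (((Icc 1 ⌊2 * Q⌋₊).filter (fun d => c * d ≤ ⌊2 * Q⌋₊)).card : ℝ) ≤ 2 * Q / c := by
    have h2 : (Icc 1 ⌊2 * Q⌋₊).filter (fun d => c * d ≤ ⌊2 * Q⌋₊) ⊆ Icc 1 (⌊2 * Q⌋₊ / c) := by
      intro d hd
      rw [mem_filter, mem_Icc] at hd
      refine mem_Icc.2 ⟨hd.1.1, (Nat.le_div_iff_mul_le hc).2 ?_⟩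
      rw [mul_comm]
      exact hd.2
    have h3 := Finset.card_le_card h2
    rw [Nat.card_Icc, Nat.add_sub_cancel] at h3
    have h4 : ((⌊2 * Q⌋₊ / c : ℕ) : ℝ) ≤ 2 * Q / c :=
      Nat.cast_div_le.trans (div_le_div_of_nonneg_right (Nat.floor_le (by linarith)) hc0.le)
    exact le_trans (by exact_mod_cast h3) h4
  rw [h1]
  refine (norm_sum_le _ _).trans ((Finset.sum_le_card_nsmul _ _
    (B * (A ^ 2 * (1 + ∑ n ∈ Icc 1 M, 1 / (n : ℝ)))) fun d hd => ?_).trans ?_)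
  · rw [mem_filter, mem_Icc] at hd
    have hcd : ((c * d : ℕ) : ℝ) ≤ 2 * Q := (Nat.le_floor_iff (by linarith)).1 hd.2
    have hr : ‖(if d.Coprime N then rho c d else 0)‖ ≤ 1 := by
      split_ifs
      · exact norm_rho_le_one (by omega) (by omega)
      · simp
    rw [norm_mul, norm_mul]
    refine mul_le_mul ?_ (norm_offDiagonal_le hQ ha hb hc hd.1.1 hcd) (norm_nonneg _) hB0
    calc _ ≤ 1 * B := mul_le_mul hr (hB _) (norm_nonneg _) zero_le_one
      _ = B := one_mul B
  · rw [nsmul_eq_mul]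
    exact mul_le_mul_of_nonneg_right hcard (by positivity)

/-! ### The small `c`: switching to characters of small conductor -/

/-- The bilinear pairing of the weight `w` with `G`. -/
def pairing (M : ℕ) (w G : ℕ → ℕ → ℂ) : ℂ := ∑ m ∈ Icc 1 M, ∑ n ∈ Icc 1 M, w m n * G m n

/-- Linearity in `G` for a fixed weight, so that the nested sums produced by the switching can be
peeled off one layer at a time. -/
theorem norm_pairing_sum_le {ι : Type*} (M : ℕ) (w : ℕ → ℕ → ℂ) (s : Finset ι)
    (G : ι → ℕ → ℕ → ℂ) {B : ι → ℝ} (h : ∀ i ∈ s, ‖pairing M w (G i)‖ ≤ B i) :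
    ‖pairing M w (fun m n => ∑ i ∈ s, G i m n)‖ ≤ ∑ i ∈ s, B i := by
  have : pairing M w (fun m n => ∑ i ∈ s, G i m n) = ∑ i ∈ s, pairing M w (G i) := by
    simp only [pairing, Finset.mul_sum]
    symm
    rw [Finset.sum_comm]
    exact Finset.sum_congr rfl fun m _ => Finset.sum_comm
  rw [this]
  exact (norm_sum_le _ _).trans (Finset.sum_le_sum h)

theorem norm_pairing_const_mul_le (M : ℕ) (w : ℕ → ℕ → ℂ) (x : ℂ) (G : ℕ → ℕ → ℂ) {B y : ℝ}
    (hx : ‖x‖ ≤ y) (h : ‖pairing M w G‖ ≤ B) :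
    ‖pairing M w (fun m n => x * G m n)‖ ≤ y * B := by
  have : pairing M w (fun m n => x * G m n) = x * pairing M w G := by
    simp only [pairing, Finset.mul_sum]
    exact Finset.sum_congr rfl fun m _ => Finset.sum_congr rfl fun n _ => by ring
  rw [this, norm_mul]
  exact mul_le_mul hx h (norm_nonneg _) ((norm_nonneg _).trans hx)

/-- The weight `a_m b_n` on the pairs coprime to `c`. -/
def coprimeWeight (a b : ℕ → ℂ) (c m n : ℕ) : ℂ :=
  if m.Coprime c ∧ n.Coprime c then a m * b n else 0

section

variable {W : ℝ → ℂ} {D : ℝ}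

/-- After `m = t m'`, `n = t n'` the kernel is `W((m' - n') / Y)` with `Y = e Q / (c t)`, on a range
of length `M / t`. The quotient of length by `Y` is at most `c M / (e Q)`, free of `t`, and the two
bounds `A / √t` multiply to `A² / t`. If `t` is not coprime to `c`, all terms vanish. -/
theorem norm_pairing_character_le
    (hD : ∀ (Y : ℝ) (_ : 0 < Y) (M : ℕ) (A B : ℝ) (α β : ℕ → ℂ),
      (∀ u ≤ M, ‖∑ m ∈ Icc 1 u, α m‖ ≤ A) → (∀ u ≤ M, ‖∑ m ∈ Icc 1 u, β m‖ ≤ B) →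
      ‖∑ m ∈ Icc 1 M, ∑ n ∈ Icc 1 M, α m * β n * W (((m : ℝ) - n) / Y)‖ ≤
        A * B * (D * (1 + M / Y))) (hD0 : 0 ≤ D)
    {A Q : ℝ} {M : ℕ} {a b : ℕ → ℂ} (hQ : 1 ≤ Q) (ha : LevelBound A Q M a)
    (hb : LevelBound A Q M b) {t q c e : ℕ} (ht : 1 ≤ t) (hq : 1 ≤ q) (hc : 1 ≤ c) (he : 1 ≤ e)
    (hl : (q.lcm c : ℝ) ≤ 2 * Q) (ψ : DirichletCharacter ℂ q) :
    ‖pairing M (coprimeWeight a b c) (fun m n => if t ∣ m ∧ t ∣ n then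
      ψ ((m / t : ℕ) : ZMod q) * conj (ψ ((n / t : ℕ) : ZMod q)) *
        W ((c : ℝ) * (((m : ℝ) - n) / e) / Q) else 0)‖ ≤
      A ^ 2 / t * (D * (1 + c * M / (e * Q))) := by
  have ht0 : (0 : ℝ) < t := by exact_mod_cast ht
  have hc0 : (0 : ℝ) < c := by exact_mod_cast hc
  have he0 : (0 : ℝ) < e := by exact_mod_cast he
  have hQ0 : 0 < Q := by linarith
  have hA := ha.nonneg hQ
  let α : ℕ → ℂ := fun m => if (t * m).Coprime c then a (t * m) * ψ (m : ZMod q) else 0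
  let β : ℕ → ℂ := fun m => if (t * m).Coprime c then b (t * m) * conj (ψ (m : ZMod q)) else 0
  have hY : 0 < e * Q / (c * t) := by positivity
  have h1 : pairing M (coprimeWeight a b c) (fun m n => if t ∣ m ∧ t ∣ n then
      ψ ((m / t : ℕ) : ZMod q) * conj (ψ ((n / t : ℕ) : ZMod q)) *
        W ((c : ℝ) * (((m : ℝ) - n) / e) / Q) else 0) =
      ∑ m ∈ Icc 1 (M / t), ∑ n ∈ Icc 1 (M / t),
        α m * β n * W (((m : ℝ) - n) / (e * Q / (c * t))) := by
    have e1 : ∀ m n : ℕ, coprimeWeight a b c m n * (if t ∣ m ∧ t ∣ n then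
        ψ ((m / t : ℕ) : ZMod q) * conj (ψ ((n / t : ℕ) : ZMod q)) *
        W ((c : ℝ) * (((m : ℝ) - n) / e) / Q) else 0) = if t ∣ m then (if t ∣ n then
        coprimeWeight a b c m n * (ψ ((m / t : ℕ) : ZMod q) * conj (ψ ((n / t : ℕ) : ZMod q)) *
        W ((c : ℝ) * (((m : ℝ) - n) / e) / Q)) else 0) else 0 := by
      intro m n
      rw [ite_and]
      split_ifs <;> simp
    simp only [pairing, e1, Finset.sum_ite_irrel, Finset.sum_const_zero]
    rw [sum_Icc_dvd _ _ ht]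
    refine Finset.sum_congr rfl fun m _ => ?_
    rw [sum_Icc_dvd _ _ ht]
    refine Finset.sum_congr rfl fun n _ => ?_
    rw [Nat.mul_div_cancel_left _ ht, Nat.mul_div_cancel_left _ ht]
    have e2 : (c : ℝ) * ((((t * m : ℕ) : ℝ) - ((t * n : ℕ) : ℝ)) / e) / Q =
        ((m : ℝ) - n) / (e * Q / (c * t)) := by
      push_cast
      field_simp
    rw [e2]
    simp only [coprimeWeight, α, β]
    by_cases h3 : (t * m).Coprime c
    · by_cases h4 : (t * n).Coprime c
      · rw [if_pos ⟨h3, h4⟩, if_pos h3, if_pos h4]; ring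
      · rw [if_neg (fun h => h4 h.2), if_neg h4]; ring
    · rw [if_neg (fun h => h3 h.1), if_neg h3]; ring
  have hpart : ∀ (x : ℕ → ℂ) (z : ZMod q → ℂ), (∀ u : ℕ, u * t ≤ M →
      ‖∑ m ∈ Icc 1 u with m.Coprime c, x (t * m) * z (m : ZMod q)‖ ≤ A / √t) →
      ∀ u ≤ M / t, ‖∑ m ∈ Icc 1 u, (if (t * m).Coprime c then x (t * m) * z (m : ZMod q) else 0)‖ ≤
        A / √t := by
    intro x z h u hu
    by_cases htc : t.Coprime c
    · have : ∀ m : ℕ, (t * m).Coprime c ↔ m.Coprime c := fun m => by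
        rw [Nat.coprime_mul_iff_left]
        exact and_iff_right htc
      simp only [this]
      rw [← Finset.sum_filter]
      exact h u ((Nat.le_div_iff_mul_le ht).1 hu)
    · rw [Finset.sum_eq_zero, norm_zero]
      · positivity
      · intro m _
        exact if_neg fun h => htc (Nat.Coprime.coprime_dvd_left (dvd_mul_right t m) h)
  rw [h1]
  refine (hD _ hY (M / t) (A / √t) (A / √t) α β
    (hpart a (fun x => ψ x) fun u hu => ha t q c u ht hq hc hl hu ψ)
    (hpart b (fun x => conj (ψ x)) fun u hu => hb.norm_sum_conj_le ht hq hc hl hu ψ)).trans ?_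
  rw [div_mul_div_comm, Real.mul_self_sqrt ht0.le, ← sq]
  refine mul_le_mul_of_nonneg_left ?_ (by positivity)
  refine mul_le_mul_of_nonneg_left (add_le_add le_rfl ?_) hD0
  have h5 : ((M / t : ℕ) : ℝ) ≤ M / t := Nat.cast_div_le
  refine (div_le_div_of_nonneg_right h5 hY.le).trans (le_of_eq ?_)
  field_simp

/-- The pairs with `n < m` among the off-diagonal pairs. -/
def upperOffDiagonal (M : ℕ) (a b : ℕ → ℂ) (c d : ℕ) : ℂ :=
  ∑ m ∈ Icc 1 M, ∑ n ∈ Icc 1 M,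
    if n < m ∧ (m.Coprime c ∧ n.Coprime c) ∧ (m.Coprime d ∧ n.Coprime d) ∧ m ≡ n [MOD d]
    then a m * b n else 0

theorem offDiagonal_eq_upper_add (M : ℕ) (a b : ℕ → ℂ) (c d : ℕ) :
    offDiagonal M a b c d = upperOffDiagonal M a b c d + upperOffDiagonal M b a c d := by
  have h : upperOffDiagonal M b a c d = ∑ m ∈ Icc 1 M, ∑ n ∈ Icc 1 M,
      if m < n ∧ (m.Coprime c ∧ n.Coprime c) ∧ (m.Coprime d ∧ n.Coprime d) ∧ m ≡ n [MOD d]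
      then a m * b n else 0 := by
    rw [upperOffDiagonal, Finset.sum_comm]
    refine Finset.sum_congr rfl fun m _ => Finset.sum_congr rfl fun n _ => ?_
    have : (m < n ∧ (n.Coprime c ∧ m.Coprime c) ∧ (n.Coprime d ∧ m.Coprime d) ∧ n ≡ m [MOD d]) ↔
        (m < n ∧ (m.Coprime c ∧ n.Coprime c) ∧ (m.Coprime d ∧ n.Coprime d) ∧ m ≡ n [MOD d]) := by
      rw [and_comm (a := n.Coprime c), and_comm (a := n.Coprime d),
        (⟨Nat.ModEq.symm, Nat.ModEq.symm⟩ : n ≡ m [MOD d] ↔ m ≡ n [MOD d])]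
    simp only [this, mul_comm]
  rw [h, upperOffDiagonal, offDiagonal, ← Finset.sum_add_distrib]
  refine Finset.sum_congr rfl fun m _ => ?_
  rw [← Finset.sum_add_distrib]
  refine Finset.sum_congr rfl fun n _ => ?_
  rcases lt_trichotomy m n with hmn | hmn | hmn
  · simp only [hmn.ne, hmn, hmn.not_gt, ne_eq, not_false_eq_true, true_and, false_and, if_false,
      zero_add]
  · simp only [hmn, lt_irrefl, ne_eq, not_true_eq_false, false_and, if_false, add_zero]
  · simp only [hmn.ne', hmn, hmn.not_gt, ne_eq, not_false_eq_true, true_and, false_and, if_false,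
      add_zero]

/-- No condition `n < m` appears on the right: for `m ≤ n` the argument of `W` is nonpositive and
the kernel vanishes by itself. This is what lets `m` and `n` separate apart from the smooth kernel.
The support of `W` also truncates `e` at `c M / Q`. -/
theorem sum_upperOffDiagonal_eq (hWsupp : Function.support W ⊆ Set.Icc 1 2) {Q : ℝ} (hQ : 1 ≤ Q)
    (M : ℕ) (a b : ℕ → ℂ) {c N : ℕ} (hc : 1 ≤ c) (hN : N ≠ 0) (hcN : c.Coprime N) :
    ∑ d ∈ Icc 1 ⌊2 * Q⌋₊, (if d.Coprime N then rho c d else 0) * W ((c : ℝ) * d / Q) *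
      upperOffDiagonal M a b c d = pairing M (coprimeWeight a b c) (fun m n =>
        ∑ j ∈ Icc 1 M, (if j.Coprime N then (μ j : ℂ) else 0) *
          ∑ k ∈ c.divisors, (μ k : ℂ) / k * ∑ l ∈ N.divisors, (μ l : ℂ) *
            ∑ e ∈ Icc 1 ⌊(c : ℝ) * M / Q⌋₊, ∑ g ∈ (k * l * e).divisors,
              ((k * l * e / g).totient : ℂ)⁻¹ * ∑ ψ : DirichletCharacter ℂ (k * l * e / g),
                if j * g ∣ m ∧ j * g ∣ n then
                  ψ ((m / (j * g) : ℕ) : ZMod (k * l * e / g)) *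
                    conj (ψ ((n / (j * g) : ℕ) : ZMod (k * l * e / g))) *
                    W ((c : ℝ) * (((m : ℝ) - n) / e) / Q) else 0) := by
  have hQ0 : 0 < Q := by linarith
  have hc0 : (0 : ℝ) < c := by exact_mod_cast hc
  simp only [upperOffDiagonal, Finset.mul_sum (s := Icc 1 M), pairing]
  rw [Finset.sum_comm]
  refine Finset.sum_congr rfl fun m hm => ?_
  rw [Finset.sum_comm]
  refine Finset.sum_congr rfl fun n hn => ?_
  rw [← Finset.mul_sum]
  by_cases hcop : m.Coprime c ∧ n.Coprime c
  swap
  · rw [coprimeWeight, if_neg hcop, zero_mul]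
    refine Finset.sum_eq_zero fun d _ => ?_
    exact mul_eq_zero_of_right _ (if_neg fun h => hcop h.2.1)
  rw [coprimeWeight, if_pos hcop]
  have hexp : ∑ j ∈ Icc 1 M, (if j.Coprime N then (μ j : ℂ) else 0) *
          ∑ k ∈ c.divisors, (μ k : ℂ) / k * ∑ l ∈ N.divisors, (μ l : ℂ) *
            ∑ e ∈ Icc 1 ⌊(c : ℝ) * M / Q⌋₊, ∑ g ∈ (k * l * e).divisors,
              ((k * l * e / g).totient : ℂ)⁻¹ * ∑ ψ : DirichletCharacter ℂ (k * l * e / g),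
                (if j * g ∣ m ∧ j * g ∣ n then
                  ψ ((m / (j * g) : ℕ) : ZMod (k * l * e / g)) *
                    conj (ψ ((n / (j * g) : ℕ) : ZMod (k * l * e / g))) *
                    W ((c : ℝ) * (((m : ℝ) - n) / e) / Q) else 0) =
      ∑ j ∈ Icc 1 M, if j.Coprime N ∧ j ∣ m ∧ j ∣ n then (μ j : ℂ) *
        ∑ k ∈ c.divisors, ∑ l ∈ N.divisors, (μ k : ℂ) / k * μ l *
          ∑ e ∈ Icc 1 ⌊(c : ℝ) * M / Q⌋₊, (if m / j ≡ n / j [MOD k * l * e] then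
            W ((c : ℝ) * (((m : ℝ) - n) / e) / Q) else 0) else 0 := by
    refine Finset.sum_congr rfl fun j hj => ?_
    by_cases hjmn : j ∣ m ∧ j ∣ n
    swap
    · rw [if_neg (c := j.Coprime N ∧ j ∣ m ∧ j ∣ n) (fun h => hjmn h.2)]
      have hno : ∀ g, ¬ (j * g ∣ m ∧ j * g ∣ n) := fun g h =>
        hjmn ⟨(dvd_mul_right j g).trans h.1, (dvd_mul_right j g).trans h.2⟩
      simp only [if_neg (hno _), Finset.sum_const_zero, mul_zero]
    by_cases hjN : j.Coprime N
    swap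
    · rw [if_neg hjN, if_neg (fun h => hjN h.1), zero_mul]
    rw [if_pos hjN, if_pos ⟨hjN, hjmn⟩]
    refine congrArg _ (Finset.sum_congr rfl fun k hk => ?_)
    rw [Finset.mul_sum]
    refine Finset.sum_congr rfl fun l hl => ?_
    rw [mul_assoc]
    refine congrArg _ (congrArg _ (Finset.sum_congr rfl fun e he => ?_))
    have hE : k * l * e ≠ 0 := mul_ne_zero (mul_ne_zero (Nat.pos_of_mem_divisors hk).ne'
      (Nat.pos_of_mem_divisors hl).ne') (by have := (mem_Icc.1 he).1; omega)
    have h1 : (if m / j ≡ n / j [MOD k * l * e] then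
            W ((c : ℝ) * (((m : ℝ) - n) / e) / Q) else 0) =
        (if m / j ≡ n / j [MOD k * l * e] then (1 : ℂ) else 0) *
            W ((c : ℝ) * (((m : ℝ) - n) / e) / Q) := by
      split_ifs <;> simp
    rw [h1, ite_modEq_eq_sum hE, Finset.sum_mul]
    refine Finset.sum_congr rfl fun g _ => ?_
    simp only [Nat.div_div_eq_div_mul, Nat.dvd_div_iff_mul_dvd hjmn.1,
      Nat.dvd_div_iff_mul_dvd hjmn.2]
    split_ifs
    · rw [← Finset.sum_mul]
      ring
    · simp
  rw [hexp]
  by_cases hmn : n < m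
  · rw [← sum_divisors_coprime_switch hmn (mem_Icc.1 hn).1 (mem_Icc.1 hm).2 hN hcN hcop.1
      (fun x => W ((c : ℝ) * x / Q)), Finset.mul_sum]
    · have hsub : m - n ≠ 0 := by omega
      have hmod : ∀ d : ℕ, d ∣ m - n ↔ m ≡ n [MOD d] := fun d =>
        ((Nat.modEq_iff_dvd' hmn.le).symm).trans ⟨Nat.ModEq.symm, Nat.ModEq.symm⟩
      have h2 : ∀ d : ℕ, (if d.Coprime N then rho c d else 0) * W ((c : ℝ) * d / Q) *
          (if n < m ∧ (m.Coprime c ∧ n.Coprime c) ∧ (m.Coprime d ∧ n.Coprime d) ∧ m ≡ n [MOD d]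
            then a m * b n else 0) = if d ∣ m - n then
          a m * b n * (if d.Coprime N ∧ d.Coprime m then rho c d * W ((c : ℝ) * d / Q) else 0)
          else 0 := by
        intro d
        have key : (n < m ∧ (m.Coprime c ∧ n.Coprime c) ∧ (m.Coprime d ∧ n.Coprime d) ∧
            m ≡ n [MOD d]) ↔ d ∣ m - n ∧ d.Coprime m := by
          rw [hmod]
          refine ⟨fun h => ⟨h.2.2.2, h.2.2.1.1.symm⟩, fun h => ⟨hmn, hcop, ⟨h.2.symm, ?_⟩, h.1⟩⟩
          rw [Nat.Coprime, ← h.1.gcd_eq]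
          exact h.2.symm
        simp only [key, ite_and]
        split_ifs <;> ring
      simp only [h2]
      rw [← Finset.sum_filter]
      refine Finset.sum_subset_zero_on_sdiff (fun d hd => ?_) (fun d hd => ?_) fun _ _ => rfl
      · rw [mem_filter] at hd
        exact Nat.mem_divisors.2 ⟨hd.2, hsub⟩
      -- A divisor `d` of `m - n` outside the summation range has `c * d > ⌊2 * Q⌋₊`, where `W` is
      -- zero.
      · rw [mem_sdiff, mem_filter, mem_Icc, Nat.mem_divisors] at hd
        have hd0 : 0 < d := Nat.pos_of_dvd_of_pos hd.1.1 (Nat.pos_of_ne_zero hsub)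
        have hR : ⌊2 * Q⌋₊ < c * d := by
          by_contra h
          exact hd.2 ⟨⟨hd0, (Nat.le_mul_of_pos_left d hc).trans (not_lt.1 h)⟩, hd.1.1⟩
        rw [eq_zero_of_floor_lt hWsupp hQ hR]
        simp
    · intro e he
      have he' := Nat.lt_of_floor_lt he
      have he0 : (0 : ℝ) < e := lt_of_le_of_lt (by positivity) he'
      refine eq_zero_of_lt_one hWsupp ((div_lt_one hQ0).2 ?_)
      rw [div_lt_iff₀ hQ0] at he'
      rw [mul_div_assoc', div_lt_iff₀ he0]
      have h3 : (m : ℝ) ≤ M := by exact_mod_cast (mem_Icc.1 hm).2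
      have h4 : (0 : ℝ) ≤ n := Nat.cast_nonneg n
      nlinarith [mul_nonneg hc0.le h4, mul_le_mul_of_nonneg_left h3 hc0.le]
  · have hle : (m : ℝ) - n ≤ 0 := by
      have : (m : ℝ) ≤ n := by exact_mod_cast not_lt.1 hmn
      linarith
    have hz : ∀ e : ℕ, W ((c : ℝ) * (((m : ℝ) - n) / e) / Q) = 0 := fun e => by
      refine eq_zero_of_lt_one hWsupp (lt_of_le_of_lt ?_ one_pos)
      exact div_nonpos_of_nonpos_of_nonneg (mul_nonpos_of_nonneg_of_nonpos hc0.le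
        (div_nonpos_of_nonpos_of_nonneg hle (Nat.cast_nonneg e))) hQ0.le
    simp only [hz, ite_self, Finset.sum_const_zero, mul_zero]
    refine Finset.sum_eq_zero fun d _ => ?_
    exact mul_eq_zero_of_right _ (if_neg fun h => hmn h.1)

/-- The number of characters cancels the factor `1 / φ`, so each choice of `j, k, l, e, g` is
bounded as for one character. The sums over `j, k, e, g` are all harmonic, and `l` contributes the
number of divisors of `N`. The hypothesis `hlevel` keeps the moduli in the admissible range. -/
theorem norm_sum_upperOffDiagonal_le (hWsupp : Function.support W ⊆ Set.Icc 1 2)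
    (hD : ∀ (Y : ℝ) (_ : 0 < Y) (M : ℕ) (A B : ℝ) (α β : ℕ → ℂ),
      (∀ u ≤ M, ‖∑ m ∈ Icc 1 u, α m‖ ≤ A) → (∀ u ≤ M, ‖∑ m ∈ Icc 1 u, β m‖ ≤ B) →
      ‖∑ m ∈ Icc 1 M, ∑ n ∈ Icc 1 M, α m * β n * W (((m : ℝ) - n) / Y)‖ ≤
        A * B * (D * (1 + M / Y))) (hD0 : 0 ≤ D)
    {A Q : ℝ} {M : ℕ} {a b : ℕ → ℂ} (hQ : 1 ≤ Q) (ha : LevelBound A Q M a)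
    (hb : LevelBound A Q M b) {c N : ℕ} (hc : 1 ≤ c) (hN : N ≠ 0) (hcN : c.Coprime N)
    (hlevel : (N : ℝ) * c * (c * M / Q) ≤ 2 * Q) :
    ‖∑ d ∈ Icc 1 ⌊2 * Q⌋₊, (if d.Coprime N then rho c d else 0) * W ((c : ℝ) * d / Q) *
      upperOffDiagonal M a b c d‖ ≤
      2 * D * A ^ 2 * (c * M / Q) * (∑ j ∈ Icc 1 M, 1 / (j : ℝ)) * N.divisors.card *
        (∑ g ∈ Icc 1 ⌊2 * Q⌋₊, 1 / (g : ℝ)) ^ 3 := by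
  have hQ0 : 0 < Q := by linarith
  have hc0 : (0 : ℝ) < c := by exact_mod_cast hc
  set R := ⌊2 * Q⌋₊ with hR
  set Z := ⌊(c : ℝ) * M / Q⌋₊ with hZ
  have hNcZ : N * c * Z ≤ R := by
    rw [hR, Nat.le_floor_iff (by linarith)]
    push_cast
    refine le_trans ?_ hlevel
    exact mul_le_mul_of_nonneg_left (Nat.floor_le (by positivity)) (by positivity)
  have hsub : ∀ s : Finset ℕ, (∀ x ∈ s, x ∈ Icc 1 R) →
      ∑ x ∈ s, 1 / (x : ℝ) ≤ ∑ g ∈ Icc 1 R, 1 / (g : ℝ) := fun s hs =>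
    Finset.sum_le_sum_of_subset_of_nonneg hs fun _ _ _ => by positivity
  set H := ∑ g ∈ Icc 1 R, 1 / (g : ℝ) with hH
  have hH0 : 0 ≤ H := Finset.sum_nonneg fun _ _ => by positivity
  set T := 2 * D * A ^ 2 * (c * M / Q) with hT
  have hT0 : 0 ≤ T := by positivity
  rw [sum_upperOffDiagonal_eq hWsupp hQ M a b hc hN hcN]
  have inner : ∀ j ∈ Icc 1 M, ∀ k ∈ c.divisors, ∀ l ∈ N.divisors, ∀ e ∈ Icc 1 Z,
      ∀ g ∈ (k * l * e).divisors, ‖pairing M (coprimeWeight a b c) (fun m n =>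
        ((k * l * e / g).totient : ℂ)⁻¹ * ∑ ψ : DirichletCharacter ℂ (k * l * e / g),
                if j * g ∣ m ∧ j * g ∣ n then
                  ψ ((m / (j * g) : ℕ) : ZMod (k * l * e / g)) *
                    conj (ψ ((n / (j * g) : ℕ) : ZMod (k * l * e / g))) *
                    W ((c : ℝ) * (((m : ℝ) - n) / e) / Q) else 0)‖ ≤
        T * (1 / j) * (1 / e) * (1 / g) := by
    intro j hj k hk l hl e he g hg
    have hj0 : 0 < j := (mem_Icc.1 hj).1
    have hk0 := Nat.pos_of_mem_divisors hk
    have hl0 := Nat.pos_of_mem_divisors hl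
    have he0 : 0 < e := (mem_Icc.1 he).1
    have hg0 := Nat.pos_of_mem_divisors hg
    have hgE := Nat.dvd_of_mem_divisors hg
    have hE0 : 0 < k * l * e := by positivity
    have hq0 : 0 < k * l * e / g := Nat.div_pos (Nat.le_of_dvd hE0 hgE) hg0
    have hjR : (0 : ℝ) < j := by exact_mod_cast hj0
    have heR : (0 : ℝ) < e := by exact_mod_cast he0
    have hgR : (0 : ℝ) < g := by exact_mod_cast hg0
    -- As `k ∣ c`, both `k * l * e / g` and `c` divide `l * e * c`, so the least common multiple
    -- does not pay for `c` twice.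
    have hlcm : (((k * l * e / g).lcm c : ℕ) : ℝ) ≤ 2 * Q := by
      have h1 : (k * l * e / g).lcm c ∣ l * e * c := by
        refine Nat.lcm_dvd ((Nat.div_dvd_of_dvd hgE).trans ?_) (dvd_mul_left _ _)
        rw [mul_assoc, mul_comm]
        exact Nat.mul_dvd_mul_left _ (Nat.dvd_of_mem_divisors hk)
      have h2 : l * e * c ≤ R := by
        refine le_trans ?_ hNcZ
        rw [mul_right_comm]
        exact Nat.mul_le_mul (Nat.mul_le_mul (Nat.divisor_le hl) le_rfl) (mem_Icc.1 he).2
      exact (Nat.le_floor_iff (by linarith)).1 ((Nat.le_of_dvd (by positivity) h1).trans h2)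
    -- The cutoff on `e` lets the `1` in `1 + c M / (e Q)` be absorbed, leaving a factor `1 / e`.
    have hone : 1 ≤ (c : ℝ) * M / (e * Q) := by
      have h3 : (e : ℝ) ≤ c * M / Q :=
        (Nat.cast_le.2 (mem_Icc.1 he).2).trans (Nat.floor_le (by positivity))
      rw [one_le_div (by positivity)]
      rwa [le_div_iff₀ hQ0] at h3
    have : NeZero (k * l * e / g) := ⟨hq0.ne'⟩
    have hφ : (0 : ℝ) < (k * l * e / g).totient := by exact_mod_cast Nat.totient_pos.2 hq0
    refine (norm_pairing_const_mul_le _ _ _ _ (y := ((k * l * e / g).totient : ℝ)⁻¹) (le_of_eq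
      (by rw [norm_inv, Complex.norm_natCast])) (norm_pairing_sum_le _ _ _ _ fun ψ _ =>
        norm_pairing_character_le hD hD0 hQ ha hb (Nat.mul_pos hj0 hg0) hq0 hc he0 hlcm ψ)).trans ?_
    rw [Finset.sum_const, nsmul_eq_mul, Finset.card_univ, ← Nat.card_eq_fintype_card,
        DirichletCharacter.card_eq_totient_of_hasEnoughRootsOfUnity, inv_mul_cancel_left₀ hφ.ne']
    have h4 : A ^ 2 / ((j * g : ℕ) : ℝ) * (D * (1 + c * M / (e * Q))) ≤
        A ^ 2 / ((j * g : ℕ) : ℝ) * (D * (2 * (c * M / (e * Q)))) := by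
      refine mul_le_mul_of_nonneg_left (mul_le_mul_of_nonneg_left (by linarith) hD0) (by positivity)
    refine h4.trans (le_of_eq ?_)
    rw [hT]
    push_cast
    field_simp
  have step : ∀ j ∈ Icc 1 M, ‖pairing M (coprimeWeight a b c) (fun m n =>
      (if j.Coprime N then (μ j : ℂ) else 0) *
          ∑ k ∈ c.divisors, (μ k : ℂ) / k * ∑ l ∈ N.divisors, (μ l : ℂ) *
            ∑ e ∈ Icc 1 Z, ∑ g ∈ (k * l * e).divisors,
              ((k * l * e / g).totient : ℂ)⁻¹ * ∑ ψ : DirichletCharacter ℂ (k * l * e / g),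
                if j * g ∣ m ∧ j * g ∣ n then
                  ψ ((m / (j * g) : ℕ) : ZMod (k * l * e / g)) *
                    conj (ψ ((n / (j * g) : ℕ) : ZMod (k * l * e / g))) *
                    W ((c : ℝ) * (((m : ℝ) - n) / e) / Q) else 0)‖ ≤
      1 * ∑ k ∈ c.divisors, 1 / (k : ℝ) * ∑ l ∈ N.divisors, 1 * ∑ e ∈ Icc 1 Z,
        T * (1 / j) * (1 / e) * H := by
    intro j hj
    have hjR : (0 : ℝ) < j := by exact_mod_cast (mem_Icc.1 hj).1
    refine norm_pairing_const_mul_le _ _ _ _ ?_ (norm_pairing_sum_le _ _ _ _ fun k hk =>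
      norm_pairing_const_mul_le _ _ _ _ ?_ (norm_pairing_sum_le _ _ _ _ fun l hl =>
      norm_pairing_const_mul_le _ _ _ _ (norm_moebius_le_one l) (norm_pairing_sum_le _ _ _ _
      fun e he => (norm_pairing_sum_le _ _ _ _ fun g hg => inner j hj k hk l hl e he g hg).trans
        ?_)))
    · split_ifs
      · exact norm_moebius_le_one j
      · simp
    · rw [norm_div, Complex.norm_natCast]
      exact div_le_div_of_nonneg_right (norm_moebius_le_one k) (Nat.cast_nonneg k)
    · rw [← Finset.mul_sum]
      have heR : (0 : ℝ) < e := by exact_mod_cast (mem_Icc.1 he).1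
      refine mul_le_mul_of_nonneg_left (hsub _ fun g hg => ?_) (by positivity)
      refine mem_Icc.2 ⟨Nat.pos_of_mem_divisors hg, (Nat.divisor_le hg).trans ?_⟩
      refine le_trans ?_ hNcZ
      rw [mul_comm N c]
      exact Nat.mul_le_mul (Nat.mul_le_mul (Nat.divisor_le hk) (Nat.divisor_le hl))
        (mem_Icc.1 he).2
  refine (norm_pairing_sum_le _ _ _ _ step).trans ?_
  have hfac : ∀ j : ℕ, 1 * ∑ k ∈ c.divisors, 1 / (k : ℝ) * ∑ l ∈ N.divisors, 1 * ∑ e ∈ Icc 1 Z,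
        T * (1 / (j : ℝ)) * (1 / (e : ℝ)) * H =
      1 / (j : ℝ) * (T * N.divisors.card * H * (∑ k ∈ c.divisors, 1 / (k : ℝ)) *
        ∑ e ∈ Icc 1 Z, 1 / (e : ℝ)) := by
    intro j
    simp only [Finset.sum_const, nsmul_eq_mul, ← Finset.sum_mul, ← Finset.mul_sum]
    ring
  simp only [hfac]
  rw [← Finset.sum_mul]
  have hcR : c * Z ≤ R := (Nat.mul_le_mul_right Z
    (Nat.le_mul_of_pos_left c (Nat.pos_of_ne_zero hN))).trans hNcZ
  -- For `Z = 0` there is no `e` at all; `Z ≥ 1` is needed below to place the divisors of `c` under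
  -- `R`.
  rcases Nat.eq_zero_or_pos Z with hZ0 | hZ0
  · rw [hZ0]
    simp only [Finset.Icc_eq_empty_of_lt Nat.zero_lt_one, Finset.sum_empty, mul_zero]
    have : 0 ≤ ∑ j ∈ Icc 1 M, 1 / (j : ℝ) := Finset.sum_nonneg fun _ _ => by positivity
    positivity
  have h5 : ∑ k ∈ c.divisors, 1 / (k : ℝ) ≤ H := hsub _ fun k hk =>
    mem_Icc.2 ⟨Nat.pos_of_mem_divisors hk, (Nat.divisor_le hk).trans
      ((Nat.le_mul_of_pos_right c hZ0).trans hcR)⟩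
  have h6 : ∑ e ∈ Icc 1 Z, 1 / (e : ℝ) ≤ H := hsub _ fun e he =>
    mem_Icc.2 ⟨(mem_Icc.1 he).1, (mem_Icc.1 he).2.trans
      ((Nat.le_mul_of_pos_left Z hc).trans hcR)⟩
  have h7 : 0 ≤ ∑ j ∈ Icc 1 M, 1 / (j : ℝ) := Finset.sum_nonneg fun _ _ => by positivity
  have h8 : 0 ≤ ∑ e ∈ Icc 1 Z, 1 / (e : ℝ) := Finset.sum_nonneg fun _ _ => by positivity
  calc _ ≤ (∑ j ∈ Icc 1 M, 1 / (j : ℝ)) * (T * N.divisors.card * H * H * H) := by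
        gcongr
    _ = _ := by ring

end

/-! ### The divisor function and harmonic sums -/

/-- Compare the factors `v + 1` and `p^(δ v)` prime by prime. If `p ≥ 2^(1/δ)`, then `v + 1 ≤ 2^v ≤
p^(δ v)`; each of the finitely many smaller primes costs at most a constant `B`. -/
theorem exists_card_divisors_le (δ : ℝ) (hδ : 0 < δ) :
    ∃ D : ℝ, 1 ≤ D ∧ ∀ n : ℕ, n ≠ 0 → (n.divisors.card : ℝ) ≤ D * (n : ℝ) ^ δ := by
  obtain ⟨P, hP⟩ := exists_nat_gt ((2 : ℝ) ^ (1 / δ))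
  -- Chosen so that `v + 1 ≤ B (1 + v δ log 2)`, while `1 + v δ log 2 ≤ p^(δ v)` by Bernoulli.
  set B : ℝ := 1 + 1 / (δ * Real.log 2) with hB
  have hlog : 0 < Real.log 2 := Real.log_pos (by norm_num)
  have hB1 : 1 ≤ B := by
    rw [hB]
    have : 0 < 1 / (δ * Real.log 2) := by positivity
    linarith
  have hB0 : 0 ≤ B := by linarith
  refine ⟨B ^ P, one_le_pow₀ hB1, fun n hn => ?_⟩
  have hloc : ∀ p ∈ n.primeFactors, ((n.factorization p + 1 : ℕ) : ℝ) ≤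
      (if p < P then B else 1) * ((p ^ n.factorization p : ℕ) : ℝ) ^ δ := by
    intro p hp
    have hp2 : (2 : ℝ) ≤ p := by exact_mod_cast (Nat.prime_of_mem_primeFactors hp).two_le
    set v := n.factorization p
    have e1 : ((p ^ v : ℕ) : ℝ) ^ δ = ((p : ℝ) ^ δ) ^ v := by
      push_cast
      rw [← Real.rpow_natCast, ← Real.rpow_mul (by linarith), mul_comm, Real.rpow_mul (by linarith),
        Real.rpow_natCast]
    rw [e1]
    push_cast
    split_ifs with hpP
    · have h1 : 1 + v * (δ * Real.log 2) ≤ ((p : ℝ) ^ δ) ^ v := by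
        have h2 : 1 + δ * Real.log 2 ≤ (p : ℝ) ^ δ := by
          refine le_trans ?_ (Real.rpow_le_rpow (by norm_num) hp2 hδ.le)
          rw [Real.rpow_def_of_pos (by norm_num), mul_comm, add_comm, mul_comm]
          rw [mul_comm δ]
          exact Real.add_one_le_exp _
        refine le_trans ?_ (pow_le_pow_left₀ (by positivity) h2 v)
        exact one_add_mul_le_pow (le_trans (by norm_num) (mul_nonneg hδ.le hlog.le)) v
      refine le_trans ?_ (mul_le_mul_of_nonneg_left h1 hB0)
      have h3 : B * (1 + v * (δ * Real.log 2)) = 1 + v + 1 / (δ * Real.log 2) +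
          v * (δ * Real.log 2) := by
        rw [hB]
        field_simp
        ring
      rw [h3]
      have : 0 ≤ 1 / (δ * Real.log 2) + v * (δ * Real.log 2) := by positivity
      linarith
    · rw [one_mul]
      have h1 : (2 : ℝ) ≤ (p : ℝ) ^ δ := by
        have h2 : (2 : ℝ) ^ (1 / δ) ≤ p := hP.le.trans (by exact_mod_cast not_lt.1 hpP)
        have h3 := Real.rpow_le_rpow (by positivity) h2 hδ.le
        rwa [← Real.rpow_mul (by norm_num), one_div, inv_mul_cancel₀ hδ.ne', Real.rpow_one] at h3
      refine le_trans ?_ (pow_le_pow_left₀ (by norm_num) h1 v)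
      have := one_add_mul_le_pow (a := (1 : ℝ)) (by norm_num) v
      norm_num at this
      linarith
  have hn' : ((n : ℕ) : ℝ) ^ δ = ∏ p ∈ n.primeFactors, ((p ^ n.factorization p : ℕ) : ℝ) ^ δ := by
    rw [Real.finsetProd_rpow _ _ (fun p _ => Nat.cast_nonneg _), ← Nat.cast_prod]
    congr 2
    exact (Nat.prod_factorization_pow_eq_self hn).symm
  rw [Nat.card_divisors hn, Nat.cast_prod, hn']
  refine (Finset.prod_le_prod (fun p _ => Nat.cast_nonneg _) hloc).trans ?_
  rw [Finset.prod_mul_distrib]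
  refine mul_le_mul_of_nonneg_right ?_ (Finset.prod_nonneg fun p _ => by positivity)
  rw [Finset.prod_ite, Finset.prod_const_one, mul_one, Finset.prod_const]
  refine pow_le_pow_right₀ hB1 ?_
  have : n.primeFactors.filter (· < P) ⊆ Finset.range P := fun p hp =>
    Finset.mem_range.2 (mem_filter.1 hp).2
  simpa using Finset.card_le_card this

/-- In `n = ∑ φ(d)` over `d ∣ n`, every term is at most `φ(n)`. -/
theorem le_card_divisors_mul_totient (n : ℕ) : n ≤ n.divisors.card * n.totient := by
  rcases Nat.eq_zero_or_pos n with rfl | hn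
  · simp
  conv_lhs => rw [← Nat.sum_totient n]
  refine (Finset.sum_le_card_nsmul _ _ n.totient fun d hd => ?_).trans (by simp)
  exact Nat.le_of_dvd (Nat.totient_pos.2 hn) (Nat.totient_dvd_of_dvd (Nat.dvd_of_mem_divisors hd))

theorem one_div_totient_le {n : ℕ} (hn : n ≠ 0) :
    1 / (n.totient : ℝ) ≤ n.divisors.card / n := by
  have h1 : (0 : ℝ) < n.totient := by exact_mod_cast Nat.totient_pos.2 (Nat.pos_of_ne_zero hn)
  have h2 : (0 : ℝ) < n := by exact_mod_cast Nat.pos_of_ne_zero hn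
  rw [div_le_div_iff₀ h1 h2, one_mul]
  exact_mod_cast le_card_divisors_mul_totient n

theorem sum_one_div_le {δ x : ℝ} (hδ : 0 < δ) (hx : 1 ≤ x) {M : ℕ} (hM : (M : ℝ) ≤ x) :
    ∑ n ∈ Icc 1 M, 1 / (n : ℝ) ≤ (1 + 1 / δ) * x ^ δ := by
  have h1 : ∑ n ∈ Icc 1 M, 1 / (n : ℝ) ≤ 1 + Real.log x := by
    rcases Nat.eq_zero_or_pos M with rfl | hM0
    · simp only [Finset.Icc_eq_empty_of_lt Nat.zero_lt_one, Finset.sum_empty]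
      linarith [Real.log_nonneg hx]
    · have h := harmonic_le_one_add_log M
      rw [harmonic_eq_sum_Icc] at h
      push_cast at h
      simp only [one_div]
      refine h.trans (add_le_add le_rfl (Real.log_le_log (by exact_mod_cast hM0) hM))
  have h2 := Real.log_le_rpow_div (by linarith : 0 ≤ x) hδ
  have h3 : 1 ≤ x ^ δ := Real.one_le_rpow hx hδ.le
  calc _ ≤ 1 + Real.log x := h1
    _ ≤ x ^ δ + x ^ δ / δ := add_le_add h3 h2
    _ = _ := by ring

theorem exists_sum_one_div_totient_le (δ : ℝ) (hδ : 0 < δ) :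
    ∃ D : ℝ, 0 ≤ D ∧ ∀ (x : ℝ) (R : ℕ), 1 ≤ x → (R : ℝ) ≤ x →
      ∑ c ∈ Icc 1 R, 1 / (c.totient : ℝ) ≤ D * (x ^ δ) ^ 2 := by
  obtain ⟨D, hD1, hD⟩ := exists_card_divisors_le δ hδ
  have hD0 : 0 ≤ D := by linarith
  refine ⟨D * (1 + 1 / δ), by positivity, fun x R hx hR => ?_⟩
  calc ∑ c ∈ Icc 1 R, 1 / (c.totient : ℝ) ≤ ∑ c ∈ Icc 1 R, D * x ^ δ * (1 / (c : ℝ)) := by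
        refine Finset.sum_le_sum fun c hc => ?_
        have hc1 := (mem_Icc.1 hc).1
        have hcx : (c : ℝ) ≤ x := (Nat.cast_le.2 (mem_Icc.1 hc).2).trans hR
        refine (one_div_totient_le (by omega)).trans ?_
        rw [mul_one_div]
        refine div_le_div_of_nonneg_right ((hD c (by omega)).trans ?_) (Nat.cast_nonneg c)
        exact mul_le_mul_of_nonneg_left (Real.rpow_le_rpow (Nat.cast_nonneg c) hcx hδ.le) hD0
    _ ≤ D * x ^ δ * ((1 + 1 / δ) * x ^ δ) := by
        rw [← Finset.mul_sum]
        exact mul_le_mul_of_nonneg_left (sum_one_div_le hδ hx hR) (by positivity)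
    _ = _ := by ring

/-! ### The total off-diagonal contribution -/

/-- Bookkeeping with `P = Q^δ`, `s = √N`, `E = Q^(1 - η/2)`, `L = 2 Q / c` and `S` the harmonic sum
up to `X`. The fourth power of `P` is padded to the seventh to match the small `c`. -/
theorem large_part_le {B k P H s E L S : ℝ} (hB : 0 ≤ B) (hP : 1 ≤ P) (hH : 0 ≤ H) (hs : 0 ≤ s)
    (hE : 0 ≤ E) (hL : L ≤ 2 * (s * E)) (hS : S ≤ H * P ^ 2) (hS0 : 0 ≤ S) :
    L * (B * ((k * P) ^ 2 * (1 + S))) ≤ 2 * s * (B * (k ^ 2 * (1 + H))) * P ^ 7 * E := by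
  have h2 : 1 + S ≤ (1 + H) * P ^ 2 := by
    have : 1 ≤ P ^ 2 := one_le_pow₀ hP
    nlinarith
  have hP0 : 0 ≤ P := by linarith
  have h3 : P ^ 4 ≤ P ^ 7 := pow_le_pow_right₀ hP (by norm_num)
  have h4 : 0 ≤ B * ((k * P) ^ 2 * (1 + S)) := by positivity
  calc _ ≤ 2 * (s * E) * (B * ((k * P) ^ 2 * (1 + S))) := mul_le_mul_of_nonneg_right hL h4
    _ ≤ 2 * (s * E) * (B * ((k * P) ^ 2 * ((1 + H) * P ^ 2))) := by gcongr
    _ = 2 * s * (B * (k ^ 2 * (1 + H))) * P ^ 4 * E := by ring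
    _ ≤ 2 * s * (B * (k ^ 2 * (1 + H))) * P ^ 7 * E := by gcongr

/-- Here `L = c M / Q`, `τ` is the number of divisors of `N`, `t = 2^δ`, and `S'` is the harmonic
sum up to `2 Q`. The exponent is `7 = 2 + 2 + 3`, from `A²`, `S` and `S'^3`; the outer factor `2`
counts the pairs `n < m` and `m < n`. -/
theorem small_part_le {D k P H s E L S t S' τ : ℝ} (hD : 0 ≤ D) (hH : 0 ≤ H)
    (hs : 0 ≤ s) (hE : 0 ≤ E) (hL : L ≤ E / s) (hS : S ≤ H * P ^ 2) (hS0 : 0 ≤ S)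
    (hS' : S' ≤ H * t * P) (hS0' : 0 ≤ S') (hτ : 0 ≤ τ) :
    2 * (2 * D * (k * P) ^ 2 * L * S * τ * S' ^ 3) ≤
      4 * D * k ^ 2 / s * H * τ * (H * t) ^ 3 * P ^ 7 * E := by
  have h1 : 0 ≤ 2 * D * (k * P) ^ 2 := by positivity
  calc _ ≤ 2 * (2 * D * (k * P) ^ 2 * (E / s) * (H * P ^ 2) * τ * (H * t * P) ^ 3) := by
        gcongr
    _ = _ := by ring

theorem exists_offDiagonal_bound {W : ℝ → ℂ} (hW : ContDiff ℝ ∞ W)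
    (hWsupp : Function.support W ⊆ Set.Icc 1 2) {η ε : ℝ} (hη : 0 < η) (hεη : ε < η / 2)
    (K : ℝ → ℝ) {N : ℕ} (hN : 1 ≤ N) :
    ∃ C : ℝ, 0 ≤ C ∧ ∀ Q X : ℝ, 1 ≤ Q → X = Q ^ (2 - η) → 1 ≤ X → ∀ a b : ℕ → ℂ,
      CharSumBound K Q X a → CharSumBound K Q X b →
        ‖SCoprime N W Q X a b - diagonalCoprime N W Q X a b‖ ≤ C * Q ^ (1 - ε) := by
  obtain ⟨B, hB0, hB, -⟩ := exists_differences_bound hW hWsupp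
  obtain ⟨D, hD0, hD⟩ := exists_bilinear_bound hW hWsupp
  -- Nine factors `Q^δ` are lost: seven for each `c`, and two in `∑ 1 / φ(c)`.
  set δ : ℝ := (η / 2 - ε) / 9 with hδdef
  have hδ : 0 < δ := by rw [hδdef]; linarith
  obtain ⟨F, hF0, hF⟩ := exists_sum_one_div_totient_le δ hδ
  set H : ℝ := 1 + 1 / δ with hH
  have hH0 : 0 ≤ H := by positivity
  set t : ℝ := 2 ^ δ with ht
  have ht0 : 0 ≤ t := by positivity
  set k : ℝ := |K δ| with hk
  have hk0 : 0 ≤ k := abs_nonneg _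
  have hN0 : (0 : ℝ) < N := by exact_mod_cast hN
  have hsN : 0 < √(N : ℝ) := Real.sqrt_pos.2 hN0
  set C1 : ℝ := 2 * √N * (B * (k ^ 2 * (1 + H))) with hC1
  set C2 : ℝ := 4 * D * k ^ 2 / √N * H * N.divisors.card * (H * t) ^ 3 with hC2
  have hC10 : 0 ≤ C1 := by positivity
  have hC20 : 0 ≤ C2 := by positivity
  refine ⟨(C1 + C2) * (F * t ^ 2), by positivity, fun Q X hQ hX hX1 a b hacs hbcs => ?_⟩
  have hQ0 : 0 < Q := by linarith
  set P : ℝ := Q ^ δ with hP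
  have hP1 : 1 ≤ P := Real.one_le_rpow hQ hδ.le
  have hP0 : 0 ≤ P := by linarith
  set M := ⌊X⌋₊ with hM
  set A : ℝ := k * P with hA
  have hA0 : 0 ≤ A := by positivity
  have ha : LevelBound A Q M a := hacs.levelBound hQ hX1 hδ
  have hb : LevelBound A Q M b := hbcs.levelBound hQ hX1 hδ
  set E : ℝ := Q ^ (1 - η / 2) with hE
  have hE0 : 0 < E := Real.rpow_pos_of_pos hQ0 _
  -- This balances `Q / c0 = √N E` against `c0 X / Q = E / √N`; the factor `√N` makes the level `N
  -- c0 (c0 X / Q)` exactly `Q`.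
  set c0 : ℝ := Q ^ (η / 2) / √N with hc0
  have hc00 : 0 < c0 := by positivity
  have hMX : (M : ℝ) ≤ X := Nat.floor_le (by linarith)
  have hXQ : X ≤ Q ^ (2 : ℝ) := by
    rw [hX]
    exact Real.rpow_le_rpow_of_exponent_le hQ (by linarith)
  have hHM : ∑ n ∈ Icc 1 M, 1 / (n : ℝ) ≤ H * P ^ 2 := by
    refine (sum_one_div_le hδ (Real.one_le_rpow hQ (by norm_num)) (hMX.trans hXQ)).trans
      (le_of_eq ?_)
    rw [← Real.rpow_mul hQ0.le, mul_comm (2 : ℝ) δ, Real.rpow_mul hQ0.le, Real.rpow_ofNat]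
  have hR2 : (⌊2 * Q⌋₊ : ℝ) ≤ 2 * Q := Nat.floor_le (by linarith)
  have h2Q : (2 * Q) ^ δ = t * P := Real.mul_rpow (by norm_num) hQ0.le
  have hHR : ∑ n ∈ Icc 1 ⌊2 * Q⌋₊, 1 / (n : ℝ) ≤ H * t * P := by
    refine (sum_one_div_le hδ (by linarith) hR2).trans (le_of_eq ?_)
    rw [h2Q]
    ring
  have hHM0 : 0 ≤ ∑ n ∈ Icc 1 M, 1 / (n : ℝ) := Finset.sum_nonneg fun _ _ => by positivity
  have hHR0 : 0 ≤ ∑ n ∈ Icc 1 ⌊2 * Q⌋₊, 1 / (n : ℝ) :=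
    Finset.sum_nonneg fun _ _ => by positivity
  have hQc0 : Q / c0 = √N * E := by
    rw [hc0, hE, Real.rpow_sub hQ0, Real.rpow_one]
    field_simp
  have hc0X : c0 * X / Q = E / √N := by
    have : E = Q ^ (η / 2) * X / Q := by
      rw [hE, hX, ← Real.rpow_add hQ0]
      nth_rewrite 3 [← Real.rpow_one Q]
      rw [← Real.rpow_sub hQ0]
      congr 1
      ring
    rw [this, hc0]
    field_simp
  have hNc0 : (N : ℝ) * c0 * (c0 * X / Q) = Q := by
    rw [hc0X, hc0, hE]
    have h1 : Q ^ (η / 2) * Q ^ (1 - η / 2) = Q := by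
      rw [← Real.rpow_add hQ0]
      simp
    have h2 : (N : ℝ) = √N * √N := (Real.mul_self_sqrt hN0.le).symm
    calc (N : ℝ) * (Q ^ (η / 2) / √N) * (Q ^ (1 - η / 2) / √N) =
        N * (Q ^ (η / 2) * Q ^ (1 - η / 2)) / (√N * √N) := by
          field_simp
      _ = Q := by rw [h1, ← h2]; field_simp
  have hterm : ∀ c ∈ Icc 1 ⌊2 * Q⌋₊, c.Coprime N →
      ‖∑ d ∈ Icc 1 ⌊2 * Q⌋₊, (if d.Coprime N then rho c d else 0) * W ((c : ℝ) * d / Q) *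
          offDiagonal M a b c d‖ ≤ (C1 + C2) * P ^ 7 * E := by
    intro c hc hcN
    have hc1 := (mem_Icc.1 hc).1
    have hcpos : (0 : ℝ) < c := by exact_mod_cast hc1
    rcases lt_or_ge c0 (c : ℝ) with hlt | hle
    · refine (norm_sum_offDiagonal_le_of_large hWsupp hB hQ ha hb hc1 N).trans ?_
      have h1 : 2 * Q / c ≤ 2 * (√N * E) := by
        rw [← hQc0, mul_div_assoc]
        exact mul_le_mul_of_nonneg_left (div_le_div_of_nonneg_left hQ0.le hc00 hlt.le) (by norm_num)
      refine (large_part_le (k := k) hB0 hP1 hH0 hsN.le hE0.le h1 hHM hHM0).trans ?_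
      exact mul_le_mul_of_nonneg_right (mul_le_mul_of_nonneg_right (le_add_of_nonneg_right hC20)
        (pow_nonneg hP0 7)) hE0.le
    · have hcM : (c : ℝ) * M / Q ≤ c0 * X / Q := by gcongr
      have hlevel : (N : ℝ) * c * (c * M / Q) ≤ 2 * Q := by
        calc (N : ℝ) * c * (c * M / Q) ≤ N * c0 * (c0 * X / Q) := by gcongr
          _ = Q := hNc0
          _ ≤ 2 * Q := by linarith
      have hN' : N ≠ 0 := by omega
      have u1 := norm_sum_upperOffDiagonal_le hWsupp hD hD0 hQ ha hb hc1 hN' hcN hlevel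
      have u2 := norm_sum_upperOffDiagonal_le hWsupp hD hD0 hQ hb ha hc1 hN' hcN hlevel
      simp only [offDiagonal_eq_upper_add, mul_add, Finset.sum_add_distrib]
      refine (norm_add_le _ _).trans ((add_le_add u1 u2).trans ?_)
      rw [← two_mul]
      refine (small_part_le (k := k) (L := c * M / Q) hD0 hH0 hsN.le hE0.le
        (hcM.trans hc0X.le) hHM hHM0 hHR hHR0 (Nat.cast_nonneg _)).trans ?_
      exact mul_le_mul_of_nonneg_right (mul_le_mul_of_nonneg_right (le_add_of_nonneg_left hC10)
        (pow_nonneg hP0 7)) hE0.le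
  rw [SCoprime_sub_diagonalCoprime hWsupp hQ]
  have hsum : ‖∑ c ∈ Icc 1 ⌊2 * Q⌋₊, if c.Coprime N then (μ c : ℂ) / c.totient *
        ∑ d ∈ Icc 1 ⌊2 * Q⌋₊, (if d.Coprime N then rho c d else 0) * W ((c : ℝ) * d / Q) *
          offDiagonal M a b c d else 0‖ ≤
      ∑ c ∈ Icc 1 ⌊2 * Q⌋₊, 1 / (c.totient : ℝ) * ((C1 + C2) * P ^ 7 * E) := by
    refine (norm_sum_le _ _).trans (Finset.sum_le_sum fun c hc => ?_)
    split_ifs with hcN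
    · rw [norm_mul, norm_div, Complex.norm_natCast]
      exact mul_le_mul (div_le_div_of_nonneg_right (norm_moebius_le_one c) (Nat.cast_nonneg _))
        (hterm c hc hcN) (norm_nonneg _) (by positivity)
    · rw [norm_zero]
      positivity
  refine hsum.trans ?_
  rw [← Finset.sum_mul]
  have h1 := hF (2 * Q) _ (by linarith) hR2
  rw [h2Q] at h1
  have hfin : P ^ 9 * E = Q ^ (1 - ε) := by
    rw [hP, hE, ← Real.rpow_natCast, ← Real.rpow_mul hQ0.le, ← Real.rpow_add hQ0]
    congr 1
    rw [hδdef]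
    push_cast
    ring
  calc _ ≤ F * (t * P) ^ 2 * ((C1 + C2) * P ^ 7 * E) :=
        mul_le_mul_of_nonneg_right h1 (by positivity)
    _ = (C1 + C2) * (F * t ^ 2) * (P ^ 9 * E) := by ring
    _ = _ := by rw [hfin]

/-! ### The Euler product -/

theorem eulerFactor_pos {p : ℕ} (hp : p.Prime) : 0 < eulerFactor p := by
  have h : (2 : ℝ) ≤ p := by exact_mod_cast hp.two_le
  have h2 : 1 / (p : ℝ) ^ 2 ≤ 1 / 2 ^ 2 := by gcongr
  have h3 : 1 / (p : ℝ) ^ 3 ≤ 1 / 2 ^ 3 := by gcongr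
  rw [eulerFactor]
  norm_num at h2 h3 ⊢
  linarith

/-- The sum `∑_{k ∣ c} μ(k) / k²`. -/
def moebiusSq (c : ℕ) : ℝ := ∑ k ∈ c.divisors, (μ k : ℝ) / (k : ℝ) ^ 2

theorem moebiusSq_mul {m n : ℕ} (h : m.Coprime n) :
    moebiusSq (m * n) = moebiusSq m * moebiusSq n := by
  let f : ArithmeticFunction ℝ := ⟨fun k => (μ k : ℝ) / (k : ℝ) ^ 2, by simp⟩
  have hf : f.IsMultiplicative := by
    refine ⟨by simp [f], fun {m n} h => ?_⟩
    simp only [f, ArithmeticFunction.coe_mk,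
      ArithmeticFunction.isMultiplicative_moebius.map_mul_of_coprime h]
    push_cast
    rw [mul_pow, div_mul_div_comm]
  have hmul := (hf.mul ArithmeticFunction.isMultiplicative_zeta.natCast).map_mul_of_coprime h
  simp only [ArithmeticFunction.coe_mul_zeta_apply] at hmul
  exact hmul

theorem moebiusSq_prime {p : ℕ} (hp : p.Prime) : moebiusSq p = 1 - 1 / (p : ℝ) ^ 2 := by
  rw [moebiusSq, hp.sum_divisors, ArithmeticFunction.moebius_apply_prime hp]
  simp
  ring

theorem abs_moebiusSq_le (c : ℕ) : |moebiusSq c| ≤ c.divisors.card := by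
  refine (Finset.abs_sum_le_sum_abs _ _).trans
    ((Finset.sum_le_card_nsmul _ _ 1 fun k hk => ?_).trans (by simp))
  have hk : (1 : ℝ) ≤ k := by exact_mod_cast Nat.pos_of_mem_divisors hk
  have h1 : |(μ k : ℝ)| ≤ 1 := by exact_mod_cast ArithmeticFunction.abs_moebius_le_one (n := k)
  rw [abs_div, abs_of_pos (by positivity : 0 < (k : ℝ) ^ 2), div_le_one (by positivity)]
  exact h1.trans (one_le_pow₀ hk)

/-- The summand of the Dirichlet series at `1` of the Euler product over the primes not dividing
`L`. -/
def eulerSummand (L c : ℕ) : ℝ :=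
  if c.Coprime L then (μ c : ℝ) / (c * c.totient) * moebiusSq c else 0

/-- Both the divisor count and `c / φ(c)` are `O(c^(δ/4))`, so the terms are `O(c^(-1 - δ/2))`. The
case `δ = 1` gives the absolute convergence behind the Euler product; small `δ` serves the error
term. -/
theorem summable_card_divisors_div {δ : ℝ} (hδ : 0 < δ) :
    Summable fun c : ℕ => (c.divisors.card : ℝ) / (c.totient * (c : ℝ) ^ δ) := by
  obtain ⟨D, hD1, hD⟩ := exists_card_divisors_le (δ / 4) (by positivity)
  have hD0 : 0 ≤ D := by linarith
  have hs : Summable fun c : ℕ => D ^ 2 * (1 / (c : ℝ) ^ (1 + δ / 2)) :=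
    (Real.summable_one_div_nat_rpow.2 (by linarith)).mul_left _
  refine Summable.of_nonneg_of_le (fun c => by positivity) (fun c => ?_) hs
  rcases Nat.eq_zero_or_pos c with rfl | hc
  · simp
    positivity
  have hc0 : (0 : ℝ) < c := by exact_mod_cast hc
  have h1 := one_div_totient_le hc.ne'
  have h2 := hD c hc.ne'
  have h3 : (c.divisors.card : ℝ) / (c.totient * (c : ℝ) ^ δ) =
      c.divisors.card * (1 / (c.totient : ℝ)) / (c : ℝ) ^ δ := by
    rw [mul_one_div, div_div]
  rw [h3]
  calc _ ≤ (D * (c : ℝ) ^ (δ / 4)) * ((D * (c : ℝ) ^ (δ / 4)) / c) / (c : ℝ) ^ δ := by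
        refine div_le_div_of_nonneg_right (mul_le_mul h2 (h1.trans
          (div_le_div_of_nonneg_right h2 hc0.le)) (by positivity) (by positivity)) (by positivity)
    _ = D ^ 2 * ((c : ℝ) ^ (δ / 4) * (c : ℝ) ^ (δ / 4) / ((c : ℝ) ^ (1 : ℝ) * (c : ℝ) ^ δ)) := by
        rw [Real.rpow_one]
        field_simp
    _ = D ^ 2 * (1 / (c : ℝ) ^ (1 + δ / 2)) := by
        rw [← Real.rpow_add hc0, ← Real.rpow_add hc0, ← Real.rpow_sub hc0, one_div,
          ← Real.rpow_neg hc0.le]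
        congr 2
        ring

theorem abs_eulerSummand_le (L c : ℕ) :
    |eulerSummand L c| ≤ (c.divisors.card : ℝ) / (c.totient * (c : ℝ) ^ (1 : ℝ)) := by
  rw [eulerSummand, Real.rpow_one]
  split_ifs
  · have h1 : |(μ c : ℝ)| ≤ 1 := by exact_mod_cast ArithmeticFunction.abs_moebius_le_one (n := c)
    rw [abs_mul, abs_div, abs_of_nonneg (by positivity : (0 : ℝ) ≤ c * c.totient),
      mul_comm (c : ℝ), div_mul_eq_mul_div]
    refine div_le_div_of_nonneg_right ?_ (by positivity)
    calc _ ≤ 1 * (c.divisors.card : ℝ) :=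
          mul_le_mul h1 (abs_moebiusSq_le c) (abs_nonneg _) zero_le_one
      _ = _ := one_mul _
  · rw [abs_zero]
    positivity

theorem summable_eulerSummand (L : ℕ) : Summable fun c => ‖eulerSummand L c‖ :=
  Summable.of_nonneg_of_le (fun _ => norm_nonneg _) (abs_eulerSummand_le L)
    (summable_card_divisors_div one_pos)

/-- The Möbius factor leaves only `e = 0, 1`, and for `p ∤ L` one has `1 - (1 - 1/p²) / (p (p - 1))
= 1 - (p + 1) / p³`. -/
theorem tsum_eulerSummand_prime_pow (L : ℕ) {p : ℕ} (hp : p.Prime) :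
    ∑' e, eulerSummand L (p ^ e) = if p ∣ L then 1 else eulerFactor p := by
  have h2 : ∀ e ∉ Finset.range 2, eulerSummand L (p ^ e) = 0 := by
    intro e he
    rw [Finset.mem_range, not_lt] at he
    have : μ (p ^ e) = 0 := by
      rw [ArithmeticFunction.moebius_apply_prime_pow hp (by omega), if_neg (by omega)]
    rw [eulerSummand, this]
    simp
  rw [tsum_eq_sum h2, Finset.sum_range_succ, Finset.sum_range_one, pow_zero, pow_one]
  have h1 : eulerSummand L 1 = 1 := by simp [eulerSummand, moebiusSq]
  rw [h1, eulerSummand]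
  simp only [hp.coprime_iff_not_dvd]
  rw [ArithmeticFunction.moebius_apply_prime hp,
    moebiusSq_prime hp, Nat.totient_prime hp, Nat.cast_sub hp.one_le, eulerFactor]
  have hp2 : (2 : ℝ) ≤ p := by exact_mod_cast hp.two_le
  have hp1 : (p : ℝ) - 1 ≠ 0 := by linarith
  by_cases h : p ∣ L
  · simp [h]
  · simp only [h, not_false_eq_true, if_true, if_false]
    push_cast
    field_simp
    ring

theorem eulerSummand_mul (L : ℕ) {m n : ℕ} (h : m.Coprime n) :
    eulerSummand L (m * n) = eulerSummand L m * eulerSummand L n := by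
  have e1 : (μ (m * n) : ℝ) = μ m * μ n := by
    rw [ArithmeticFunction.isMultiplicative_moebius.map_mul_of_coprime h, Int.cast_mul]
  simp only [eulerSummand, Nat.coprime_mul_iff_left, ite_and, moebiusSq_mul h,
    Nat.totient_mul h, e1]
  split_ifs
  · push_cast
    simp only [div_eq_mul_inv, mul_inv]
    ring
  all_goals simp

theorem tsum_eulerSummand {L : ℕ} (hL : L ≠ 0) :
    ∑' c, eulerSummand L c =
      (∏' p : Nat.Primes, eulerFactor p) * ∏ p ∈ L.primeFactors, (eulerFactor p)⁻¹ := by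
  have h1 := EulerProduct.eulerProduct_hasProd (f := eulerSummand L)
    (by simp [eulerSummand, moebiusSq]) (fun h => eulerSummand_mul L h) (summable_eulerSummand L)
    (by simp [eulerSummand])
  simp only [fun p : Nat.Primes => tsum_eulerSummand_prime_pow L p.2] at h1
  let s : Finset Nat.Primes := L.primeFactors.subtype Nat.Prime
  -- The finite product of the factors at `p ∣ L` is multiplied in to complete the Euler product,
  -- and divided out again since no factor is zero.
  have h2 : HasProd (fun p : Nat.Primes => if (p : ℕ) ∣ L then eulerFactor p else 1)
      (∏ p ∈ s, if (p : ℕ) ∣ L then eulerFactor p else 1) := by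
    refine hasProd_prod_of_ne_finset_one fun p hp => if_neg fun hpL => hp ?_
    exact Finset.mem_subtype.2 (Nat.mem_primeFactors.2 ⟨p.2, hpL, hL⟩)
  have h3 : (∏ p ∈ s, if (p : ℕ) ∣ L then eulerFactor p else 1) =
      ∏ p ∈ L.primeFactors, eulerFactor p := by
    refine (Finset.prod_subtype_of_mem (fun p : ℕ => if p ∣ L then eulerFactor p else 1)
      (fun p hp => Nat.prime_of_mem_primeFactors hp)).trans ?_
    exact Finset.prod_congr rfl fun p hp => if_pos (Nat.dvd_of_mem_primeFactors hp)
  have h4 := (h1.mul h2).tprod_eq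
  have h5 : (fun p : Nat.Primes => (if (p : ℕ) ∣ L then 1 else eulerFactor p) *
      if (p : ℕ) ∣ L then eulerFactor p else 1) = fun p : Nat.Primes => eulerFactor p := by
    funext p
    split_ifs <;> simp
  rw [h5, h3] at h4
  rw [h4, Finset.prod_inv_distrib, mul_inv_cancel_right₀]
  exact Finset.prod_ne_zero_iff.2 fun p hp =>
    (eulerFactor_pos (Nat.prime_of_mem_primeFactors hp)).ne'

/-! ### The main term -/

section

variable {W : ℝ → ℂ}

/-- The sums over `d` met below end at `⌊2 * Q⌋₊ / (k * l)`, which may fall short of `2 * Y` through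
rounding. Only the vanishing of later terms is needed. -/
theorem exists_riemann_sum_bound_of_eq_zero (hW : ContDiff ℝ ∞ W)
    (hWsupp : Function.support W ⊆ Set.Icc 1 2) :
    ∃ D : ℝ, 0 ≤ D ∧ ∀ (Y : ℝ) (_ : 0 < Y) (R : ℕ), (∀ d : ℕ, R < d → W (d / Y) = 0) →
      ‖∑ d ∈ Icc 1 R, W (d / Y) - Y * mellin W 1‖ ≤ D * min 1 Y := by
  obtain ⟨D, hD0, hD⟩ := exists_riemann_sum_bound hW hWsupp
  refine ⟨D, hD0, fun Y hY R hR => ?_⟩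
  have h := hD Y hY (max R ⌈2 * Y⌉₊) ((Nat.le_ceil _).trans (by exact_mod_cast le_max_right _ _))
  have e : ∑ d ∈ Icc 1 R, W (d / Y) = ∑ d ∈ Icc 1 (max R ⌈2 * Y⌉₊), W (d / Y) := by
    refine Finset.sum_subset_zero_on_sdiff (fun d hd => ?_) (fun d hd => ?_) fun _ _ => rfl
    · rw [mem_Icc] at hd ⊢
      exact ⟨hd.1, hd.2.trans (le_max_left _ _)⟩
    · rw [mem_sdiff, mem_Icc, mem_Icc] at hd
      refine hR d ?_
      by_contra h
      exact hd.2 ⟨hd.1.1, not_lt.1 h⟩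
  rwa [e]

/-- The weight `∑_{(q, L) = 1} W(q/Q) φ*(q) / φ(q)` of the diagonal terms. -/
def diagonalWeight (W : ℝ → ℂ) (Q : ℝ) (L : ℕ) : ℂ :=
  ∑ q ∈ Icc 1 ⌊2 * Q⌋₊, if q.Coprime L then
    W (q / Q) * (primitiveTotient q : ℂ) / (Nat.totient q : ℂ) else 0

/-- The factorization `q = c d` and the expansion of `rho` reappear; the multiples `d` of `k * l`
are then parametrized, leaving plain Riemann sums of `W` at scale `Q / (c k l)`. -/
theorem diagonalWeight_eq (hWsupp : Function.support W ⊆ Set.Icc 1 2) {Q : ℝ} (hQ : 1 ≤ Q)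
    {L : ℕ} (hL : L ≠ 0) :
    diagonalWeight W Q L = ∑ c ∈ Icc 1 ⌊2 * Q⌋₊, if c.Coprime L then (μ c : ℂ) / c.totient *
      ∑ k ∈ c.divisors, ∑ l ∈ L.divisors, (μ k : ℂ) / k * μ l *
        ∑ d ∈ Icc 1 (⌊2 * Q⌋₊ / (k * l)), W (d / (Q / (c * k * l))) else 0 := by
  let f : ℕ → ℕ → ℂ := fun c d => if (c * d).Coprime L then
    W ((c : ℝ) * d / Q) / ((c * d).totient : ℂ) * ((μ c : ℂ) * (d.totient : ℂ)) else 0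
  have h1 : ∀ q ∈ Icc 1 ⌊2 * Q⌋₊, (if q.Coprime L then
      W (q / Q) * (primitiveTotient q : ℂ) / (Nat.totient q : ℂ) else 0) =
      ∑ x ∈ q.divisorsAntidiagonal, f x.1 x.2 := by
    intro q hq
    have hq0 : q ≠ 0 := by have := (mem_Icc.1 hq).1; omega
    split_ifs with hqL
    · rw [primitiveTotient_eq hq0, mul_div_right_comm, Finset.mul_sum]
      refine Finset.sum_congr rfl fun x hx => ?_
      obtain ⟨hx1, -⟩ := Nat.mem_divisorsAntidiagonal.1 hx
      simp only [f]
      rw [hx1, if_pos hqL, ← Nat.cast_mul, hx1]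
    · symm
      refine Finset.sum_eq_zero fun x hx => ?_
      obtain ⟨hx1, -⟩ := Nat.mem_divisorsAntidiagonal.1 hx
      simp only [f]
      rw [hx1, if_neg hqL]
  rw [diagonalWeight, Finset.sum_congr rfl h1, sum_Icc_divisorsAntidiagonal]
  · refine Finset.sum_congr rfl fun c hc => ?_
    have hc0 : 0 < c := (mem_Icc.1 hc).1
    by_cases hcL : c.Coprime L
    · rw [if_pos hcL]
      have h2 : ∀ k ∈ c.divisors, ∀ l ∈ L.divisors, (μ k : ℂ) / k * μ l *
          ∑ d ∈ Icc 1 (⌊2 * Q⌋₊ / (k * l)), W (d / (Q / (c * k * l))) =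
          ∑ d ∈ Icc 1 ⌊2 * Q⌋₊, (μ k : ℂ) / k * μ l * (if k * l ∣ d then 1 else 0) *
            W ((c : ℝ) * d / Q) := by
        intro k hk l hl
        have hkl : 0 < k * l := Nat.mul_pos (Nat.pos_of_mem_divisors hk)
          (Nat.pos_of_mem_divisors hl)
        have h3 := sum_Icc_dvd (fun d => W ((c : ℝ) * d / Q)) ⌊2 * Q⌋₊ hkl
        simp only [mul_assoc, ← Finset.mul_sum, ite_mul, one_mul, zero_mul]
        rw [h3]
        refine congrArg _ (congrArg _ (Finset.sum_congr rfl fun d _ => ?_))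
        congr 1
        push_cast
        rw [div_div_eq_mul_div]
        ring
      rw [Finset.sum_congr rfl fun k hk => Finset.sum_congr rfl fun l hl => h2 k hk l hl]
      have h4 : ∑ k ∈ c.divisors, ∑ l ∈ L.divisors, ∑ d ∈ Icc 1 ⌊2 * Q⌋₊,
          (μ k : ℂ) / k * μ l * (if k * l ∣ d then 1 else 0) * W ((c : ℝ) * d / Q) =
          ∑ d ∈ Icc 1 ⌊2 * Q⌋₊, (if d.Coprime L then rho c d else 0) * W ((c : ℝ) * d / Q) := by
        simp_rw [ite_coprime_mul_rho hL hcL, Finset.sum_mul]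
        rw [Finset.sum_comm (s := Icc 1 ⌊2 * Q⌋₊)]
        exact Finset.sum_congr rfl fun k _ => Finset.sum_comm
      rw [h4, Finset.mul_sum]
      refine Finset.sum_congr rfl fun d hd => ?_
      have hd0 : 0 < d := (mem_Icc.1 hd).1
      simp only [f]
      by_cases hdL : d.Coprime L
      · rw [if_pos hdL, if_pos (Nat.coprime_mul_iff_left.2 ⟨hcL, hdL⟩)]
        have := rho_eq hc0.ne' hd0.ne'
        calc _ = W ((c : ℝ) * d / Q) * (μ c : ℂ) *
              ((d.totient : ℂ) / ((c * d).totient : ℂ)) := by ring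
          _ = _ := by rw [this]; ring
      · rw [if_neg hdL, if_neg (fun h => hdL (Nat.coprime_mul_iff_left.1 h).2)]
        ring
    · rw [if_neg hcL]
      exact Finset.sum_eq_zero fun d _ =>
        if_neg (fun h => hcL (Nat.coprime_mul_iff_left.1 h).1)
  · intro c d hcd
    simp only [f]
    rw [eq_zero_of_floor_lt hWsupp hQ hcd]
    simp

/-- Replacing each Riemann sum by its density `1 / (c k l)` decouples `k` from `l`: the first sum
becomes `moebiusSq c`, the second `φ(L) / L`. -/
theorem eulerSummand_mul_totient_div {L : ℕ} (hL : L ≠ 0) (c : ℕ) :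
    ((eulerSummand L c * (L.totient / L) : ℝ) : ℂ) = if c.Coprime L then (μ c : ℂ) / c.totient *
      ∑ k ∈ c.divisors, ∑ l ∈ L.divisors, (μ k : ℂ) / k * μ l * (1 / (c * k * l)) else 0 := by
  have h1 : ∑ k ∈ c.divisors, ∑ l ∈ L.divisors, (μ k : ℂ) / k * μ l * (1 / (c * k * l)) =
      1 / c * ((∑ k ∈ c.divisors, (μ k : ℂ) / (k : ℂ) ^ 2) * ∑ l ∈ L.divisors, (μ l : ℂ) / l) := by
    rw [Finset.sum_mul_sum, Finset.mul_sum]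
    refine Finset.sum_congr rfl fun k _ => ?_
    rw [Finset.mul_sum]
    refine Finset.sum_congr rfl fun l _ => ?_
    rw [one_div, mul_inv, mul_inv]
    ring
  rw [h1, sum_divisors_moebius_div L hL, eulerSummand, moebiusSq]
  split_ifs
  · push_cast
    rw [← div_div, one_div, div_right_comm]
    ring
  · simp

/-- The weight and its main term are compared term by term as series over all `c`. The Riemann sum
error `min(1, Y)` remains valid for `c > 2 Q`, where the sum is empty, so the tail of the main
series needs no separate estimate. -/
theorem exists_diagonalWeight_bound (hW : ContDiff ℝ ∞ W)
    (hWsupp : Function.support W ⊆ Set.Icc 1 2) {δ : ℝ} (hδ : 0 < δ) (hδ1 : δ ≤ 1) :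
    ∃ D : ℝ, 0 ≤ D ∧ ∀ (Q : ℝ) (L : ℕ), 1 ≤ Q → L ≠ 0 →
      ‖diagonalWeight W Q L - mellin W 1 * ((∏' p : Nat.Primes, eulerFactor p : ℝ) : ℂ) * Q * r L‖
        ≤ D * L.divisors.card * Q ^ δ := by
  obtain ⟨D, hD0, hD⟩ := exists_riemann_sum_bound_of_eq_zero hW hWsupp
  have hsum := summable_card_divisors_div hδ
  refine ⟨D * ∑' c : ℕ, (c.divisors.card : ℝ) / (c.totient * (c : ℝ) ^ δ),
    mul_nonneg hD0 (tsum_nonneg fun c => by positivity), fun Q L hQ hL => ?_⟩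
  have hQ0 : 0 < Q := by linarith
  let S : ℕ → ℂ := fun c => if c.Coprime L then (μ c : ℂ) / c.totient *
      ∑ k ∈ c.divisors, ∑ l ∈ L.divisors, (μ k : ℂ) / k * μ l *
        ∑ d ∈ Icc 1 (⌊2 * Q⌋₊ / (k * l)), W (d / (Q / (c * k * l))) else 0
  have hvanish : ∀ c k l d : ℕ, ⌊2 * Q⌋₊ < c * k * l * d → W (d / (Q / (c * k * l))) = 0 := by
    intro c k l d h
    have h1 := eq_zero_of_floor_lt hWsupp hQ h
    rw [← h1, div_div_eq_mul_div]
    congr 1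
    push_cast
    ring
  have hS : ∀ c ∉ Icc 1 ⌊2 * Q⌋₊, S c = 0 := by
    intro c hc
    simp only [S]
    split_ifs
    · rcases Nat.eq_zero_or_pos c with rfl | hc0
      · simp
      have hcR : ⌊2 * Q⌋₊ < c := by
        by_contra h
        exact hc (mem_Icc.2 ⟨hc0, not_lt.1 h⟩)
      rw [Finset.sum_eq_zero, mul_zero]
      intro k hk
      refine Finset.sum_eq_zero fun l hl => ?_
      rw [Finset.sum_eq_zero, mul_zero]
      intro d hd
      refine hvanish c k l d (hcR.trans_le ?_)
      rw [mul_assoc, mul_assoc]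
      exact Nat.le_mul_of_pos_right c (Nat.mul_pos (Nat.pos_of_mem_divisors hk)
        (Nat.mul_pos (Nat.pos_of_mem_divisors hl) (mem_Icc.1 hd).1))
    · rfl
  have hS1 : HasSum S (diagonalWeight W Q L) := by
    rw [diagonalWeight_eq hWsupp hQ hL]
    exact hasSum_sum_of_ne_finset_zero hS
  have hE : HasSum (fun c => Q * mellin W 1 * ((eulerSummand L c * (L.totient / L) : ℝ) : ℂ))
      (mellin W 1 * ((∏' p : Nat.Primes, eulerFactor p : ℝ) : ℂ) * Q * r L) := by
    have h1 : HasSum (fun c => eulerSummand L c * (L.totient / L))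
        ((∏' p : Nat.Primes, eulerFactor p) * r L) := by
      have h2 := ((summable_eulerSummand L).of_norm.hasSum).mul_right ((L.totient : ℝ) / L)
      rw [tsum_eulerSummand hL] at h2
      have e : (∏' p : Nat.Primes, eulerFactor p) * r L = (∏' p : Nat.Primes, eulerFactor p) *
          (∏ p ∈ L.primeFactors, (eulerFactor p)⁻¹) * ((L.totient : ℝ) / L) := by
        unfold r
        ring
      rwa [e]
    have h3 := (Complex.hasSum_ofReal.2 h1).mul_left (Q * mellin W 1)
    have e : mellin W 1 * ((∏' p : Nat.Primes, eulerFactor p : ℝ) : ℂ) * Q * r L =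
        Q * mellin W 1 * (((∏' p : Nat.Primes, eulerFactor p) * r L : ℝ) : ℂ) := by
      rw [Complex.ofReal_mul]
      ring
    rwa [e]
  have hdiff := hS1.sub hE
  rw [← hdiff.tsum_eq]
  have hterm : ∀ c : ℕ, ‖S c - Q * mellin W 1 * ((eulerSummand L c * (L.totient / L) : ℝ) : ℂ)‖ ≤
      D * L.divisors.card * Q ^ δ * ((c.divisors.card : ℝ) / (c.totient * (c : ℝ) ^ δ)) := by
    intro c
    rw [eulerSummand_mul_totient_div hL]
    simp only [S]
    split_ifs with hcL
    swap
    · rw [mul_zero, sub_zero, norm_zero]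
      positivity
    rcases Nat.eq_zero_or_pos c with rfl | hc0
    · simp
    have hcR : (0 : ℝ) < c := by exact_mod_cast hc0
    have hφ : (0 : ℝ) < c.totient := by exact_mod_cast Nat.totient_pos.2 hc0
    have h1 : (μ c : ℂ) / c.totient * ∑ k ∈ c.divisors, ∑ l ∈ L.divisors, (μ k : ℂ) / k * μ l *
        ∑ d ∈ Icc 1 (⌊2 * Q⌋₊ / (k * l)), W (d / (Q / (c * k * l))) -
        Q * mellin W 1 * ((μ c : ℂ) / c.totient * ∑ k ∈ c.divisors, ∑ l ∈ L.divisors,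
          (μ k : ℂ) / k * μ l * (1 / (c * k * l))) =
        (μ c : ℂ) / c.totient * ∑ k ∈ c.divisors, ∑ l ∈ L.divisors, (μ k : ℂ) / k * μ l *
        (∑ d ∈ Icc 1 (⌊2 * Q⌋₊ / (k * l)), W (d / (Q / (c * k * l))) -
          ((Q / (c * k * l) : ℝ) : ℂ) * mellin W 1) := by
      rw [mul_left_comm, ← mul_sub]
      refine congrArg _ ?_
      rw [Finset.mul_sum, ← Finset.sum_sub_distrib]
      refine Finset.sum_congr rfl fun k _ => ?_
      rw [Finset.mul_sum, ← Finset.sum_sub_distrib]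
      refine Finset.sum_congr rfl fun l _ => ?_
      push_cast
      ring
    rw [h1, norm_mul, norm_div, Complex.norm_natCast]
    have h2 : ‖∑ k ∈ c.divisors, ∑ l ∈ L.divisors, (μ k : ℂ) / k * μ l *
        (∑ d ∈ Icc 1 (⌊2 * Q⌋₊ / (k * l)), W (d / (Q / (c * k * l))) -
          ((Q / (c * k * l) : ℝ) : ℂ) * mellin W 1)‖ ≤
        ∑ k ∈ c.divisors, ∑ l ∈ L.divisors, D * (Q / c) ^ δ := by
      refine (norm_sum_le _ _).trans (Finset.sum_le_sum fun k hk => (norm_sum_le _ _).trans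
        (Finset.sum_le_sum fun l hl => ?_))
      have hk1 : (1 : ℝ) ≤ k := by exact_mod_cast Nat.pos_of_mem_divisors hk
      have hl1 : (1 : ℝ) ≤ l := by exact_mod_cast Nat.pos_of_mem_divisors hl
      have hY : 0 < Q / (c * k * l) := by positivity
      have h3 := hD (Q / (c * k * l)) hY (⌊2 * Q⌋₊ / (k * l)) (fun d hd => hvanish c k l d (by
        rw [Nat.div_lt_iff_lt_mul (Nat.mul_pos (Nat.pos_of_mem_divisors hk)
          (Nat.pos_of_mem_divisors hl))] at hd
        refine hd.trans_le ?_
        calc d * (k * l) = k * l * d := by ring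
          _ ≤ c * (k * l * d) := Nat.le_mul_of_pos_left _ hc0
          _ = c * k * l * d := by ring))
      have h4 : ‖(μ k : ℂ) / k * μ l‖ ≤ 1 := by
        rw [norm_mul, norm_div, Complex.norm_natCast]
        refine mul_le_one₀ ?_ (norm_nonneg _) (norm_moebius_le_one l)
        exact (div_le_one (by linarith)).2 ((norm_moebius_le_one k).trans hk1)
      -- Interpolating between the two bounds for the error gives the decay in `c` that makes the
      -- error series converge, at the cost of `Q^δ`.
      have h5 : min 1 (Q / (c * k * l)) ≤ (Q / c) ^ δ := by
        have h6 : Q / (c * k * l) ≤ Q / c := by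
          refine div_le_div_of_nonneg_left hQ0.le hcR ?_
          rw [mul_assoc]
          exact le_mul_of_one_le_right hcR.le (one_le_mul_of_one_le_of_one_le hk1 hl1)
        refine (min_le_min le_rfl h6).trans ?_
        have h7 : 0 < Q / c := by positivity
        rcases le_total 1 (Q / c) with h8 | h8
        · exact (min_le_left _ _).trans (Real.one_le_rpow h8 hδ.le)
        · refine (min_le_right _ _).trans ?_
          conv_lhs => rw [← Real.rpow_one (Q / c)]
          exact Real.rpow_le_rpow_of_exponent_ge h7 h8 hδ1
      rw [norm_mul]
      calc _ ≤ 1 * (D * min 1 (Q / (c * k * l))) :=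
            mul_le_mul h4 h3 (norm_nonneg _) zero_le_one
        _ ≤ D * (Q / c) ^ δ := by
            rw [one_mul]
            exact mul_le_mul_of_nonneg_left h5 hD0
    rw [Finset.sum_const, Finset.sum_const, nsmul_eq_mul, nsmul_eq_mul,
      Real.div_rpow hQ0.le hcR.le] at h2
    calc _ ≤ 1 / (c.totient : ℝ) * (c.divisors.card * (L.divisors.card *
          (D * (Q ^ δ / (c : ℝ) ^ δ)))) :=
          mul_le_mul (div_le_div_of_nonneg_right (norm_moebius_le_one c) hφ.le) h2
            (norm_nonneg _) (by positivity)
      _ = _ := by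
          have : (0 : ℝ) < (c : ℝ) ^ δ := Real.rpow_pos_of_pos hcR δ
          field_simp
  refine (tsum_of_norm_bounded (hsum.mul_left _).hasSum hterm).trans (le_of_eq ?_)
  rw [tsum_mul_left]
  ring

end

/-! ### The asymptotic large sieve -/

theorem diagonalCoprime_eq {W : ℝ → ℂ} (hWsupp : Function.support W ⊆ Set.Icc 1 2) {Q : ℝ}
    (hQ : 1 ≤ Q) (X : ℝ) (a b : ℕ → ℂ) (N : ℕ) :
    diagonalCoprime N W Q X a b =
      ∑ n ∈ Icc 1 ⌊X⌋₊, a n * b n * diagonalWeight W Q (n * N) := by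
  rw [diagonalCoprime, tsum_eq_sum_Icc_floor hWsupp hQ _ (fun q hq => by simp [hq])]
  simp only [diagonalWeight, diagonalSum, Finset.sum_filter, Finset.mul_sum]
  rw [Finset.sum_comm]
  refine Finset.sum_congr rfl fun q _ => ?_
  by_cases hqN : q.Coprime N
  · rw [if_pos hqN]
    refine Finset.sum_congr rfl fun n _ => ?_
    have : q.Coprime (n * N) ↔ n.Coprime q := by
      rw [Nat.coprime_mul_iff_right, Nat.coprime_comm]
      exact and_iff_left hqN
    simp only [this]
    split_ifs <;> ring
  · rw [if_neg hqN]
    symm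
    refine Finset.sum_eq_zero fun n _ => ?_
    rw [if_neg (fun h => hqN (Nat.coprime_mul_iff_right.1 h).2), mul_zero]

theorem exists_diagonal_bound {W : ℝ → ℂ} (hW : ContDiff ℝ ∞ W)
    (hWsupp : Function.support W ⊆ Set.Icc 1 2) {η ε : ℝ} (hη : 0 < η) (hεη : ε < η / 2)
    (K : ℝ → ℝ) {N : ℕ} (hN : 1 ≤ N) :
    ∃ C : ℝ, 0 ≤ C ∧ ∀ Q X : ℝ, 1 ≤ Q → X = Q ^ (2 - η) → 1 ≤ X → ∀ a b : ℕ → ℂ,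
      CharSumBound K Q X a → CharSumBound K Q X b →
        ‖diagonalCoprime N W Q X a b - eulerMainTerm N W Q X a b‖ ≤ C * Q ^ (1 - ε) := by
  -- The losses are `Q^(7 δ)`: two from `A²`, two from the harmonic sum, two from the divisor bound
  -- for `n ≤ X ≤ Q²`, and one from the weight.
  obtain ⟨δ, hδ, hδ1, hδε⟩ : ∃ δ : ℝ, 0 < δ ∧ δ ≤ 1 ∧ 7 * δ ≤ η / 2 - ε :=
    ⟨min 1 ((η / 2 - ε) / 7), lt_min one_pos (by linarith), min_le_left _ _, by
      linarith [min_le_right 1 ((η / 2 - ε) / 7)]⟩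
  obtain ⟨D, hD0, hD⟩ := exists_diagonalWeight_bound hW hWsupp hδ hδ1
  obtain ⟨T, hT1, hT⟩ := exists_card_divisors_le δ hδ
  have hT0 : 0 ≤ T := by linarith
  refine ⟨D * |K δ| ^ 2 * T * (N : ℝ) ^ δ * (1 + 1 / δ), by positivity,
    fun Q X hQ hX hX1 a b hacs hbcs => ?_⟩
  have hQ0 : 0 < Q := by linarith
  have ha : LevelBound (|K δ| * Q ^ δ) Q ⌊X⌋₊ a := hacs.levelBound hQ hX1 hδ
  have hb : LevelBound (|K δ| * Q ^ δ) Q ⌊X⌋₊ b := hbcs.levelBound hQ hX1 hδ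
  have hMX : (⌊X⌋₊ : ℝ) ≤ X := Nat.floor_le (by linarith)
  have hXQ : X ≤ Q ^ (2 : ℝ) := by
    rw [hX]
    exact Real.rpow_le_rpow_of_exponent_le hQ (by linarith)
  have hQ2 : (Q ^ (2 : ℝ)) ^ δ = (Q ^ δ) ^ 2 := by
    rw [← Real.rpow_mul hQ0.le, mul_comm (2 : ℝ) δ, Real.rpow_mul hQ0.le, Real.rpow_ofNat]
  rw [diagonalCoprime_eq hWsupp hQ, eulerMainTerm, Finset.mul_sum, ← Finset.sum_sub_distrib]
  have h1 : ∀ n ∈ Icc 1 ⌊X⌋₊, ‖a n * b n * diagonalWeight W Q (n * N) -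
      mellin W 1 * ((∏' p : Nat.Primes, eulerFactor p : ℝ) : ℂ) * (Q : ℂ) *
        (a n * b n * (r (n * N) : ℂ))‖ ≤
      ‖a n * b n‖ * (D * (T * (N : ℝ) ^ δ * (Q ^ δ) ^ 2) * Q ^ δ) := by
    intro n hn
    have hn1 := (mem_Icc.1 hn).1
    have hnN : n * N ≠ 0 := mul_ne_zero (by omega) (by omega)
    have h2 : a n * b n * diagonalWeight W Q (n * N) -
      mellin W 1 * ((∏' p : Nat.Primes, eulerFactor p : ℝ) : ℂ) * (Q : ℂ) *
        (a n * b n * (r (n * N) : ℂ)) = a n * b n * (diagonalWeight W Q (n * N) -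
      mellin W 1 * ((∏' p : Nat.Primes, eulerFactor p : ℝ) : ℂ) * (Q : ℂ) * (r (n * N) : ℂ)) := by
      ring
    rw [h2, norm_mul]
    refine mul_le_mul_of_nonneg_left ((hD Q (n * N) hQ hnN).trans ?_) (norm_nonneg _)
    refine mul_le_mul_of_nonneg_right (mul_le_mul_of_nonneg_left ((hT _ hnN).trans ?_) hD0)
      (by positivity)
    rw [Nat.cast_mul, Real.mul_rpow (Nat.cast_nonneg n) (Nat.cast_nonneg N), ← hQ2,
      mul_comm ((n : ℝ) ^ δ), ← mul_assoc]
    refine mul_le_mul_of_nonneg_left (Real.rpow_le_rpow (Nat.cast_nonneg n) ?_ hδ.le)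
      (by positivity)
    exact ((Nat.cast_le.2 (mem_Icc.1 hn).2).trans hMX).trans hXQ
  refine (norm_sum_le _ _).trans ((Finset.sum_le_sum h1).trans ?_)
  rw [← Finset.sum_mul]
  have h3 : ∑ n ∈ Icc 1 ⌊X⌋₊, ‖a n * b n‖ ≤
      (|K δ| * Q ^ δ) ^ 2 * ((1 + 1 / δ) * (Q ^ δ) ^ 2) := by
    have h4 := sum_norm_mul_le hQ ha hb (g := fun _ => 1) (fun _ => zero_le_one)
    simp only [mul_one] at h4
    refine h4.trans (mul_le_mul_of_nonneg_left ?_ (by positivity))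
    rw [← hQ2]
    exact sum_one_div_le hδ (Real.one_le_rpow hQ (by norm_num)) (hMX.trans hXQ)
  have h5 : (Q ^ δ) ^ 7 ≤ Q ^ (1 - ε) := by
    rw [← Real.rpow_natCast, ← Real.rpow_mul hQ0.le]
    rcases hQ.eq_or_lt with h6 | h6
    · rw [← h6, Real.one_rpow, Real.one_rpow]
    · refine Real.rpow_le_rpow_of_exponent_le hQ ?_
      -- The condition `X ≥ 1` with `Q > 1` forces `η ≤ 2`, hence `7 δ ≤ η / 2 - ε ≤ 1 - ε`.
      have h7 : η ≤ 2 := by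
        by_contra h
        have : X < 1 := by
          rw [hX]
          exact Real.rpow_lt_one_of_one_lt_of_neg h6 (by linarith)
        linarith
      push_cast
      linarith
  calc _ ≤ (|K δ| * Q ^ δ) ^ 2 * ((1 + 1 / δ) * (Q ^ δ) ^ 2) *
        (D * (T * (N : ℝ) ^ δ * (Q ^ δ) ^ 2) * Q ^ δ) :=
        mul_le_mul_of_nonneg_right h3 (by positivity)
    _ = D * |K δ| ^ 2 * T * (N : ℝ) ^ δ * (1 + 1 / δ) * (Q ^ δ) ^ 7 := by ring
    _ ≤ _ := mul_le_mul_of_nonneg_left h5 (by positivity)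

theorem SCoprime_asymptotic {W : ℝ → ℂ} (hW : ContDiff ℝ ∞ W)
    (hWsupp : Function.support W ⊆ Set.Icc 1 2) {η ε : ℝ} (hη : 0 < η) (hεη : ε < η / 2)
    (K : ℝ → ℝ) {N : ℕ} (hN : 1 ≤ N) :
    ∃ C : ℝ, ∀ Q X : ℝ, 1 ≤ Q → X = Q ^ (2 - η) → ∀ a b : ℕ → ℂ,
      CharSumBound K Q X a → CharSumBound K Q X b →
        ‖SCoprime N W Q X a b - diagonalCoprime N W Q X a b‖ ≤ C * Q ^ (1 - ε) ∧
        ‖SCoprime N W Q X a b - eulerMainTerm N W Q X a b‖ ≤ C * Q ^ (1 - ε) := by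
  obtain ⟨C1, hC1, h1⟩ := exists_offDiagonal_bound hW hWsupp hη hεη K hN
  obtain ⟨C2, hC2, h2⟩ := exists_diagonal_bound hW hWsupp hη hεη K hN
  refine ⟨C1 + C2, fun Q X hQ hX a b ha hb => ?_⟩
  have hE : 0 ≤ Q ^ (1 - ε) := Real.rpow_nonneg (by linarith) _
  -- If `η > 2`, then `X < 1` can occur; every sum over `n ≤ X` is then empty.
  rcases lt_or_ge X 1 with hX1 | hX1
  · have hM : ⌊X⌋₊ = 0 := Nat.floor_eq_zero.2 hX1
    have e1 : SCoprime N W Q X a b = 0 := by simp [SCoprime, primitiveSum, hM]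
    have e2 : diagonalCoprime N W Q X a b = 0 := by simp [diagonalCoprime, diagonalSum, hM]
    have e3 : eulerMainTerm N W Q X a b = 0 := by simp [eulerMainTerm, hM]
    rw [e1, e2, e3, sub_zero, norm_zero]
    have : 0 ≤ (C1 + C2) * Q ^ (1 - ε) := by positivity
    exact ⟨this, this⟩
  · have b1 := h1 Q X hQ hX hX1 a b ha hb
    have b2 := h2 Q X hQ hX hX1 a b ha hb
    rw [add_mul]
    refine ⟨b1.trans (le_add_of_nonneg_right (by positivity)), ?_⟩
    rw [← sub_add_sub_cancel _ (diagonalCoprime N W Q X a b)]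
    exact (norm_add_le _ _).trans (add_le_add b1 b2)

theorem S_eq_SCoprime_one (W : ℝ → ℂ) (Q X : ℝ) (a b : ℕ → ℂ) :
    S W Q X a b = SCoprime 1 W Q X a b := by
  simp [S, SCoprime]

theorem diagonal_eq_diagonalCoprime_one (W : ℝ → ℂ) (Q X : ℝ) (a b : ℕ → ℂ) :
    diagonal W Q X a b = diagonalCoprime 1 W Q X a b := by
  simp [diagonal, diagonalCoprime]

end AsymptoticLargeSieve

end

theorem theorem2
    (W : ℝ → ℂ) (hW : ContDiff ℝ ∞ W) (hWsupp : Function.support W ⊆ Set.Icc 1 2)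
    (η ε : ℝ) (hη : 0 < η) (hε : 0 < ε) (hεη : ε < η / 2) (K : ℝ → ℝ) :
    (∃ C : ℝ, ∀ Q X : ℝ, 1 ≤ Q → X = Q ^ (2 - η) → ∀ a b : ℕ → ℂ,
      AsymptoticLargeSieve.CharSumBound K Q X a →
      AsymptoticLargeSieve.CharSumBound K Q X b →
        ‖AsymptoticLargeSieve.S W Q X a b - AsymptoticLargeSieve.diagonal W Q X a b‖
            ≤ C * Q ^ (1 - ε) ∧
        ‖AsymptoticLargeSieve.S W Q X a b - AsymptoticLargeSieve.eulerMainTerm 1 W Q X a b‖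
            ≤ C * Q ^ (1 - ε)) ∧
    (∀ N : ℕ, 1 ≤ N → ∃ C : ℝ, ∀ Q X : ℝ, 1 ≤ Q → X = Q ^ (2 - η) → ∀ a b : ℕ → ℂ,
      AsymptoticLargeSieve.CharSumBound K Q X a →
      AsymptoticLargeSieve.CharSumBound K Q X b →
        ‖AsymptoticLargeSieve.SCoprime N W Q X a b -
            AsymptoticLargeSieve.diagonalCoprime N W Q X a b‖ ≤ C * Q ^ (1 - ε) ∧
        ‖AsymptoticLargeSieve.SCoprime N W Q X a b -
            AsymptoticLargeSieve.eulerMainTerm N W Q X a b‖ ≤ C * Q ^ (1 - ε)) := by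
  refine ⟨?_, fun N hN => AsymptoticLargeSieve.SCoprime_asymptotic hW hWsupp hη hεη K hN⟩
  simp only [AsymptoticLargeSieve.S_eq_SCoprime_one,
    AsymptoticLargeSieve.diagonal_eq_diagonalCoprime_one]
  exact AsymptoticLargeSieve.SCoprime_asymptotic hW hWsupp hη hεη K le_rfl
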